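/- **Theorem 2.2 (Rodrigues type formula).** For an irreducible root system $\Phi$ of rank $l$ of type $P$, with positive system $\Phi^+$ and simple system $\Pi$, let $\Delta(P)$ be the Fomin–Zelevinsky cluster complex: the simplicial complex on the set $\Phi_{\ge -1}=\Phi^{+}\sqcup(-\Pi)$ of almost positive roots whose simplices are the sets of pairwise compatible almost positive roots. (Two almost positive roots $\alpha,\beta$ are compatible if $(\alpha\|\beta)=0$. The compatibility degree is determined by $(-\alpha_i\|\beta)=\max([\beta:\alpha_i],0)$, where $[\beta:\alpha_i]$ is the coefficient of the simple root $\alpha_i$ in $\beta$, and by $(\tau_\varepsilon\alpha\|\tau_\varepsilon\beta)=(\alpha\|\beta)$ for $\varepsilon\in\{+,-\}$. Here $I=I_+\sqcup I_-$ is a two-colouring of the nodes of the Dynkin diagram, and $\tau_\varepsilon$ fixes $-\alpha_i$ for $i\in I_{-\varepsilon}$ and is the product of the simple reflections $s_i$, $i\in I_\varepsilon$, on all other almost positive roots.) Let $f_{i-1}(P)$ be the number of faces of $\Delta(P)$ of dimension $i-1$, let $f_{-1}(P)=1$, and put $$f_P(t)=\sum_{i=0}^{l} f_{i-1}(P)(-t)^i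 .$$ For $n\in\mathbb Z_{\ge 0}$ and real $\alpha,\beta>-1$ let $\widetilde P^{(\alpha,\beta)}_n(t)=P^{(\alpha,\beta)}_n(2t-1)$ be the shifted Jacobi polynomial, where $$P_n^{(\alpha,\beta)}(x)=\frac1{n!}\sum_{k=0}^n\binom nk (n+\alpha+\beta+1)_k\,(\alpha+k+1)_{n-k}\Bigl(\frac{x-1}2\Bigr)^k,\qquad (a)_k=a(a+1)\cdots(a+k-1).$$ Then the following identities of polynomials in $t$ hold. 1. For all $l\ge 1$: $$t(1-t)f_{A_l}(t)=\frac1{(l+1)!}\frac{d^l}{dt^l}\bigl[t^{l+1}(1-t)^{l+1}\bigr],\qquad f_{A_l}(t)=\frac{(-1)^l}{l+1}\widetilde P^{(1,1)}_l(t).$$ 2. For all $l\ge 2$: $$f_{B_l}(t)=\frac1{l!}\frac{d^l}{dt^l}\bigl[t^{l}(1-t)^{l}\bigr],\qquad f_{B_l}(t)=(-1)^l\widetilde P^{(0,0)}_l(t).$$ 3. For all $l\ge 4$: $$f_{D_l}(t)=\frac1{(l-1)!}\frac{d^{l-1}}{dt^{l-1}}\bigl[t^{l-1}(1-t)^{l}\bigr]+\frac1{(l-2)!}\frac{d^{l-2}}{dt^{l-2}}\bigl[t^{l}(1-t)^{l-2}\bigr],$$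 $$f_{D_l}(t)=\frac1{(l-1)!}\frac{d^{l-2}}{dt^{l-2}}\Bigl[t^{l-2}(1-t)^{l-2}\bigl((l-1)-(3l-2)t+(3l-2)t^2\bigr)\Bigr],$$ $$f_{D_l}(t)=(-1)^{l-1}(1-t)\,\widetilde P^{(1,0)}_{l-1}(t)+(-1)^l t^2\,\widetilde P^{(0,2)}_{l-2}(t).$$ -/

import Mathlib

open Polynomial
open scoped Nat Matrix

namespace ClusterComplex

/-- A Cartan matrix, with entries `C i j = ⟨α_i, α_j^∨⟩`, whose Dynkin diagram comes with a
two-colouring of its nodes: distinct nodes of the same colour are not joined. -/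
structure BipartiteCartan (n : ℕ) where
  /-- the Cartan matrix -/
  C : Matrix (Fin n) (Fin n) ℤ
  /-- the colour of a node -/
  sign : Fin n → Bool
  proper : ∀ i j, i ≠ j → sign i = sign j → C i j = 0

variable {n : ℕ}

/-- The simple root `α_i`. Elements of the root lattice are written in coordinates with respect
to the simple roots, so that `v i` is the coefficient of `α_i` in `v`. -/
def simpleRoot (i : Fin n) : Fin n → ℤ := Pi.single i 1

/-- The simple reflection `s_i v = v - ⟨v, α_i^∨⟩ α_i`. -/
def simpleReflection (C : Matrix (Fin n) (Fin n) ℤ) (i : Fin n) (v : Fin n → ℤ) : Fin n → ℤ :=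
  v - (v ᵥ* C) i • simpleRoot i

/-- The root system `Φ` with Cartan matrix `C`: the images of the simple roots under the group
generated by the simple reflections. -/
inductive IsRoot (C : Matrix (Fin n) (Fin n) ℤ) : (Fin n → ℤ) → Prop
  | simple (i : Fin n) : IsRoot C (simpleRoot i)
  | reflect (i : Fin n) (v : Fin n → ℤ) : IsRoot C v → IsRoot C (simpleReflection C i v)

/-- The set `Φ_{≥ -1} = Φ⁺ ⊔ (-Π)` of almost positive roots. -/
def almostPositiveRoots (C : Matrix (Fin n) (Fin n) ℤ) : Set (Fin n → ℤ) :=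
  {v | IsRoot C v ∧ 0 ≤ v} ∪ {v | ∃ i, v = -simpleRoot i}

open Classical in
/-- The maps `τ_ε`: an almost positive root `-α_i` with `i` of the colour opposite to `ε` is
fixed, and on every other almost positive root `τ_ε` is the product of the (pairwise commuting)
simple reflections `s_i` with `i` of colour `ε`. As the roots `α_i` of colour `ε` are pairwise
orthogonal, this product is `v ↦ v - ∑ ⟨v, α_i^∨⟩ α_i`, summed over the `i` of colour `ε`. -/
noncomputable def tau (R : BipartiteCartan n) (ε : Bool) (v : Fin n → ℤ) : Fin n → ℤ :=
  if ∃ i, R.sign i ≠ ε ∧ v = -simpleRoot i then v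
  else v - ∑ i with R.sign i = ε, (v ᵥ* R.C) i • simpleRoot i

/-- The graph of the Fomin-Zelevinsky compatibility degree `(α ‖ β)` on almost positive roots:
`(-α_i ‖ β) = max (coefficient of α_i in β) 0` and `(τ_ε α ‖ τ_ε β) = (α ‖ β)`. -/
inductive HasCompatibilityDegree (R : BipartiteCartan n) : (Fin n → ℤ) → (Fin n → ℤ) → ℤ → Prop
  | base (i : Fin n) (β : Fin n → ℤ) (hβ : β ∈ almostPositiveRoots R.C) :
      HasCompatibilityDegree R (-simpleRoot i) β (max (β i) 0)
  | step (ε : Bool) (α β : Fin n → ℤ) (d : ℤ) : HasCompatibilityDegree R α β d →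
      HasCompatibilityDegree R (tau R ε α) (tau R ε β) d

/-- The cluster complex: its ground set is the set of almost positive roots, and its (non-empty)
faces are the sets of pairwise compatible almost positive roots. -/
def clusterComplex (R : BipartiteCartan n) :
    AbstractSimplicialComplex (almostPositiveRoots R.C) where
  faces := {s | s.Nonempty ∧ (s : Set (almostPositiveRoots R.C)).Pairwise fun α β =>
    HasCompatibilityDegree R α β 0}
  isRelLowerSet_faces := fun _ hs =>
    ⟨hs.1, fun _ hts ht => ⟨ht, hs.2.mono (by exact_mod_cast hts)⟩⟩
  singleton_mem := fun v => ⟨Finset.singleton_nonempty v, by simp⟩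

/-- The number of faces with `i` vertices, that is, of dimension `i - 1`. -/
noncomputable def faceNumber (R : BipartiteCartan n) (i : ℕ) : ℕ :=
  Set.ncard {s ∈ (clusterComplex R).faces | s.card = i}

/-- The `f`-polynomial `∑_{i=0}^n f_{i-1} (-t)^i` of the cluster complex, with `f_{-1} = 1`. -/
noncomputable def fPolynomial (R : BipartiteCartan n) : ℝ[X] :=
  1 + ∑ i ∈ Finset.Icc 1 n, (faceNumber R i : ℝ[X]) * (-X) ^ i

/-- Type `A_l`; the nodes `0, 1, …, l - 1` form a path. -/
def typeA (l : ℕ) : BipartiteCartan l where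
  C := CartanMatrix.A l
  sign i := i.val.bodd
  proper i j hij h := by
    have h1 : i.val + 1 ≠ j.val := fun e => by simp [← e] at h
    have h2 : j.val + 1 ≠ i.val := fun e => by simp [← e] at h
    simp [CartanMatrix.A, hij, h1, h2]

/-- Type `B_l`; the nodes `0, 1, …, l - 1` form a path. -/
def typeB (l : ℕ) : BipartiteCartan l where
  C := CartanMatrix.B l
  sign i := i.val.bodd
  proper i j hij h := by
    have h1 : i.val + 1 ≠ j.val := fun e => by simp [← e] at h
    have h2 : j.val + 1 ≠ i.val := fun e => by simp [← e] at h
    simp [CartanMatrix.B, hij, h1, h2]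

/-- Type `D_l`; the nodes `0, 1, …, l - 2` form a path, and the last node `l - 1` is joined to
the node `l - 3`, so that it has the colour of the node `l - 2`. -/
def typeD (l : ℕ) : BipartiteCartan l where
  C := CartanMatrix.D l
  sign i := if i.val + 1 = l then (l - 2).bodd else i.val.bodd
  proper i j hij h := by
    have hb : ∀ m : ℕ, m.bodd ≠ (m + 1).bodd := fun m => by simp
    have hi := i.2
    have hj := j.2
    have hij' : i.val ≠ j.val := fun e => hij (Fin.ext e)
    have hb1 := hb i.val
    have hb2 := hb j.val
    simp only [CartanMatrix.D, Matrix.of_apply, hij, if_false]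
    split_ifs <;> first | rfl | (exfalso; split_ifs at h <;> grind)

end ClusterComplex

/-- The polynomial `f_{A_l}`. -/
noncomputable def fA (l : ℕ) : ℝ[X] := ClusterComplex.fPolynomial (ClusterComplex.typeA l)

/-- The polynomial `f_{B_l}`. -/
noncomputable def fB (l : ℕ) : ℝ[X] := ClusterComplex.fPolynomial (ClusterComplex.typeB l)

/-- The polynomial `f_{D_l}`. -/
noncomputable def fD (l : ℕ) : ℝ[X] := ClusterComplex.fPolynomial (ClusterComplex.typeD l)

/-- The Jacobi polynomial
`P_n^{(α, β)}(x) = (1/n!) ∑_k (n choose k) (n+α+β+1)_k (α+k+1)_{n-k} ((x-1)/2)^k`,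
where `(a)_k = a (a+1) ⋯ (a+k-1)`, in its standard normalization. -/
noncomputable def jacobi (α β : ℝ) (n : ℕ) : ℝ[X] :=
  C (1 / (n ! : ℝ)) * ∑ k ∈ Finset.range (n + 1),
    C ((n.choose k : ℝ) * (ascPochhammer ℝ k).eval (n + α + β + 1) *
      (ascPochhammer ℝ (n - k)).eval (α + k + 1)) * (C (1 / 2 : ℝ) * (X - 1)) ^ k

/-- The shifted Jacobi polynomial `P_n^{(α, β)}(2t - 1)`. -/
noncomputable def shiftedJacobi (α β : ℝ) (n : ℕ) : ℝ[X] :=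
  (jacobi α β n).comp (2 * X - 1)

/-!
The proof replaces the three cluster complexes by complexes of noncrossing arcs on a surface, counts
the faces of the latter by generating functions, and recognizes Legendre polynomials.

*Models.* Almost positive roots of type `A_l` correspond to the diagonals of an `(l + 3)`-gon, those
of type `B_l` to the arcs in a disc with `l + 1` boundary points and an interior point (that is, to
the centrally symmetric diagonals of a `(2l + 2)`-gon), and those of type `D_l` to the tagged arcs
in a disc with `l` boundary points and a puncture. In each case the negative simple roots are the
edges of a zigzag triangulation, the coordinates of a positive root are the numbers of crossings
with these edges (with a correction for the tags in type `D`), and `τ_+`, `τ_-` act as two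
reflections of the polygon or disc. Compatibility degrees are determined by their values against the negative simple
roots and by invariance under `τ_ε`, and every orbit meets the negative simple roots, so degree zero
means not crossing. The structure `ClusterComplex.Model` lists what has to be checked, and
`Model.fPolynomial_eq` then says that the `f`-polynomial is the polynomial `∑ y ^ #t` over the
noncrossing sets `t` of arcs, at `y = -t`. The models are `modelA`, `modelB` and `modelD`.

*Counting.* Noncrossing sets are sorted by the longest arc over a fixed edge, or by the first radius
(`cliquePoly_eliminate`). For the series `H` of polygon dissections this gives the quadratic
equation `quadratic_of_segments`, whose discriminant is `1 - 2cx + x²` with `c = 1 + 2y = 1 - 2t`.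
The series of type `B` is the inverse of a square root of this discriminant
(`mul_discriminant_root`), which is the generating function of the Legendre polynomials
`P_l(1 - 2t)`; hence `coeff_cyclicSeries` and `fB_eq`. The series of types `A` and `D` are rational
in `x`, `y`, `H` and `H'`, which expresses `f_{A_l}` and `f_{D_l}` by two or three consecutive
Legendre polynomials (`mul_diagCount_eq`, `two_mul_tagged_eq`).

*Formulas.* The Legendre polynomials are defined by the Rodrigues formula in type `B`. The Rodrigues
type formulas in the other types follow from `legendre_add_two` and `legendre_add_two'`. The first
differentiates `(X(1 - X)) ^ (n + 2)` twice before the remaining derivatives are taken, the second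
moves a factor `X` through an iterated derivative. For the formulas with Jacobi polynomials,
coefficients of powers of `s = t - 1` are compared.
-/

/-! ### Clique polynomials -/

section Clique

variable {α β S : Type*} [CommRing S]

open Classical in
/-- The clique polynomial, evaluated at `y`, of the graph with vertex set `s` in which distinct
vertices related by `r` are adjacent: the sum of `y ^ #t` over the cliques `t ⊆ s`. -/
noncomputable def cliquePoly (y : S) (r : α → α → Prop) (s : Finset α) : S :=
  ∑ t ∈ s.powerset, if (t : Set α).Pairwise r then y ^ t.card else 0

@[simp] lemma cliquePoly_empty (y : S) (r : α → α → Prop) : cliquePoly y r ∅ = 1 := by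
  simp [cliquePoly]

lemma cliquePoly_insert [DecidableEq α] (y : S) {r : α → α → Prop} (hr : ∀ a b, r a b → r b a)
    {v : α} [DecidablePred (r v)] {s : Finset α} (hv : v ∉ s) :
    cliquePoly y r (insert v s) = cliquePoly y r s + y * cliquePoly y r (s.filter (r v)) := by
  have : Std.Symm r := ⟨hr⟩
  unfold cliquePoly
  rw [Finset.sum_powerset_insert hv, Finset.mul_sum]
  congr 1
  have hsub : (s.filter (r v)).powerset ⊆ s.powerset :=
    Finset.powerset_mono.2 (Finset.filter_subset _ _)
  rw [← Finset.sum_subset hsub]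
  · refine Finset.sum_congr rfl fun t ht => ?_
    rw [Finset.mem_powerset] at ht
    have hvt : v ∉ t := fun h => hv (Finset.mem_filter.1 (ht h)).1
    have key : ((insert v t : Finset α) : Set α).Pairwise r ↔ (t : Set α).Pairwise r := by
      rw [Finset.coe_insert, Set.pairwise_insert_of_symm]
      exact and_iff_left fun b hb _ => (Finset.mem_filter.1 (ht hb)).2
    rw [Finset.card_insert_of_notMem hvt]
    by_cases h : (t : Set α).Pairwise r
    · rw [if_pos h, if_pos (key.2 h), pow_succ']
    · rw [if_neg h, if_neg (key.not.2 h), mul_zero]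
  · intro t ht ht'
    rw [Finset.mem_powerset] at ht ht'
    have hvt : v ∉ t := fun h => hv (ht h)
    rw [if_neg]
    intro h
    rw [Finset.coe_insert, Set.pairwise_insert_of_symm] at h
    refine ht' fun b hb => Finset.mem_filter.2 ⟨ht hb, h.2 b hb ?_⟩
    rintro rfl
    exact hvt hb

lemma cliquePoly_union [DecidableEq α] (y : S) {r : α → α → Prop} (hr : ∀ a b, r a b → r b a)
    {s t : Finset α} (hd : Disjoint s t) (hst : ∀ a ∈ s, ∀ b ∈ t, r a b) :
    cliquePoly y r (s ∪ t) = cliquePoly y r s * cliquePoly y r t := by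
  classical
  induction t using Finset.strongInduction with
  | H t ih =>
    rcases t.eq_empty_or_nonempty with rfl | ⟨v, hv⟩
    · simp
    · have hve : v ∉ t.erase v := Finset.notMem_erase v t
      have hvs : v ∉ s := fun h => Finset.disjoint_left.1 hd h hv
      have h1 : t.erase v ⊂ t := Finset.erase_ssubset hv
      have h2 : (t.erase v).filter (r v) ⊂ t := lt_of_le_of_lt (Finset.filter_subset _ _) h1
      have e : s ∪ t = insert v (s ∪ t.erase v) := by
        rw [← Finset.union_insert, Finset.insert_erase hv]
      have e2 : (s ∪ t.erase v).filter (r v) = s ∪ (t.erase v).filter (r v) := by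
        rw [Finset.filter_union, Finset.filter_true_of_mem fun a ha => hr _ _ (hst a ha v hv)]
      rw [e, cliquePoly_insert y hr (by simp [hvs]), e2,
        ih _ h1 (hd.mono_right h1.subset) fun a ha b hb => hst a ha b (h1.subset hb),
        ih _ h2 (hd.mono_right h2.subset) fun a ha b hb => hst a ha b (h2.subset hb)]
      conv_rhs => rw [← Finset.insert_erase hv, cliquePoly_insert y hr hve]
      ring

lemma cliquePoly_image [DecidableEq β] (y : S) {r : α → α → Prop} {r' : β → β → Prop} {f : α → β}
    {s : Finset α} (hf : Set.InjOn f s) (hr : ∀ a ∈ s, ∀ b ∈ s, a ≠ b → (r a b ↔ r' (f a) (f b))) :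
    cliquePoly y r' (s.image f) = cliquePoly y r s := by
  classical
  unfold cliquePoly
  symm
  refine Finset.sum_bij (fun t _ => t.image f) ?_ ?_ ?_ ?_
  · intro t ht
    exact Finset.mem_powerset.2 (Finset.image_subset_image (Finset.mem_powerset.1 ht))
  · intro t ht t' ht' h
    have := congrArg (fun u : Finset β => (u : Set β)) h
    simp only [Finset.coe_image] at this
    exact Finset.coe_injective <| (hf.image_eq_image_iff
      (by exact_mod_cast Finset.mem_powerset.1 ht)
      (by exact_mod_cast Finset.mem_powerset.1 ht')).1 this
  · intro u hu
    obtain ⟨t, ht, rfl⟩ := Finset.subset_image_iff.1 (Finset.mem_powerset.1 hu)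
    exact ⟨t, Finset.mem_powerset.2 (by exact_mod_cast ht), rfl⟩
  · intro t ht
    have ht := Finset.mem_powerset.1 ht
    have hft : Set.InjOn f t := hf.mono (by exact_mod_cast ht)
    rw [Finset.card_image_of_injOn hft]
    congr 1
    rw [Finset.coe_image, hft.pairwise_image, eq_iff_iff]
    constructor
    · intro h a ha b hb hab
      exact (hr a (ht ha) b (ht hb) hab).1 (h ha hb hab)
    · intro h a ha b hb hab
      exact (hr a (ht ha) b (ht hb) hab).2 (h ha hb hab)

/-- Sort the cliques by their element in `m` at which `g` is largest, if there is one. -/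
lemma cliquePoly_eliminate [DecidableEq α] (y : S) {r : α → α → Prop}
    (hr : ∀ a b, r a b → r b a) (g : α → ℤ) {s m : Finset α} (hm : m ⊆ s)
    (hg : ∀ a ∈ m, ∀ b ∈ m, r a b → g a = g b → a = b) (link : α → Finset α)
    (hlink : ∀ a ∈ m, ∀ x, x ∈ link a ↔ x ∈ s ∧ r a x ∧ x ≠ a ∧ ¬(x ∈ m ∧ g a < g x)) :
    cliquePoly y r s = cliquePoly y r (s \ m) + ∑ a ∈ m, y * cliquePoly y r (link a) := by
  classical
  induction hn : m.card generalizing m s link with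
  | zero => simp [Finset.card_eq_zero.1 hn]
  | succ n ih =>
    obtain ⟨v, hv, hmax⟩ := Finset.exists_max_image m g (Finset.card_pos.1 (by omega))
    have hvs := hm hv
    have hm' : m.erase v ⊆ s.erase v := Finset.erase_subset_erase v hm
    rw [← Finset.insert_erase hvs, cliquePoly_insert y hr (Finset.notMem_erase v s),
      ih hm' (fun a ha b hb => hg a (Finset.mem_of_mem_erase ha) b (Finset.mem_of_mem_erase hb))
        link ?_ (by rw [Finset.card_erase_of_mem hv]; omega),
      ← Finset.add_sum_erase m _ hv]
    · have e1 : insert v (s.erase v) \ m = s.erase v \ m.erase v := by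
        ext x
        by_cases h : x = v <;> simp [h, hv]
      have e2 : (s.erase v).filter (r v) = link v := by
        ext x
        rw [hlink v hv, Finset.mem_filter, Finset.mem_erase]
        constructor
        · rintro ⟨⟨h1, h2⟩, h3⟩
          exact ⟨h2, h3, h1, fun h => absurd (hmax x h.1) (by omega)⟩
        · rintro ⟨h1, h2, h3, _⟩
          exact ⟨⟨h3, h1⟩, h2⟩
      rw [e1, e2]
      ring
    · intro a ha x
      obtain ⟨hav, ham⟩ := Finset.mem_erase.1 ha
      rw [hlink a ham, Finset.mem_erase, Finset.mem_erase]
      by_cases h : x = v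
      · subst h
        have := hmax a ham
        have h3 : r a x → g a ≠ g x := fun h1 h2 => hav (hg a ham x hv h1 h2)
        constructor
        · rintro ⟨h1, h2, h4, h5⟩
          exact absurd ⟨hv, by have := h3 h2; omega⟩ h5
        · rintro ⟨h1, -⟩
          exact absurd rfl h1.1
      · simp [h]

end Clique

/-! ### Combinatorial models of cluster complexes -/

namespace ClusterComplex

variable {n : ℕ}

lemma simpleRoot_vecMul (C : Matrix (Fin n) (Fin n) ℤ) (i j : Fin n) :
    (simpleRoot i ᵥ* C) j = C i j := by
  simp [simpleRoot]

/-- Reflecting a root in pairwise orthogonal simple roots, in any order, gives a root. -/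
lemma IsRoot.sub_sum {R : BipartiteCartan n} {ε : Bool} {v : Fin n → ℤ} (hv : IsRoot R.C v)
    (s : Finset (Fin n)) (hs : ∀ i ∈ s, R.sign i = ε) :
    IsRoot R.C (v - ∑ i ∈ s, (v ᵥ* R.C) i • simpleRoot i) := by
  classical
  induction s using Finset.induction_on with
  | empty => simpa using hv
  | insert j s hj ih =>
    have h := IsRoot.reflect j _ (ih fun i hi => hs i (Finset.mem_insert_of_mem hi))
    have e : ((v - ∑ i ∈ s, (v ᵥ* R.C) i • simpleRoot i) ᵥ* R.C) j = (v ᵥ* R.C) j := by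
      rw [Matrix.sub_vecMul, Matrix.sum_vecMul, Pi.sub_apply, Finset.sum_apply,
        Finset.sum_eq_zero, sub_zero]
      intro i hi
      rw [Matrix.smul_vecMul, Pi.smul_apply, simpleRoot_vecMul, R.proper i j, smul_zero]
      · rintro rfl
        exact hj hi
      · rw [hs i (Finset.mem_insert_of_mem hi), hs j (Finset.mem_insert_self j s)]
    rw [simpleReflection, e] at h
    rw [Finset.sum_insert hj]
    convert h using 1
    abel

/-- A combinatorial model of the cluster complex of `R`: a finite set `verts` with two involutions
which match the maps `τ_ε` on almost positive roots, and an invariant relation `compat` which is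
the expected one against the negative simple roots. -/
structure Model (R : BipartiteCartan n) (α : Type*) where
  /-- the vertices of the model -/
  verts : Finset α
  /-- the involutions that correspond to `τ_ε` -/
  refl : Bool → α → α
  /-- the almost positive root attached to a vertex -/
  vec : α → Fin n → ℤ
  /-- the vertices attached to the negative simple roots -/
  neg : Fin n → α
  /-- the compatibility relation -/
  compat : α → α → Prop
  diag : ∀ i, R.C i i = 2
  refl_mem : ∀ ε, ∀ x ∈ verts, refl ε x ∈ verts
  refl_refl : ∀ ε, ∀ x ∈ verts, refl ε (refl ε x) = x
  neg_mem : ∀ i, neg i ∈ verts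
  vec_neg : ∀ i, vec (neg i) = -simpleRoot i
  vec_injOn : Set.InjOn vec verts
  vec_nonneg : ∀ x ∈ verts, (∃ i, x = neg i) ∨ 0 ≤ vec x
  vec_surj : ∀ v, IsRoot R.C v → 0 ≤ v → ∃ x ∈ verts, vec x = v
  refl_neg : ∀ ε i, R.sign i ≠ ε → refl ε (neg i) = neg i
  vec_refl : ∀ ε, ∀ x ∈ verts, (∀ i, R.sign i ≠ ε → x ≠ neg i) → ∀ k,
    vec (refl ε x) k = if R.sign k = ε then vec x k - (vec x ᵥ* R.C) k else vec x k
  compat_symm : ∀ x y, compat x y → compat y x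
  compat_refl : ∀ ε, ∀ x ∈ verts, ∀ y ∈ verts, compat x y → compat (refl ε x) (refl ε y)
  compat_neg : ∀ i, ∀ x ∈ verts, compat (neg i) x ↔ vec x i ≤ 0
  /-- Every vertex is reached from the `neg i` by the involutions. -/
  orbit : ∀ P : α → Prop, (∀ i, P (neg i)) → (∀ ε, ∀ x ∈ verts, P x → P (refl ε x)) →
    ∀ x ∈ verts, P x

namespace Model

variable {R : BipartiteCartan n} {α : Type*} (M : Model R α)
include M

/-- On the vertices of a model, `τ_ε` is the given involution. -/
lemma tau_vec (ε : Bool) {x : α} (hx : x ∈ M.verts) :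
    tau R ε (M.vec x) = M.vec (M.refl ε x) := by
  unfold tau
  split_ifs with h
  · obtain ⟨i, hi, h⟩ := h
    rw [← M.vec_neg] at h
    rw [M.vec_injOn hx (M.neg_mem i) h, M.refl_neg ε i hi]
  · funext k
    rw [M.vec_refl ε x hx fun i hi hxi => h ⟨i, hi, by rw [hxi, M.vec_neg]⟩]
    simp only [simpleRoot, Pi.sub_apply, Finset.sum_apply, Pi.smul_apply, smul_eq_mul]
    split_ifs with hk
    · congr 1
      rw [Finset.sum_eq_single k]
      · simp
      · intro b _ hb
        simp [hb.symm]
      · simp [hk]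
    · rw [Finset.sum_eq_zero, sub_zero]
      intro b hb
      have : k ≠ b := by
        rintro rfl
        exact hk (Finset.mem_filter.1 hb).2
      simp [this]

lemma isRoot_vec {x : α} (hx : x ∈ M.verts) : IsRoot R.C (M.vec x) := by
  refine M.orbit (fun x => IsRoot R.C (M.vec x)) (fun i => ?_) (fun ε x hx h => ?_) x hx
  · have h := IsRoot.reflect i _ (IsRoot.simple (C := R.C) i)
    rw [simpleReflection, simpleRoot_vecMul, M.diag] at h
    rw [M.vec_neg]
    convert h using 1
    module
  · rw [← M.tau_vec ε hx, tau]
    split_ifs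
    · exact h
    · exact h.sub_sum _ fun i hi => (Finset.mem_filter.1 hi).2

lemma vec_mem {x : α} (hx : x ∈ M.verts) : M.vec x ∈ almostPositiveRoots R.C := by
  rcases M.vec_nonneg x hx with ⟨i, rfl⟩ | h
  · exact Or.inr ⟨i, M.vec_neg i⟩
  · exact Or.inl ⟨M.isRoot_vec hx, h⟩

lemma exists_vec_eq {v : Fin n → ℤ} (hv : v ∈ almostPositiveRoots R.C) :
    ∃ x ∈ M.verts, M.vec x = v := by
  rcases hv with ⟨h, h0⟩ | ⟨i, rfl⟩
  · exact M.vec_surj v h h0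
  · exact ⟨_, M.neg_mem i, M.vec_neg i⟩

/-- Compatibility degree zero means compatible in the model. Both implications rest on invariance
under the reflections: one is an induction on how a degree is computed, the other moves one of the
two roots to a negative simple root. -/
lemma hasCompatibilityDegree_zero_iff {x y : α} (hx : x ∈ M.verts) (hy : y ∈ M.verts) :
    HasCompatibilityDegree R (M.vec x) (M.vec y) 0 ↔ M.compat x y := by
  constructor
  · have key : ∀ a b d, HasCompatibilityDegree R a b d → ∃ x ∈ M.verts, ∃ y ∈ M.verts,
        M.vec x = a ∧ M.vec y = b ∧ (d = 0 → M.compat x y) := by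
      intro a b d h
      induction h with
      | base i β hβ =>
        obtain ⟨y, hy, rfl⟩ := M.exists_vec_eq hβ
        refine ⟨_, M.neg_mem i, y, hy, M.vec_neg i, rfl, fun h => ?_⟩
        rw [M.compat_neg i y hy]
        exact max_eq_right_iff.1 h
      | step ε a b d _ ih =>
        obtain ⟨x, hx, y, hy, rfl, rfl, h⟩ := ih
        exact ⟨_, M.refl_mem ε x hx, _, M.refl_mem ε y hy, (M.tau_vec ε hx).symm,
          (M.tau_vec ε hy).symm, fun hd => M.compat_refl ε x hx y hy (h hd)⟩
    intro h
    obtain ⟨x', hx', y', hy', h1, h2, h3⟩ := key _ _ _ h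
    rw [← M.vec_injOn hx' hx h1, ← M.vec_injOn hy' hy h2]
    exact h3 rfl
  · refine M.orbit (fun x => ∀ y ∈ M.verts, M.compat x y →
      HasCompatibilityDegree R (M.vec x) (M.vec y) 0) ?_ ?_ x hx y hy
    · intro i y hy h
      rw [M.compat_neg i y hy] at h
      have := HasCompatibilityDegree.base (R := R) i (M.vec y) (M.vec_mem hy)
      rwa [max_eq_right h, ← M.vec_neg] at this
    · intro ε x hx ih y hy h
      have hy' := M.refl_mem ε y hy
      have h' := M.compat_refl ε _ (M.refl_mem ε x hx) y hy h
      rw [M.refl_refl ε x hx] at h'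
      have := HasCompatibilityDegree.step ε _ _ _ (ih _ hy' h')
      rwa [M.tau_vec ε hx, M.tau_vec ε hy', M.refl_refl ε y hy] at this

open Classical in
lemma faceNumber_eq {i : ℕ} (hi : i ≠ 0) : faceNumber R i =
    (M.verts.powerset.filter fun t : Finset α =>
      (t : Set α).Pairwise M.compat ∧ t.card = i).card := by
  let e : M.verts → almostPositiveRoots R.C := fun x => ⟨M.vec x, M.vec_mem x.2⟩
  have he : Function.Injective e := fun x y h =>
    Subtype.ext (M.vec_injOn x.2 y.2 (congrArg Subtype.val h))
  let F : {t : Finset α // t ⊆ M.verts} → Finset (almostPositiveRoots R.C) := fun t =>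
    t.1.attach.map ⟨fun x : {z // z ∈ t.1} => e ⟨x.1, t.2 x.2⟩,
      fun x y h => Subtype.ext (congrArg (fun z : M.verts => z.1) (he h))⟩
  have hF : ∀ t x, x ∈ F t ↔ ∃ z, ∃ hz : z ∈ t.1, e ⟨z, t.2 hz⟩ = x := by
    intro t x
    simp only [F, Finset.mem_map, Finset.mem_attach, true_and]
    constructor
    · rintro ⟨z, rfl⟩
      exact ⟨z.1, z.2, rfl⟩
    · rintro ⟨z, hz, rfl⟩
      exact ⟨⟨z, hz⟩, rfl⟩
  rw [faceNumber, ← Set.ncard_coe_finset]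
  symm
  refine Set.ncard_congr (fun t ht => F ⟨t, ?_⟩) ?_ ?_ ?_
  · exact Finset.mem_powerset.1 (Finset.mem_filter.1 ht).1
  · intro t ht
    obtain ⟨h1, h2, h3⟩ := Finset.mem_filter.1 ht
    have h1 := Finset.mem_powerset.1 h1
    have hc : (F ⟨t, h1⟩).card = i := by simp [F, h3]
    refine ⟨⟨Finset.card_ne_zero.1 (hc ▸ hi), ?_⟩, hc⟩
    intro a ha b hb hab
    obtain ⟨x, hx, rfl⟩ := (hF _ _).1 ha
    obtain ⟨y, hy, rfl⟩ := (hF _ _).1 hb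
    refine (M.hasCompatibilityDegree_zero_iff (h1 hx) (h1 hy)).2 (h2 hx hy ?_)
    rintro rfl
    exact hab rfl
  · intro t t' ht ht' h
    ext z
    have h1 := Finset.mem_powerset.1 (Finset.mem_filter.1 ht).1
    have h1' := Finset.mem_powerset.1 (Finset.mem_filter.1 ht').1
    constructor
    · intro hz
      have := (hF ⟨t, h1⟩ (e ⟨z, h1 hz⟩)).2 ⟨z, hz, rfl⟩
      rw [h] at this
      obtain ⟨z', hz', e'⟩ := (hF _ _).1 this
      have hz'' : z' = z := congrArg (fun w : M.verts => w.1) (he e')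
      rwa [← hz'']
    · intro hz
      have := (hF ⟨t', h1'⟩ (e ⟨z, h1' hz⟩)).2 ⟨z, hz, rfl⟩
      rw [← h] at this
      obtain ⟨z', hz', e'⟩ := (hF _ _).1 this
      have hz'' : z' = z := congrArg (fun w : M.verts => w.1) (he e')
      rwa [← hz'']
  · rintro u ⟨⟨hu0, hu⟩, hui⟩
    have hs : (M.verts.filter fun x => ∃ a ∈ u, M.vec x = a) ⊆ M.verts := Finset.filter_subset _ _
    have hFu : F ⟨_, hs⟩ = u := by
      ext a
      rw [hF]
      constructor
      · rintro ⟨z, hz, rfl⟩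
        obtain ⟨-, b, hb, hzb⟩ := Finset.mem_filter.1 hz
        have : e ⟨z, hs hz⟩ = b := Subtype.ext hzb
        rwa [this]
      · intro ha
        obtain ⟨x, hx, hxa⟩ := M.exists_vec_eq a.2
        exact ⟨x, Finset.mem_filter.2 ⟨hx, a, ha, hxa⟩, Subtype.ext hxa⟩
    refine ⟨_, Finset.mem_filter.2 ⟨Finset.mem_powerset.2 hs, ?_, ?_⟩, hFu⟩
    · intro x hx y hy hxy
      obtain ⟨hx, a, ha, hxa⟩ := Finset.mem_filter.1 hx
      obtain ⟨hy, b, hb, hyb⟩ := Finset.mem_filter.1 hy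
      rw [← M.hasCompatibilityDegree_zero_iff hx hy, hxa, hyb]
      refine hu ha hb fun hab => hxy (M.vec_injOn hx hy ?_)
      rw [hxa, hyb, hab]
    · have := congrArg Finset.card hFu
      rw [hui] at this
      simpa [F] using this

/-- The `f`-polynomial is the clique polynomial of the model. The bound on the degree says that
there are no faces with more than `n` vertices. -/
lemma fPolynomial_eq
    (hdeg : (cliquePoly (-X : ℝ[X]) M.compat M.verts).natDegree ≤ n) :
    fPolynomial R = cliquePoly (-X) M.compat M.verts := by
  classical
  have hpow : ∀ i j : ℕ, ((-X : ℝ[X]) ^ i).coeff j = if i = j then (-1) ^ j else 0 := by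
    intro i j
    rw [neg_pow, ← C_1, ← C_neg, ← C_pow, coeff_C_mul, coeff_X_pow]
    by_cases h : i = j
    · simp [h]
    · simp [h, Ne.symm h]
  have hcl : ∀ i, (cliquePoly (-X : ℝ[X]) M.compat M.verts).coeff i =
      ((M.verts.powerset.filter fun t : Finset α =>
        (t : Set α).Pairwise M.compat ∧ t.card = i).card : ℝ) * (-1) ^ i := by
    intro i
    rw [cliquePoly, finsetSum_coeff, Finset.card_filter, Nat.cast_sum, Finset.sum_mul]
    refine Finset.sum_congr rfl fun t _ => ?_
    by_cases h : (t : Set α).Pairwise M.compat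
    · rw [if_pos h, hpow]
      by_cases h' : t.card = i <;> simp [h, h']
    · simp [h]
  ext j
  rw [hcl, fPolynomial, coeff_add, finsetSum_coeff]
  simp only [← C_eq_natCast, coeff_C_mul, hpow]
  rcases Nat.eq_zero_or_pos j with rfl | hj
  · rw [Finset.sum_eq_zero]
    · have : (M.verts.powerset.filter fun t : Finset α =>
          (t : Set α).Pairwise M.compat ∧ t.card = 0) = {∅} := by
        ext t
        simp only [Finset.mem_filter, Finset.mem_powerset, Finset.card_eq_zero,
          Finset.mem_singleton]
        constructor
        · exact fun h => h.2.2
        · rintro rfl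
          simp
      rw [this]
      simp
    · intro i hi
      rw [if_neg (by have := (Finset.mem_Icc.1 hi).1; omega), mul_zero]
  · rw [coeff_one, if_neg hj.ne', zero_add]
    by_cases hjn : j ≤ n
    · rw [Finset.sum_eq_single_of_mem j (Finset.mem_Icc.2 ⟨hj, hjn⟩)]
      · rw [if_pos rfl, M.faceNumber_eq hj.ne']
      · intro i _ hij
        rw [if_neg hij, mul_zero]
    · rw [← hcl, coeff_eq_zero_of_natDegree_lt (by omega), Finset.sum_eq_zero]
      intro i hi
      rw [if_neg (by have := (Finset.mem_Icc.1 hi).2; omega), mul_zero]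

end Model

/-! ### Chords in a strip -/

/-- The bijection `ℤ → ℕ` which lists the integers as `0, -1, 1, -2, 2, …`. The chords that join
consecutive integers of this list form a zigzag (snake) triangulation of a polygon whose vertices
are the integers of an interval around `0`. -/
def strip (x : ℤ) : ℤ := if 0 ≤ x then 2 * x else -2 * x - 1

/-- The inverse of `strip`. -/
def unstrip (m : ℤ) : ℤ := if m % 2 = 0 then m / 2 else -((m + 1) / 2)

/-- The indicator function of the half line `[a, ∞)`. -/
def step (a k : ℤ) : ℤ := if a ≤ k then 1 else 0

/-- For a chord joining the `a`-th and the `b`-th vertex of the zigzag, the number of its crossings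
with the `k`-th edge of the zigzag, which joins the vertices `k + 1` and `k + 2`; it is `-1` if the
two chords coincide. -/
def chordVec (a b k : ℤ) : ℤ := step (min a b) k - step (max a b) (k + 2)

/-- The lower end of the `i`-th edge of the zigzag. -/
def snakeLo (i : ℤ) : ℤ := -((i + 3) / 2)

/-- The upper end of the `i`-th edge of the zigzag. -/
def snakeHi (i : ℤ) : ℤ := (i + 2) / 2

/-- The centre, doubled, of the reflection of `ℤ` that corresponds to `τ_ε`. -/
def centre (ε : Bool) : ℤ := if ε then 0 else -1

/-- The effect of a reflection on the positions in the list `strip` of the vertices of an `m`-gon: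
positions of parity `e` move up, the others move down, as far as the list permits. -/
def IsStripRefl (m e a a' : ℤ) : Prop :=
  (a % 2 = e → (a + 1 < m → a' = a + 1) ∧ (a + 1 = m → a' = a)) ∧
  (a % 2 ≠ e → (0 < a → a' = a - 1) ∧ (a = 0 → a' = a))

lemma bodd_eq_decide (n : ℕ) : n.bodd = decide ((n : ℤ) % 2 = 1) := by
  have := Nat.mod_two_of_bodd n
  cases h : n.bodd <;> simp_all <;> omega

lemma chordVec_comm (a b k : ℤ) : chordVec a b k = chordVec b a k := by
  rw [chordVec, chordVec, min_comm, max_comm]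

lemma chordVec_of_lt {a b : ℤ} (h : a < b) (k : ℤ) :
    chordVec a b k = step a k - step b (k + 2) := by
  rw [chordVec, min_eq_left h.le, max_eq_right h.le]

lemma step_refl (e a k : ℤ) (he : e = 0 ∨ e = 1) :
    step (if a % 2 = e then a + 1 else a - 1) k =
      if k % 2 = e then step a (k - 1) + step a (k + 1) - step a k else step a k := by
  unfold step
  rcases he with rfl | rfl <;> split_ifs <;> omega

lemma chordVec_refl_of_lt {m e a b a' b' k : ℤ} (he : e = 0 ∨ e = 1) (ha : 0 ≤ a) (hab : a < b)
    (hb : b < m) (ha' : IsStripRefl m e a a') (hb' : IsStripRefl m e b b')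
    (hne : ¬(b = a + 1 ∧ a % 2 = e)) (hm : b ≠ a + 1 ∨ b + 1 ≠ m) (h1 : b ≠ 1)
    (hk : 0 ≤ k) (hkm : k + 3 < m) :
    chordVec a' b' k = if k % 2 = e then
      chordVec a b (k - 1) + chordVec a b (k + 1) - chordVec a b k else chordVec a b k := by
  obtain ⟨ha1, ha2⟩ := ha'
  obtain ⟨hb1, hb2⟩ := hb'
  have hlt : a' < b' := by omega
  have e1 : step a' k = step (if a % 2 = e then a + 1 else a - 1) k := by
    unfold step
    split_ifs <;> omega
  have e2 : step b' (k + 2) = step (if b % 2 = e then b + 1 else b - 1) (k + 2) := by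
    unfold step
    split_ifs <;> omega
  simp only [chordVec_of_lt hlt, chordVec_of_lt hab, e1, e2, step_refl _ _ _ he]
  have e3 : (k + 2) % 2 = k % 2 := by omega
  rw [e3, show k - 1 + 2 = k + 2 - 1 by ring, show k + 1 + 2 = k + 2 + 1 by ring]
  split_ifs <;> ring

/-- Away from the fixed edges of the zigzag, the chord vectors transform under the reflections as
the root vectors do under the products of simple reflections of one colour. -/
lemma chordVec_refl {m e a b a' b' k : ℤ} (he : e = 0 ∨ e = 1) (ha : 0 ≤ a) (hb : 0 ≤ b)
    (hab : a ≠ b) (ham : a < m) (hbm : b < m)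
    (ha' : IsStripRefl m e a a') (hb' : IsStripRefl m e b b')
    (hne : ¬(b = a + 1 ∧ a % 2 = e)) (hne' : ¬(a = b + 1 ∧ b % 2 = e))
    (h0 : ¬(a + b = 1)) (h1 : ¬(a + b + 3 = 2 * m))
    (hk : 0 ≤ k) (hkm : k + 3 < m) :
    chordVec a' b' k = if k % 2 = e then
      chordVec a b (k - 1) + chordVec a b (k + 1) - chordVec a b k else chordVec a b k := by
  rcases lt_or_gt_of_ne hab with h | h
  · exact chordVec_refl_of_lt he ha h hbm ha' hb' hne (by omega) (by omega) hk hkm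
  · rw [chordVec_comm a' b']
    simp only [chordVec_comm a b]
    exact chordVec_refl_of_lt he hb h ham hb' ha' hne' (by omega) (by omega) hk hkm

/-- A sum over `Fin l` of a function supported at a single integer. -/
lemma sum_fin_ite_eq (l : ℕ) (f : ℤ → ℤ) (m : ℤ) :
    ∑ j : Fin l, (if ((j : ℕ) : ℤ) = m then f j else 0) = if 0 ≤ m ∧ m < l then f m else 0 := by
  split_ifs with h
  · rw [Finset.sum_eq_single ⟨m.toNat, by omega⟩]
    · have : ((m.toNat : ℕ) : ℤ) = m := by omega
      simp [this]
    · intro b _ hb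
      rw [if_neg]
      rintro rfl
      exact hb (Fin.ext (by simp))
    · simp
  · refine Finset.sum_eq_zero fun j _ => if_neg ?_
    have := j.2
    omega

/-- Induction over an interval of integers from any starting point. -/
lemma int_interval_induction {m M q₀ : ℤ} (h1 : m ≤ q₀) (h2 : q₀ ≤ M) {Q : ℤ → Prop} (h : Q q₀)
    (hQ : ∀ q, m ≤ q → q + 1 ≤ M → (Q q ↔ Q (q + 1))) : ∀ q, m ≤ q → q ≤ M → Q q := by
  have up : ∀ n : ℕ, q₀ + n ≤ M → Q (q₀ + n) := by
    intro n
    induction n with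
    | zero => simpa using fun _ => h
    | succ n ih =>
      intro hn
      push_cast at hn ⊢
      rw [← add_assoc, ← hQ _ (by omega) (by omega)]
      exact ih (by omega)
  have down : ∀ n : ℕ, m ≤ q₀ - n → Q (q₀ - n) := by
    intro n
    induction n with
    | zero => simpa using fun _ => h
    | succ n ih =>
      intro hn
      push_cast at hn ⊢
      rw [hQ _ (by omega) (by omega)]
      convert ih (by omega) using 1
      ring
  intro q hq hq'
  rcases le_total q₀ q with h | h
  · have := up (q - q₀).toNat (by omega)
    rwa [show q₀ + ((q - q₀).toNat : ℤ) = q by omega] at this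
  · have := down (q₀ - q).toNat (by omega)
    rwa [show q₀ - ((q₀ - q).toNat : ℤ) = q by omega] at this

/-- The diagonals of the polygon with vertices the integers from `lo` to `hi`. -/
noncomputable def diagonals (lo hi : ℤ) : Finset (ℤ × ℤ) :=
  (Finset.Icc lo hi ×ˢ Finset.Icc lo hi).filter fun p => p.1 + 2 ≤ p.2 ∧ ¬(p.1 = lo ∧ p.2 = hi)

lemma mem_diagonals {lo hi : ℤ} {p : ℤ × ℤ} : p ∈ diagonals lo hi ↔
    lo ≤ p.1 ∧ p.1 + 2 ≤ p.2 ∧ p.2 ≤ hi ∧ ¬(p.1 = lo ∧ p.2 = hi) := by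
  simp only [diagonals, Finset.mem_filter, Finset.mem_product, Finset.mem_Icc]
  omega

/-- Two diagonals do not cross. -/
def Noncrossing (p q : ℤ × ℤ) : Prop :=
  ¬(p.1 < q.1 ∧ q.1 < p.2 ∧ p.2 < q.2) ∧ ¬(q.1 < p.1 ∧ p.1 < q.2 ∧ q.2 < p.2)

/-! ### Type A -/

lemma vecMul_cartanA (l : ℕ) (f : ℤ → ℤ) (h1 : f (-1) = 0) (h2 : f l = 0) (k : Fin l) :
    ((fun i : Fin l => f i) ᵥ* CartanMatrix.A l) k = 2 * f k - f (k - 1) - f (k + 1) := by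
  have hk := k.2
  have e : ∀ j : Fin l, f j * CartanMatrix.A l j k =
      2 * (if ((j : ℕ) : ℤ) = k then f j else 0) - (if ((j : ℕ) : ℤ) = k - 1 then f j else 0) -
        (if ((j : ℕ) : ℤ) = k + 1 then f j else 0) := by
    intro j
    simp only [CartanMatrix.A, Matrix.of_apply, Fin.ext_iff]
    split_ifs <;> omega
  simp only [Matrix.vecMul, dotProduct, e, Finset.sum_sub_distrib, ← Finset.mul_sum,
    sum_fin_ite_eq]
  have e1 : (if 0 ≤ (k : ℤ) - 1 ∧ (k : ℤ) - 1 < l then f (k - 1) else 0) = f (k - 1) := by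
    split_ifs with h
    · rfl
    · rw [show (k : ℤ) - 1 = -1 by omega, h1]
  have e2 : (if 0 ≤ (k : ℤ) + 1 ∧ (k : ℤ) + 1 < l then f (k + 1) else 0) = f (k + 1) := by
    split_ifs with h
    · rfl
    · rw [show (k : ℤ) + 1 = l by omega, h2]
  rw [e1, e2, if_pos (by omega)]

/-- The reflection of a diagonal of the polygon with vertices `lo, …, hi` in the centre `c / 2`. An
end that would leave the polygon stays where it is, as it is fixed by the reflection. -/
def reflDiagonal (lo hi c : ℤ) (p : ℤ × ℤ) : ℤ × ℤ :=
  if hi < c - p.1 then (p.1, c - p.2) else if c - p.2 < lo then (c - p.1, p.2)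
  else (c - p.2, c - p.1)

/-- The first vertex of the polygon that models type `A_l`. -/
def loA (l : ℕ) : ℤ := -(((l : ℤ) + 3) / 2)

/-- The last vertex of the polygon with `l + 3` vertices that models type `A_l`. -/
def hiA (l : ℕ) : ℤ := loA l + l + 2

lemma isStripRefl_strip {m x : ℤ} (ε : Bool) {x' : ℤ}
    (h0 : -(m / 2) ≤ x) (h1 : x ≤ -(m / 2) + m - 1)
    (hx : x' = if -(m / 2) + m - 1 < centre ε - x ∨ centre ε - x < -(m / 2) then x
      else centre ε - x) :
    IsStripRefl m (if ε then 1 else 0) (strip x) (strip x') := by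
  subst hx
  unfold IsStripRefl strip centre
  cases ε <;> simp only [if_true, if_false, Bool.false_eq_true] <;> split_ifs <;> omega

lemma sign_eq_iff (k : ℕ) (ε : Bool) : k.bodd = ε ↔ (k : ℤ) % 2 = if ε then 1 else 0 := by
  rw [bodd_eq_decide]
  cases ε <;> simp

lemma reflDiagonal_mem {lo hi : ℤ} {l : ℕ} (hlo : lo = loA l) (hhi : hi = hiA l) (ε : Bool)
    {p : ℤ × ℤ} (hp : p ∈ diagonals lo hi) : reflDiagonal lo hi (centre ε) p ∈ diagonals lo hi := by
  rw [mem_diagonals] at *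
  subst hlo hhi
  unfold reflDiagonal centre hiA loA at *
  cases ε <;> simp only [if_true, if_false, Bool.false_eq_true] <;> split_ifs <;> grind

lemma reflDiagonal_reflDiagonal {lo hi : ℤ} {l : ℕ} (hlo : lo = loA l) (hhi : hi = hiA l) (ε : Bool)
    {p : ℤ × ℤ} (hp : p ∈ diagonals lo hi) :
    reflDiagonal lo hi (centre ε) (reflDiagonal lo hi (centre ε) p) = p := by
  obtain ⟨a, b⟩ := p
  rw [mem_diagonals] at *
  subst hlo hhi
  unfold reflDiagonal centre hiA loA at *
  cases ε <;> simp only [if_true, if_false, Bool.false_eq_true] <;> split_ifs <;>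
    simp_all <;> omega

lemma noncrossing_reflDiagonal {lo hi : ℤ} {l : ℕ} (hlo : lo = loA l) (hhi : hi = hiA l) (ε : Bool)
    {p q : ℤ × ℤ} (hp : p ∈ diagonals lo hi) (hq : q ∈ diagonals lo hi) (h : Noncrossing p q) :
    Noncrossing (reflDiagonal lo hi (centre ε) p) (reflDiagonal lo hi (centre ε) q) := by
  rw [mem_diagonals] at *
  subst hlo hhi
  unfold Noncrossing at *
  unfold reflDiagonal centre hiA loA at *
  cases ε <;> simp only [if_true, if_false, Bool.false_eq_true] at * <;> split_ifs <;>
    dsimp only at * <;> omega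

/-- The roots of type `A_l` are differences `e_a - e_b`, since the simple reflections permute the
`e_a`. -/
lemma isRoot_cartanA {l : ℕ} {v : Fin l → ℤ} (hv : IsRoot (CartanMatrix.A l) v) :
    ∃ a b : ℤ, 0 ≤ a ∧ a ≤ l ∧ 0 ≤ b ∧ b ≤ l ∧ a ≠ b ∧ ∀ k : Fin l, v k = step a k - step b k := by
  induction hv with
  | simple i =>
    have := i.2
    refine ⟨i, i + 1, by omega, by omega, by omega, by omega, by omega, fun k => ?_⟩
    simp only [simpleRoot, Pi.single_apply, step, Fin.ext_iff]
    split_ifs <;> omega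
  | reflect i v _ ih =>
    obtain ⟨a, b, ha, hal, hb, hbl, hab, h⟩ := ih
    have hi := i.2
    have hv : v = fun k : Fin l => (fun k : ℤ => step a k - step b k) k := funext h
    let s : ℤ → ℤ := fun x => if x = i then i + 1 else if x = i + 1 then i else x
    refine ⟨s a, s b, ?_, ?_, ?_, ?_, ?_, fun k => ?_⟩
    iterate 5 exact by simp only [s]; split_ifs <;> omega
    have e := vecMul_cartanA l (fun k : ℤ => step a k - step b k)
      (by simp only [step]; split_ifs <;> omega) (by simp only [step]; split_ifs <;> omega) i
    rw [← hv] at e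
    simp only [simpleReflection, Pi.sub_apply, Pi.smul_apply, simpleRoot, Pi.single_apply, e, h k,
      smul_eq_mul, Fin.ext_iff]
    have key : ∀ x : ℤ, step (s x) k = step x k - (2 * step x i - step x (i - 1) - step x (i + 1)) *
        (if (k : ℕ) = i then 1 else 0) := by
      intro x
      simp only [step, s]
      split_ifs <;> omega
    rw [key a, key b]
    ring

/-- A chord of an `(l + 3)`-gon other than an edge is determined by its chord vector. -/
lemma chordVec_inj_of_lt {l a b c d : ℤ} (ha : 0 ≤ a) (hab : a < b) (hb : b < l + 3)
    (hab' : b ≠ a + 2) (h1 : b ≠ 1) (h2 : a ≠ l + 1) (hc : 0 ≤ c) (hcd : c < d) (hd : d < l + 3)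
    (hcd' : d ≠ c + 2) (h1' : d ≠ 1) (h2' : c ≠ l + 1)
    (h : ∀ k, 0 ≤ k → k < l → chordVec a b k = chordVec c d k) : a = c ∧ b = d := by
  simp only [chordVec_of_lt hab, chordVec_of_lt hcd, step] at h
  by_cases e1 : b = a + 1
  · have k1 := h (a - 1) (by omega) (by omega)
    split_ifs at k1 <;> omega
  · by_cases e2 : d = c + 1
    · have k1 := h (c - 1) (by omega) (by omega)
      split_ifs at k1 <;> omega
    · have k1 := h a (by omega) (by omega)
      have k2 := h c (by omega) (by omega)
      have k3 := h (b - 3) (by omega) (by omega)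
      have k4 := h (d - 3) (by omega) (by omega)
      have : a = c := by
        clear k3 k4
        split_ifs at k1 <;> split_ifs at k2 <;> omega
      subst this
      clear k1 k2
      refine ⟨rfl, ?_⟩
      split_ifs at k3 <;> split_ifs at k4 <;> omega

lemma chordVec_inj {l a b c d : ℤ} (ha : 0 ≤ a) (hb : 0 ≤ b) (hab : a ≠ b) (hal : a < l + 3)
    (hbl : b < l + 3) (hab' : b ≠ a + 2 ∧ a ≠ b + 2) (h1 : a + b ≠ 1) (h2 : a + b ≠ 2 * l + 3)
    (hc : 0 ≤ c) (hd : 0 ≤ d) (hcd : c ≠ d) (hcl : c < l + 3)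
    (hdl : d < l + 3) (hcd' : d ≠ c + 2 ∧ c ≠ d + 2) (h1' : c + d ≠ 1) (h2' : c + d ≠ 2 * l + 3)
    (h : ∀ k, 0 ≤ k → k < l → chordVec a b k = chordVec c d k) :
    (a = c ∧ b = d) ∨ (a = d ∧ b = c) := by
  rcases lt_or_gt_of_ne hab with hab | hab <;> rcases lt_or_gt_of_ne hcd with hcd | hcd
  · have := chordVec_inj_of_lt (l := l) ha hab hbl (by omega) (by omega) (by omega)
      hc hcd hdl (by omega)
      (by omega) (by omega) h
    omega
  · have := chordVec_inj_of_lt (l := l) ha hab hbl (by omega) (by omega) (by omega)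
      hd hcd hcl (by omega)
      (by omega) (by omega) fun k h0 hk => by rw [h k h0 hk, chordVec_comm]
    omega
  · have := chordVec_inj_of_lt (l := l) hb hab hal (by omega) (by omega) (by omega)
      hc hcd hdl (by omega)
      (by omega) (by omega) fun k h0 hk => by rw [← h k h0 hk, chordVec_comm]
    omega
  · have := chordVec_inj_of_lt (l := l) hb hab hal (by omega) (by omega) (by omega)
      hd hcd hcl (by omega)
      (by omega) (by omega) fun k h0 hk => by rw [chordVec_comm, h k h0 hk, chordVec_comm]
    omega

lemma chordVec_neg_one {a b : ℤ} (ha : 0 ≤ a) (hb : 0 ≤ b) (h : a + b ≠ 1) (hab : a ≠ b) :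
    chordVec a b (-1) = 0 := by
  unfold chordVec step
  split_ifs <;> omega

lemma chordVec_last {l a b : ℤ} (ha : a ≤ l + 2) (hb : b ≤ l + 2) (h : a + b ≠ 2 * l + 3)
    (hab : a ≠ b) : chordVec a b l = 0 := by
  unfold chordVec step
  split_ifs <;> omega

/-- The model of the cluster complex of type `A_l`: the diagonals of a polygon with `l + 3`
vertices, where compatible diagonals are those which do not cross. -/
noncomputable def modelA (l : ℕ) : Model (typeA l) (ℤ × ℤ) where
  verts := diagonals (loA l) (hiA l)
  refl ε := reflDiagonal (loA l) (hiA l) (centre ε)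
  vec p k := chordVec (strip p.1) (strip p.2) k
  neg i := (snakeLo i, snakeHi i)
  compat := Noncrossing
  diag i := by simp [typeA, CartanMatrix.A]
  refl_mem ε _ hx := reflDiagonal_mem rfl rfl ε hx
  refl_refl ε _ hx := reflDiagonal_reflDiagonal rfl rfl ε hx
  neg_mem i := by
    have := i.2
    rw [mem_diagonals]
    unfold snakeLo snakeHi hiA loA
    dsimp only
    omega
  vec_neg i := by
    funext k
    simp only [simpleRoot, Pi.neg_apply, Pi.single_apply, Fin.ext_iff]
    unfold chordVec step strip snakeLo snakeHi
    split_ifs <;> omega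
  vec_injOn := by
    rintro ⟨a, b⟩ hp ⟨c, d⟩ hq h
    rw [Finset.mem_coe, mem_diagonals] at hp hq
    have h' : ∀ k : ℤ, 0 ≤ k → k < l →
        chordVec (strip a) (strip b) k = chordVec (strip c) (strip d) k := by
      intro k hk hkl
      have := congrFun h ⟨k.toNat, by omega⟩
      simpa [hk] using this
    have hlo : loA l = -(((l : ℤ) + 3) / 2) := rfl
    unfold hiA at hp hq
    rw [hlo] at hp hq
    dsimp only at hp hq
    have := chordVec_inj (l := l) ?_ ?_ ?_ ?_ ?_ ?_ ?_ ?_ ?_ ?_ ?_ ?_ ?_ ?_ ?_ ?_ h'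
    · ext <;> unfold strip at this <;> dsimp only <;> split_ifs at this <;> omega
    all_goals unfold strip; split_ifs <;> omega
  vec_nonneg := by
    rintro ⟨a, b⟩ hp
    rw [mem_diagonals] at hp
    unfold hiA loA at hp
    dsimp only at hp
    by_cases h : strip a = strip b + 1 ∨ strip b = strip a + 1
    · left
      have h0 : strip a = strip b + 1 → 0 ≤ strip b - 1 ∧ strip b - 1 < l := by
        unfold strip; split_ifs <;> omega
      have h1 : strip b = strip a + 1 → 0 ≤ strip a - 1 ∧ strip a - 1 < l := by
        unfold strip; split_ifs <;> omega
      refine ⟨⟨b - a - 2 |>.toNat, ?_⟩, ?_⟩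
      · unfold strip at h; split_ifs at h <;> omega
      · unfold strip snakeLo snakeHi at *
        ext <;> simp <;> split_ifs at h <;> omega
    · right
      intro k
      simp only [Pi.zero_apply]
      unfold chordVec step strip at *
      split_ifs <;> omega
  vec_surj := by
    intro v hv h0
    obtain ⟨a, b, ha, hal, hb, hbl, hab, h⟩ := isRoot_cartanA hv
    have hlt : a < b := by
      by_contra hba
      have := h0 ⟨b.toNat, by omega⟩
      rw [h] at this
      simp only [step, Pi.zero_apply, hb, Int.toNat_of_nonneg] at this
      split_ifs at this <;> omega
    refine ⟨(min (unstrip a) (unstrip (b + 2)), max (unstrip a) (unstrip (b + 2))), ?_, ?_⟩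
    · rw [mem_diagonals]
      unfold unstrip hiA loA
      dsimp only
      split_ifs <;> omega
    · funext k
      rw [h]
      have e1 : strip (unstrip a) = a := by unfold unstrip strip; split_ifs <;> omega
      have e2 : strip (unstrip (b + 2)) = b + 2 := by unfold unstrip strip; split_ifs <;> omega
      dsimp only
      rcases le_total (unstrip a) (unstrip (b + 2)) with hm | hm
      · rw [min_eq_left hm, max_eq_right hm, e1, e2, chordVec_of_lt (by omega)]
        simp [step]
      · rw [min_eq_right hm, max_eq_left hm, e1, e2, chordVec_comm, chordVec_of_lt (by omega)]
        simp [step]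
  refl_neg ε i hi := by
    have := i.2
    simp only [typeA] at hi
    rw [Ne, sign_eq_iff] at hi
    unfold reflDiagonal snakeLo snakeHi centre hiA loA
    cases ε <;> simp only [if_true, if_false, Bool.false_eq_true] at * <;> split_ifs <;> ext <;>
      dsimp only <;> omega
  vec_refl ε p hp hne k := by
    have hk := k.2
    obtain ⟨a, b⟩ := p
    rw [mem_diagonals] at hp
    have hs : (typeA l).sign k = ε ↔ ((k : ℕ) : ℤ) % 2 = if ε then 1 else 0 := sign_eq_iff k ε
    unfold hiA loA at hp
    dsimp only at hp
    have ha0 : 0 ≤ strip a := by unfold strip; split_ifs <;> omega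
    have hb0 : 0 ≤ strip b := by unfold strip; split_ifs <;> omega
    have hal : strip a < l + 3 := by unfold strip; split_ifs <;> omega
    have hbl : strip b < l + 3 := by unfold strip; split_ifs <;> omega
    have hab : strip a ≠ strip b := by unfold strip; split_ifs <;> omega
    have h0 : strip a + strip b ≠ 1 := by unfold strip; split_ifs <;> omega
    have h1 : strip a + strip b ≠ 2 * l + 3 := by unfold strip; split_ifs <;> omega
    have he : (if ε then 1 else 0 : ℤ) = 0 ∨ (if ε then 1 else 0 : ℤ) = 1 := by cases ε <;> simp
    have hsnake : ∀ i : ℤ, 0 ≤ i → i < l → ¬(i % 2 = if ε then 1 else 0) →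
        ¬(a = snakeLo i ∧ b = snakeHi i) := by
      intro i hi hil hie h
      have e : ((i.toNat : ℕ) : ℤ) = i := by omega
      refine hne ⟨i.toNat, by omega⟩ ?_ ?_
      · simp only [typeA]
        rw [Ne, sign_eq_iff, e]
        exact hie
      · simp only [e, h]
    have hC : ((fun k : Fin l => chordVec (strip a) (strip b) k) ᵥ* (typeA l).C) k = _ :=
      vecMul_cartanA l (chordVec (strip a) (strip b))
        (chordVec_neg_one ha0 hb0 h0 hab) (chordVec_last (by omega) (by omega) h1 hab) k
    simp only [hs, hC]
    have hr : ∀ x, a = x ∨ b = x → IsStripRefl (l + 3) (if ε then 1 else 0) (strip x)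
        (strip (if hiA l < centre ε - x ∨ centre ε - x < loA l then x else centre ε - x)) :=
      fun x hx => isStripRefl_strip ε (by omega) (by omega) (by
        unfold hiA loA
        congr 3
        rw [add_sub_assoc, add_sub_assoc, add_assoc]
        norm_num)
    have key := chordVec_refl he ha0 hb0 hab hal hbl (hr a (Or.inl rfl)) (hr b (Or.inr rfl)) ?_ ?_
      h0 (by omega) (k := k) (by omega) (by omega)
    · have e : chordVec (strip (reflDiagonal (loA l) (hiA l) (centre ε) (a, b)).1)
          (strip (reflDiagonal (loA l) (hiA l) (centre ε) (a, b)).2) k =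
          chordVec (strip (if hiA l < centre ε - a ∨ centre ε - a < loA l then a else centre ε - a))
          (strip (if hiA l < centre ε - b ∨ centre ε - b < loA l then b else centre ε - b)) k := by
        unfold reflDiagonal hiA loA
        cases ε <;> simp only [centre, if_true, if_false, Bool.false_eq_true] <;>
          split_ifs <;> first | (exfalso; omega) | rfl | exact chordVec_comm _ _ _
      rw [e, key]
      split_ifs <;> ring
    · intro h
      refine hsnake (strip a - 1) ?_ ?_ ?_ ?_
      · omega
      · omega
      · split_ifs at * <;> omega
      · unfold strip snakeLo snakeHi at *
        split_ifs at * <;> omega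
    · intro h
      refine hsnake (strip b - 1) ?_ ?_ ?_ ?_
      · omega
      · omega
      · split_ifs at * <;> omega
      · unfold strip snakeLo snakeHi at *
        split_ifs at * <;> omega
  compat_symm _ _ h := ⟨h.2, h.1⟩
  compat_refl ε _ hx _ hy h := noncrossing_reflDiagonal rfl rfl ε hx hy h
  compat_neg i p hp := by
    rw [mem_diagonals] at hp
    unfold Noncrossing chordVec step strip snakeLo snakeHi hiA loA at *
    dsimp only at *
    split_ifs <;> omega
  orbit P h0 h := by
    rintro ⟨a, b⟩ hp
    rw [mem_diagonals] at hp
    dsimp only at hp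
    have hd := hp
    unfold hiA loA at hd
    obtain ⟨i, hi⟩ : ∃ i : Fin l, ((i : ℕ) : ℤ) + 2 = b - a :=
      ⟨⟨(b - a - 2).toNat, by omega⟩, by simp; omega⟩
    have := i.2
    have key := int_interval_induction (m := loA l + (b - a)) (M := hiA l) (q₀ := snakeHi i)
      (by unfold snakeHi loA; omega) (by unfold snakeHi hiA loA; omega)
      (Q := fun q => P (q - (b - a), q)) ?_ ?_ b (by omega) (by omega)
    · simpa using key
    · convert h0 i using 2
      unfold snakeLo snakeHi
      omega
    · intro q hq hq'
      obtain ⟨p, hp'⟩ : ∃ p, q - (b - a) = p := ⟨_, rfl⟩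
      have hp1 : p + 1 = q + 1 - (b - a) := by omega
      rw [hp', ← hp1]
      have hpos : (p, q) ∈ diagonals (loA l) (hiA l) := by
        rw [mem_diagonals]
        dsimp only
        omega
      have hpos' : (p + 1, q + 1) ∈ diagonals (loA l) (hiA l) := by
        rw [mem_diagonals]
        dsimp only
        unfold hiA loA at *
        omega
      have e1 : reflDiagonal (loA l) (hiA l) (centre false) (p, q) = (-1 - q, -1 - p) := by
        unfold reflDiagonal centre hiA loA at *
        simp only [if_false, Bool.false_eq_true]
        split_ifs <;> first | rfl | (exfalso; omega)
      have e2 : reflDiagonal (loA l) (hiA l) (centre true) (-1 - q, -1 - p) = (p + 1, q + 1) := by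
        unfold reflDiagonal centre hiA loA at *
        simp only [if_true]
        split_ifs <;> first | (exfalso; omega) | (ext <;> dsimp only <;> omega)
      have m1 := reflDiagonal_mem rfl rfl false hpos
      rw [e1] at m1
      have e1' := reflDiagonal_reflDiagonal rfl rfl false hpos
      have e2' := reflDiagonal_reflDiagonal rfl rfl true m1
      rw [e1] at e1'
      rw [e2] at e2'
      constructor
      · intro hP
        have := h true _ m1 (e1 ▸ h false _ hpos hP)
        rwa [e2] at this
      · intro hP
        have := h false _ m1 (e2' ▸ h true _ hpos' hP)
        rwa [e1'] at this

/-! ### Arcs in a disc with one marked interior point -/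

/-- The arcs `(a, b)` in a disc with `N` boundary points, numbered by the residue classes modulo
`N`, that go from `a` to `b` and pass on a fixed side of a point in the interior, so that
`2 ≤ b - a ≤ N`. Arcs which differ by a translation by `N` are identified, and the representative is
the one with `0 ≤ b < N`. Equivalently, these are the centrally symmetric pairs of diagonals and the
diameters (`b - a = N`) of a `2N`-gon. -/
noncomputable def cyclicArcs (N : ℤ) : Finset (ℤ × ℤ) :=
  (Finset.Icc (-N) N ×ˢ Finset.Icc 0 (N - 1)).filter fun p => p.1 + 2 ≤ p.2 ∧ p.2 ≤ p.1 + N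

lemma mem_cyclicArcs {N : ℤ} {p : ℤ × ℤ} : p ∈ cyclicArcs N ↔
    0 ≤ p.2 ∧ p.2 < N ∧ p.1 + 2 ≤ p.2 ∧ p.2 ≤ p.1 + N := by
  simp only [cyclicArcs, Finset.mem_filter, Finset.mem_product, Finset.mem_Icc]
  omega

/-- Two arcs do not cross. An arc with negative first end passes over the gap between the points
`N - 1` and `0`; two such arcs do not cross when they are nested. -/
def NoncrossingCyclic (N : ℤ) (p q : ℤ × ℤ) : Prop :=
  (0 ≤ p.1 → 0 ≤ q.1 → Noncrossing p q) ∧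
  (0 ≤ p.1 → q.1 < 0 → ¬(p.1 < q.2 ∧ q.2 < p.2) ∧ ¬(p.1 < q.1 + N ∧ q.1 + N < p.2)) ∧
  (p.1 < 0 → 0 ≤ q.1 → ¬(q.1 < p.2 ∧ p.2 < q.2) ∧ ¬(q.1 < p.1 + N ∧ p.1 + N < q.2)) ∧
  (p.1 < 0 → q.1 < 0 → (q.1 ≤ p.1 ∧ p.2 ≤ q.2) ∨ (p.1 ≤ q.1 ∧ q.2 ≤ p.2))

lemma NoncrossingCyclic.symm {N : ℤ} {p q : ℤ × ℤ} (h : NoncrossingCyclic N p q) :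
    NoncrossingCyclic N q p :=
  ⟨fun h1 h2 => ⟨(h.1 h2 h1).2, (h.1 h2 h1).1⟩, fun h1 h2 => h.2.2.1 h2 h1,
    fun h1 h2 => h.2.1 h2 h1, fun h1 h2 => (h.2.2.2 h2 h1).symm⟩

/-- The reflection of an arc in the centre `c / 2`. -/
def reflArc (N c : ℤ) (p : ℤ × ℤ) : ℤ × ℤ :=
  if c - p.1 < 0 then (c - p.2 + N, c - p.1 + N) else
  if N ≤ c - p.1 then (c - p.2 - N, c - p.1 - N) else (c - p.2, c - p.1)

lemma reflArc_mem {N : ℤ} (ε : Bool) {p : ℤ × ℤ} (hp : p ∈ cyclicArcs N) :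
    reflArc N (centre ε) p ∈ cyclicArcs N := by
  rw [mem_cyclicArcs] at *
  unfold reflArc centre
  cases ε <;> simp only [if_true, if_false, Bool.false_eq_true] <;> split_ifs <;>
    dsimp only <;> omega

lemma reflArc_reflArc {N : ℤ} (ε : Bool) {p : ℤ × ℤ} (hp : p ∈ cyclicArcs N) :
    reflArc N (centre ε) (reflArc N (centre ε) p) = p := by
  rw [mem_cyclicArcs] at hp
  unfold reflArc centre
  cases ε <;> simp only [if_true, if_false, Bool.false_eq_true] <;> ext <;> split_ifs <;>
    dsimp only at * <;> omega

lemma noncrossingCyclic_reflArc {N : ℤ} (ε : Bool) {p q : ℤ × ℤ} (hp : p ∈ cyclicArcs N)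
    (hq : q ∈ cyclicArcs N) (h : NoncrossingCyclic N p q) :
    NoncrossingCyclic N (reflArc N (centre ε) p) (reflArc N (centre ε) q) := by
  rw [mem_cyclicArcs] at *
  unfold NoncrossingCyclic Noncrossing at *
  unfold reflArc centre
  cases ε <;> simp only [if_true, if_false, Bool.false_eq_true] <;> split_ifs <;>
    dsimp only at * <;> omega

/-- The reflections generate the translations, and a translation takes an arc to an edge of the
zigzag. -/
lemma reflArc_orbit {N : ℤ} (P : ℤ × ℤ → Prop)
    (h0 : ∀ i, 0 ≤ i → i + 2 ≤ N → P (snakeLo i, snakeHi i))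
    (h : ∀ ε, ∀ x ∈ cyclicArcs N, P x → P (reflArc N (centre ε) x)) :
    ∀ x ∈ cyclicArcs N, P x := by
  rintro ⟨a, b⟩ hp
  rw [mem_cyclicArcs] at hp
  dsimp only at hp
  have key := int_interval_induction (m := 0) (M := N - 1) (q₀ := snakeHi (b - a - 2))
    (by unfold snakeHi; omega) (by unfold snakeHi; omega)
    (Q := fun q => P (q - (b - a), q)) ?_ ?_ b (by omega) (by omega)
  · simpa using key
  · convert h0 (b - a - 2) (by omega) (by omega) using 2
    unfold snakeLo snakeHi
    omega
  · intro q hq hq'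
    have hpos : (q - (b - a), q) ∈ cyclicArcs N := by
      rw [mem_cyclicArcs]
      dsimp only
      omega
    have hpos' : (q + 1 - (b - a), q + 1) ∈ cyclicArcs N := by
      rw [mem_cyclicArcs]
      dsimp only
      omega
    have e2 : reflArc N (centre true) (reflArc N (centre false) (q - (b - a), q)) =
        (q + 1 - (b - a), q + 1) := by
      unfold reflArc centre
      simp only [if_false, Bool.false_eq_true, if_true]
      ext <;> dsimp only <;> split_ifs <;> dsimp only at * <;> omega
    have m1 := reflArc_mem false hpos
    have e1' := reflArc_reflArc false hpos
    have e2' := reflArc_reflArc true m1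
    rw [e2] at e2'
    constructor
    · intro hP
      have := h true _ m1 (h false _ hpos hP)
      rwa [e2] at this
    · intro hP
      have := h false _ m1 (e2' ▸ h true _ hpos' hP)
      rwa [e1'] at this

lemma strip_add_of_neg {N x : ℤ} (hx : x < 0) (hN : -N ≤ x) :
    strip (x + N) = 2 * N - 1 - strip x := by
  unfold strip
  split_ifs <;> omega

lemma strip_sub_of_nonneg {N x : ℤ} (hx : 0 ≤ x) (hN : x < N) :
    strip (x - N) = 2 * N - 1 - strip x := by
  unfold strip
  split_ifs <;> omega

lemma strip_bounds {N : ℤ} {p : ℤ × ℤ} (hp : p ∈ cyclicArcs N) :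
    0 ≤ strip p.1 ∧ strip p.1 < 2 * N ∧ 0 ≤ strip p.2 ∧ strip p.2 < 2 * N ∧
    strip p.1 ≠ strip p.2 ∧ strip p.2 ≠ strip p.1 + 2 ∧ strip p.1 ≠ strip p.2 + 2 ∧
    strip p.1 + strip p.2 ≠ 1 ∧ strip p.1 + strip p.2 + 3 ≠ 4 * N := by
  rw [mem_cyclicArcs] at hp
  unfold strip
  split_ifs <;> omega

/-- Every diagonal of a `2N`-gon, given by the positions of its ends in the zigzag, comes from an
arc, up to the central symmetry. -/
lemma exists_arc_strip {N a c : ℤ} (ha : 0 ≤ a) (hac : a + 3 ≤ c) (hc : c < 2 * N) :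
    ∃ p ∈ cyclicArcs N, (strip p.1 = a ∧ strip p.2 = c) ∨ (strip p.1 = c ∧ strip p.2 = a) ∨
      (strip p.1 = 2 * N - 1 - a ∧ strip p.2 = 2 * N - 1 - c) ∨
      (strip p.1 = 2 * N - 1 - c ∧ strip p.2 = 2 * N - 1 - a) := by
  obtain ⟨p, q, hpq, hp, hq, h⟩ : ∃ p q : ℤ, p < q ∧ -N ≤ p ∧ q < N ∧
      ((strip p = a ∧ strip q = c) ∨ (strip p = c ∧ strip q = a)) := by
    rcases lt_or_ge (unstrip a) (unstrip c) with h | h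
    · refine ⟨_, _, h, ?_, ?_, Or.inl ?_⟩ <;> unfold unstrip at * <;> (try unfold strip) <;>
        split_ifs <;>
        omega
    · refine ⟨unstrip c, unstrip a, ?_, ?_, ?_, Or.inr ?_⟩ <;> unfold unstrip at * <;>
        (try unfold strip) <;> split_ifs at * <;> omega
  have h2 : p + 2 ≤ q ∧ q - p + 2 ≤ 2 * N := by
    unfold strip at h
    split_ifs at h <;> omega
  by_cases h3 : q < 0
  · have e1 := strip_add_of_neg (N := N) (x := p) (by omega) (by omega)
    have e2 := strip_add_of_neg (N := N) (x := q) (by omega) (by omega)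
    refine ⟨(p + N, q + N), ?_, ?_⟩
    · rw [mem_cyclicArcs]
      dsimp only
      omega
    · dsimp only
      omega
  · by_cases h4 : q - p ≤ N
    · refine ⟨(p, q), ?_, ?_⟩
      · rw [mem_cyclicArcs]
        dsimp only
        omega
      · dsimp only
        omega
    · have e1 := strip_add_of_neg (N := N) (x := p) (by omega) (by omega)
      have e2 := strip_sub_of_nonneg (N := N) (x := q) (by omega) (by omega)
      refine ⟨(q - N, p + N), ?_, ?_⟩
      · rw [mem_cyclicArcs]
        dsimp only
        omega
      · dsimp only
        omega

lemma arc_ext_of_strip {N : ℤ} {p q : ℤ × ℤ} (hp : p ∈ cyclicArcs N) (hq : q ∈ cyclicArcs N)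
    (h : (strip p.1 = strip q.1 ∧ strip p.2 = strip q.2) ∨
      (strip p.1 = strip q.2 ∧ strip p.2 = strip q.1) ∨
      (strip p.1 = 2 * N - 1 - strip q.1 ∧ strip p.2 = 2 * N - 1 - strip q.2) ∨
      (strip p.1 = 2 * N - 1 - strip q.2 ∧ strip p.2 = 2 * N - 1 - strip q.1)) : p = q := by
  rw [mem_cyclicArcs] at *
  have : p.1 = q.1 ∧ p.2 = q.2 := by
    unfold strip at h
    split_ifs at h <;> omega
  exact Prod.ext this.1 this.2

lemma chordVec_mirror {m a b k : ℤ} :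
    chordVec (m - 1 - a) (m - 1 - b) k = chordVec a b (m - 4 - k) := by
  unfold chordVec step
  split_ifs <;> omega

lemma arc_eq_snake {N : ℤ} {p : ℤ × ℤ} (hp : p ∈ cyclicArcs N)
    (h : strip p.2 = strip p.1 + 1 ∨ strip p.1 = strip p.2 + 1) :
    p = (snakeLo (p.2 - p.1 - 2), snakeHi (p.2 - p.1 - 2)) := by
  rw [mem_cyclicArcs] at hp
  unfold strip at h
  unfold snakeLo snakeHi
  ext <;> dsimp only <;> split_ifs at h <;> omega

/-- The chord of a reflected arc is, up to the central symmetry, the reflected chord. -/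
lemma exists_isStripRefl_reflArc {N : ℤ} (ε : Bool) {p : ℤ × ℤ} (hp : p ∈ cyclicArcs N) :
    ∃ a b, IsStripRefl (2 * N) (if ε then 1 else 0) (strip p.1) a ∧
      IsStripRefl (2 * N) (if ε then 1 else 0) (strip p.2) b ∧
      ((strip (reflArc N (centre ε) p).1 = b ∧ strip (reflArc N (centre ε) p).2 = a) ∨
      (strip (reflArc N (centre ε) p).1 = 2 * N - 1 - b ∧
        strip (reflArc N (centre ε) p).2 = 2 * N - 1 - a)) := by
  rw [mem_cyclicArcs] at hp
  have e1 : 2 * N / 2 = N := by omega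
  have hr : ∀ x, -N ≤ x → x < N → IsStripRefl (2 * N) (if ε then 1 else 0) (strip x) (strip
      (if -(2 * N / 2) + 2 * N - 1 < centre ε - x ∨ centre ε - x < -(2 * N / 2) then x
        else centre ε - x)) :=
    fun x hx hx' => isStripRefl_strip ε (by omega) (by omega) rfl
  refine ⟨_, _, hr p.1 (by omega) (by omega), hr p.2 (by omega) (by omega), ?_⟩
  unfold strip reflArc centre
  cases ε <;> simp only [if_true, if_false, Bool.false_eq_true] <;> split_ifs <;>
    dsimp only at * <;> omega

/-! ### Type B -/

lemma vecMul_cartanB (l : ℕ) (f : ℤ → ℤ) (h1 : f (-1) = 0) (h2 : f l = f (l - 2)) (k : Fin l) :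
    ((fun i : Fin l => f i) ᵥ* CartanMatrix.B l) k = 2 * f k - f (k - 1) - f (k + 1) := by
  have hk := k.2
  have e : ∀ j : Fin l, f j * CartanMatrix.B l j k =
      2 * (if ((j : ℕ) : ℤ) = k then f j else 0) -
        (if (k : ℕ) = l - 1 then 2 else 1) * (if ((j : ℕ) : ℤ) = k - 1 then f j else 0) -
        (if ((j : ℕ) : ℤ) = k + 1 then f j else 0) := by
    intro j
    simp only [CartanMatrix.B, Matrix.of_apply, Fin.ext_iff]
    split_ifs <;> omega
  simp only [Matrix.vecMul, dotProduct, e, Finset.sum_sub_distrib, ← Finset.mul_sum,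
    sum_fin_ite_eq]
  have e1 : (if 0 ≤ (k : ℤ) - 1 ∧ (k : ℤ) - 1 < l then f (k - 1) else 0) = f (k - 1) := by
    split_ifs with h
    · rfl
    · rw [show (k : ℤ) - 1 = -1 by omega, h1]
  rw [e1, if_pos (by omega)]
  by_cases h : (k : ℕ) = l - 1
  · rw [if_pos h, if_neg (by omega), show (k : ℤ) + 1 = l by omega, h2,
      show (k : ℤ) - 1 = l - 2 by omega]
    ring
  · rw [if_neg h, if_pos (by omega)]
    ring

/-- The number of crossings of the centrally symmetric pair of chords of a `(2l + 2)`-gon given by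
the positions `a`, `b`, or of this chord alone if it is a diameter, with the `k`-th edge of the
zigzag. -/
def foldVec (l a b k : ℤ) : ℤ :=
  if a + b = 2 * l + 1 then chordVec a b k else chordVec a b k + chordVec a b (2 * l - 2 - k)

lemma foldVec_comm (l a b k : ℤ) : foldVec l a b k = foldVec l b a k := by
  unfold foldVec
  simp only [chordVec_comm a b, add_comm a b]

lemma chordVec_mirror' (l a b k : ℤ) :
    chordVec (2 * l + 1 - a) (2 * l + 1 - b) k = chordVec a b (2 * l - 2 - k) := by
  have := chordVec_mirror (m := 2 * l + 2) (a := a) (b := b) (k := k)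
  rwa [show 2 * l + 2 - 1 - a = 2 * l + 1 - a by ring,
    show 2 * l + 2 - 1 - b = 2 * l + 1 - b by ring,
    show 2 * l + 2 - 4 - k = 2 * l - 2 - k by ring] at this

lemma chordVec_diameter {l a b : ℤ} (h : a + b = 2 * l + 1) (k : ℤ) :
    chordVec a b (2 * l - 2 - k) = chordVec a b k := by
  rw [← chordVec_mirror', show 2 * l + 1 - a = b by omega, show 2 * l + 1 - b = a by omega,
    chordVec_comm]

lemma foldVec_mirror (l a b k : ℤ) :
    foldVec l (2 * l + 1 - a) (2 * l + 1 - b) k = foldVec l a b k := by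
  unfold foldVec
  simp only [chordVec_mirror', show 2 * l - 2 - (2 * l - 2 - k) = k by ring]
  split_ifs with h1 h2 h2
  · exact chordVec_diameter h2 k
  · omega
  · omega
  · ring

lemma foldVec_symm (l a b k : ℤ) : foldVec l a b (2 * l - 2 - k) = foldVec l a b k := by
  unfold foldVec
  rw [show 2 * l - 2 - (2 * l - 2 - k) = k by ring]
  split_ifs with h
  · exact chordVec_diameter h k
  · ring

lemma foldVec_neg_one {l a b : ℤ} (ha : 0 ≤ a) (hb : 0 ≤ b) (hal : a < 2 * l + 2)
    (hbl : b < 2 * l + 2) (h0 : a + b ≠ 1) (h1 : a + b + 3 ≠ 4 * (l + 1)) (hab : a ≠ b) :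
    foldVec l a b (-1) = 0 := by
  have e1 := chordVec_neg_one ha hb h0 hab
  have e2 := chordVec_last (l := 2 * l - 1) (a := a) (b := b) (by omega) (by omega) (by omega) hab
  unfold foldVec
  rw [show 2 * l - 2 - -1 = 2 * l - 1 by ring, e1, e2]
  simp

/-- Folding commutes with the reflections. -/
lemma foldVec_refl {l e a b a' b' k : ℤ} (he : e = 0 ∨ e = 1) (ha : 0 ≤ a) (hb : 0 ≤ b)
    (hab : a ≠ b) (ham : a < 2 * l + 2) (hbm : b < 2 * l + 2)
    (ha' : IsStripRefl (2 * l + 2) e a a') (hb' : IsStripRefl (2 * l + 2) e b b')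
    (hne : ¬(b = a + 1 ∧ a % 2 = e)) (hne' : ¬(a = b + 1 ∧ b % 2 = e))
    (h0 : ¬(a + b = 1)) (h1 : ¬(a + b + 3 = 4 * (l + 1)))
    (hk : 0 ≤ k) (hkm : k < l) :
    foldVec l a' b' k = if k % 2 = e then
      foldVec l a b (k - 1) + foldVec l a b (k + 1) - foldVec l a b k else foldVec l a b k := by
  have r1 := chordVec_refl he ha hb hab ham hbm ha' hb' hne hne' h0 (by omega) hk (by omega)
  have r2 := chordVec_refl (k := 2 * l - 2 - k) he ha hb hab ham hbm ha' hb' hne hne' h0 (by omega)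
    (by omega) (by omega)
  have hsum : a' + b' = 2 * l + 1 ↔ a + b = 2 * l + 1 := by
    obtain ⟨ha1, ha2⟩ := ha'
    obtain ⟨hb1, hb2⟩ := hb'
    omega
  unfold foldVec
  simp only [hsum, r1, r2]
  rw [show 2 * l - 2 - k - 1 = 2 * l - 2 - (k + 1) by ring,
    show 2 * l - 2 - k + 1 = 2 * l - 2 - (k - 1) by ring,
    show (2 * l - 2 - k) % 2 = k % 2 by omega]
  split_ifs <;> ring

/-- Up to order and central symmetry, a chord has ends at positions `c < d` with
`c + d ≤ 2l + 1`. -/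
lemma exists_fold_normal {l a b : ℤ} (ha : 0 ≤ a) (hb : 0 ≤ b)
    (hab : a ≠ b) (ham : a < 2 * l + 2) (hbm : b < 2 * l + 2) (hab' : b ≠ a + 2 ∧ a ≠ b + 2)
    (h0 : ¬(a + b = 1)) (h1 : ¬(a + b + 3 = 4 * (l + 1))) :
    ∃ c d, 0 ≤ c ∧ c < d ∧ c + d ≤ 2 * l + 1 ∧ d ≠ c + 2 ∧ d ≠ 1 ∧
      (∀ k, foldVec l a b k = foldVec l c d k) ∧
      ((a = c ∧ b = d) ∨ (a = d ∧ b = c) ∨ (a = 2 * l + 1 - c ∧ b = 2 * l + 1 - d) ∨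
        (a = 2 * l + 1 - d ∧ b = 2 * l + 1 - c)) := by
  by_cases h : a + b ≤ 2 * l + 1
  · rcases lt_or_gt_of_ne hab with h' | h'
    · exact ⟨a, b, ha, h', h, by omega, by omega, fun k => rfl, Or.inl ⟨rfl, rfl⟩⟩
    · exact ⟨b, a, hb, h', by omega, by omega, by omega, fun k => foldVec_comm _ _ _ _,
        Or.inr (Or.inl ⟨rfl, rfl⟩)⟩
  · rcases lt_or_gt_of_ne hab with h' | h'
    · exact ⟨2 * l + 1 - b, 2 * l + 1 - a, by omega, by omega, by omega, by omega, by omega,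
        fun k => by rw [foldVec_mirror, foldVec_comm], by omega⟩
    · exact ⟨2 * l + 1 - a, 2 * l + 1 - b, by omega, by omega, by omega, by omega, by omega,
        fun k => by rw [foldVec_mirror], by omega⟩

lemma foldVec_normal {l a b k : ℤ} (hab : a < b) (h : a + b ≤ 2 * l + 1)
    (hk : k < l) : foldVec l a b k =
      if b = a + 1 then (if k = a - 1 then -1 else 0) else
      if a + b = 2 * l + 1 then (if a ≤ k then 1 else 0) else
        (if a ≤ k ∧ k ≤ b - 3 then 1 else 0) + (if 2 * l + 1 - b ≤ k then 1 else 0) := by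
  unfold foldVec
  simp only [chordVec_of_lt hab, step]
  split_ifs <;> omega

lemma foldVec_inj_normal {l a b c d : ℤ} (ha : 0 ≤ a) (hab : a < b) (h : a + b ≤ 2 * l + 1)
    (hab' : b ≠ a + 2) (hb1 : b ≠ 1) (hc : 0 ≤ c) (hcd : c < d) (h' : c + d ≤ 2 * l + 1)
    (hcd' : d ≠ c + 2) (hd1 : d ≠ 1)
    (he : ∀ k, 0 ≤ k → k < l → foldVec l a b k = foldVec l c d k) : a = c ∧ b = d := by
  have he := fun k h0 hk => (foldVec_normal hab h hk).symm.trans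
    ((he k h0 hk).trans (foldVec_normal hcd h' hk))
  by_cases e1 : b = a + 1
  · have k1 := he (a - 1) (by omega) (by omega)
    split_ifs at k1 <;> omega
  · by_cases e2 : d = c + 1
    · have k1 := he (c - 1) (by omega) (by omega)
      split_ifs at k1 <;> omega
    · simp only [e1, e2, if_false] at he
      have hac : a = c := by
        have k1 := he a (by omega) (by omega)
        have k2 := he c (by omega) (by omega)
        split_ifs at k1 <;> split_ifs at k2 <;> omega
      subst hac
      refine ⟨rfl, ?_⟩
      by_contra hbd
      -- the larger of the two second ends is detected where its indicator function jumps
      have jump : ∀ b d : ℤ, a < b → a < d → a + b ≤ 2 * l + 1 → b ≠ a + 2 → b ≠ a + 1 →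
          a + d ≤ 2 * l + 1 → d ≠ a + 2 → d ≠ a + 1 → b < d →
          (∀ k, 0 ≤ k → k < l →
          (if a + b = 2 * l + 1 then (if a ≤ k then 1 else 0) else
            (if a ≤ k ∧ k ≤ b - 3 then 1 else 0) + (if 2 * l + 1 - b ≤ k then 1 else 0) : ℤ) =
          if a + d = 2 * l + 1 then (if a ≤ k then 1 else 0) else
            (if a ≤ k ∧ k ≤ d - 3 then 1 else 0) + (if 2 * l + 1 - d ≤ k then 1 else 0)) →
          False := by
        intro b d h1 h2 h3 h4 h5 h6 h7 h8 hlt H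
        by_cases hb : b - 2 < l
        · have k1 := H (b - 2) (by omega) (by omega)
          split_ifs at k1 <;> omega
        · by_cases hd : a + d = 2 * l + 1
          · have k1 := H (2 * l + 1 - b) (by omega) (by omega)
            split_ifs at k1 <;> omega
          · have k1 := H (2 * l + 1 - d) (by omega) (by omega)
            split_ifs at k1 <;> omega
      rcases lt_or_gt_of_ne hbd with hlt | hlt
      · exact jump b d hab hcd h hab' e1 h' hcd' e2 hlt he
      · exact jump d b hcd hab h' hcd' e2 h hab' e1 hlt fun k h0 hk => (he k h0 hk).symm

lemma arc_ext_of_foldVec {l : ℤ} {p q : ℤ × ℤ} (hp : p ∈ cyclicArcs (l + 1))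
    (hq : q ∈ cyclicArcs (l + 1)) (h : ∀ k, 0 ≤ k → k < l →
      foldVec l (strip p.1) (strip p.2) k = foldVec l (strip q.1) (strip q.2) k) : p = q := by
  obtain ⟨a1, a2, a3, a4, a5, a6, a7, a8, a9⟩ := strip_bounds hp
  obtain ⟨b1, b2, b3, b4, b5, b6, b7, b8, b9⟩ := strip_bounds hq
  obtain ⟨a, b, ha, hab, hs, hab', hb, hf, hc⟩ := exists_fold_normal (l := l) a1 a3 a5 (by omega)
    (by omega) ⟨a6, a7⟩ a8 (by omega)
  obtain ⟨a', b', ha', hab'', hs', hab''', hb', hf', hc'⟩ := exists_fold_normal (l := l) b1 b3 b5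
    (by omega) (by omega) ⟨b6, b7⟩ b8 (by omega)
  have := foldVec_inj_normal ha hab hs hab' hb ha' hab'' hs' hab''' hb' fun k h0 hk => by
    rw [← hf, ← hf', h k h0 hk]
  refine arc_ext_of_strip hp hq ?_
  clear h hf hf'
  omega

/-- The coordinates of the weight `e_a`, with `e_{2l - 1 - a} = -e_a`. -/
def weightB (l a k : ℤ) : ℤ := step a k - step (2 * l - 1 - a) k

/-- The action on the indices of the weights of the `i`-th simple reflection. -/
def weightSwap (l i x : ℤ) : ℤ :=
  if x = i then i + 1 else if x = i + 1 then i else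
    if x = 2 * l - 1 - i then 2 * l - 2 - i else if x = 2 * l - 2 - i then 2 * l - 1 - i else x

lemma weightSwap_nonneg {l i x : ℤ} (hi : 0 ≤ i) (hil : i < l) (hx : 0 ≤ x) :
    0 ≤ weightSwap l i x := by
  unfold weightSwap; split_ifs <;> omega

lemma weightSwap_lt {l i x : ℤ} (hil : i < l) (hi : 0 ≤ i) (hx : x < 2 * l) :
    weightSwap l i x < 2 * l := by
  unfold weightSwap; split_ifs <;> omega

lemma weightSwap_weightSwap {l i : ℤ} (hil : i < l) (x : ℤ) :
    weightSwap l i (weightSwap l i x) = x := by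
  unfold weightSwap; split_ifs <;> omega

lemma weightSwap_neg {l i : ℤ} (hil : i < l) (x : ℤ) :
    weightSwap l i (2 * l - 1 - x) = 2 * l - 1 - weightSwap l i x := by
  unfold weightSwap; split_ifs <;> omega

lemma weightB_neg_one {l x : ℤ} (h0 : 0 ≤ x) (h1 : x < 2 * l) : weightB l x (-1) = 0 := by
  unfold weightB step; split_ifs <;> omega

lemma weightB_last (l x : ℤ) : weightB l x l = weightB l x (l - 2) := by
  unfold weightB step; split_ifs <;> omega

lemma two_mul_step_sub (y i : ℤ) : 2 * step y i - step y (i - 1) - step y (i + 1) =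
    (if y = i then 1 else 0) - (if y = i + 1 then 1 else 0) := by
  unfold step; split_ifs <;> omega

lemma step_weightSwap {l i : ℤ} (hil : i < l) (x : ℤ) {k : ℤ} (hk : k < l) :
    step (weightSwap l i x) k = step x k - (2 * step x i - step x (i - 1) - step x (i + 1)) *
      (if k = i then 1 else 0) := by
  rw [two_mul_step_sub]
  unfold weightSwap
  by_cases c1 : x = i
  · subst c1
    unfold step
    split_ifs <;> omega
  rw [if_neg c1, if_neg c1]
  by_cases c2 : x = i + 1
  · subst c2
    unfold step
    split_ifs <;> omega
  rw [if_neg c2, if_neg c2, sub_zero, zero_mul, sub_zero]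
  unfold step
  split_ifs <;> omega

lemma weightB_weightSwap {l i : ℤ} (hil : i < l) (x : ℤ) {k : ℤ} (hk : k < l) :
    weightB l (weightSwap l i x) k = weightB l x k -
      (2 * weightB l x i - weightB l x (i - 1) - weightB l x (i + 1)) *
      (if k = i then 1 else 0) := by
  unfold weightB
  rw [← weightSwap_neg hil, step_weightSwap hil _ hk, step_weightSwap hil _ hk]
  ring

lemma weightSwap_ne {l i a b : ℤ} (hil : i < l) (hab : a ≠ b) (hab' : a + b ≠ 2 * l - 1) :
    weightSwap l i a ≠ weightSwap l i b ∧ weightSwap l i a + weightSwap l i b ≠ 2 * l - 1 := by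
  constructor
  · intro h
    rw [← weightSwap_weightSwap hil a, h, weightSwap_weightSwap hil b] at hab
    exact hab rfl
  · intro h
    have h' : weightSwap l i a = weightSwap l i (2 * l - 1 - b) := by
      rw [weightSwap_neg hil]
      omega
    have := congrArg (weightSwap l i) h'
    rw [weightSwap_weightSwap hil, weightSwap_weightSwap hil] at this
    omega

/-- The roots of type `B_l` are `±e_a` and `±e_a ± e_b`, since the simple reflections permute the
`±e_a`. -/
lemma isRoot_cartanB {l : ℕ} {v : Fin l → ℤ} (hv : IsRoot (CartanMatrix.B l) v) :
    ∃ a : ℤ, 0 ≤ a ∧ a < 2 * l ∧ ((∀ k : Fin l, v k = weightB l a k) ∨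
      ∃ b : ℤ, 0 ≤ b ∧ b < 2 * l ∧ a ≠ b ∧ a + b ≠ 2 * l - 1 ∧
        ∀ k : Fin l, v k = weightB l a k - weightB l b k) := by
  induction hv with
  | simple i =>
    have := i.2
    by_cases hi : (i : ℕ) + 1 = l
    · refine ⟨i, by omega, by omega, Or.inl fun k => ?_⟩
      have := k.2
      simp only [simpleRoot, Pi.single_apply, weightB, step, Fin.ext_iff]
      split_ifs <;> omega
    · refine ⟨i, by omega, by omega, Or.inr ⟨i + 1, by omega, by omega, by omega, by omega,
        fun k => ?_⟩⟩
      have := k.2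
      simp only [simpleRoot, Pi.single_apply, weightB, step, Fin.ext_iff]
      split_ifs <;> omega
  | reflect i v _ ih =>
    have hi : ((i : ℕ) : ℤ) < l := by exact_mod_cast i.2
    have hi0 : (0 : ℤ) ≤ (i : ℕ) := by omega
    have hk : ∀ k : Fin l, ((k : ℕ) : ℤ) < l := fun k => by exact_mod_cast k.2
    obtain ⟨a, ha, hal, h | ⟨b, hb, hbl, hab, hab', h⟩⟩ := ih
    · refine ⟨weightSwap l i a, weightSwap_nonneg hi0 hi ha, weightSwap_lt hi hi0 hal,
        Or.inl fun k => ?_⟩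
      have hv : v = fun k : Fin l => weightB l a k := funext h
      have e := vecMul_cartanB l (weightB l a) (weightB_neg_one ha hal) (weightB_last l a) i
      rw [← hv] at e
      simp only [simpleReflection, Pi.sub_apply, Pi.smul_apply, simpleRoot, Pi.single_apply, e, h k,
        smul_eq_mul, Fin.ext_iff, weightB_weightSwap hi _ (hk k), Int.natCast_inj]
    · have hne := weightSwap_ne hi hab hab'
      refine ⟨weightSwap l i a, weightSwap_nonneg hi0 hi ha, weightSwap_lt hi hi0 hal,
        Or.inr ⟨weightSwap l i b, weightSwap_nonneg hi0 hi hb, weightSwap_lt hi hi0 hbl, hne.1,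
          hne.2, fun k => ?_⟩⟩
      have hv : v = fun k : Fin l => (fun k : ℤ => weightB l a k - weightB l b k) k := funext h
      have e := vecMul_cartanB l (fun k : ℤ => weightB l a k - weightB l b k)
        (by simp only [weightB_neg_one ha hal, weightB_neg_one hb hbl, sub_self])
        (by simp only [weightB_last]) i
      rw [← hv] at e
      simp only [simpleReflection, Pi.sub_apply, Pi.smul_apply, simpleRoot, Pi.single_apply, e, h k,
        smul_eq_mul, Fin.ext_iff, weightB_weightSwap hi _ (hk k), Int.natCast_inj]
      ring

lemma snake_mem_cyclicArcs {N i : ℤ} (h0 : 0 ≤ i) (h : i + 2 ≤ N) :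
    (snakeLo i, snakeHi i) ∈ cyclicArcs N := by
  rw [mem_cyclicArcs]
  unfold snakeLo snakeHi
  dsimp only
  omega

lemma strip_snake {i : ℤ} (h0 : 0 ≤ i) :
    (strip (snakeLo i) = i + 1 ∧ strip (snakeHi i) = i + 2) ∨
    (strip (snakeLo i) = i + 2 ∧ strip (snakeHi i) = i + 1) := by
  unfold strip snakeLo snakeHi
  split_ifs <;> omega

lemma chordVec_snake {i : ℤ} (h0 : 0 ≤ i) (k : ℤ) :
    chordVec (strip (snakeLo i)) (strip (snakeHi i)) k = if k = i then -1 else 0 := by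
  have : chordVec (i + 1) (i + 2) k = if k = i then -1 else 0 := by
    rw [chordVec_of_lt (by omega)]
    unfold step
    split_ifs <;> omega
  rcases strip_snake h0 with ⟨h1, h2⟩ | ⟨h1, h2⟩
  · rw [h1, h2, this]
  · rw [h1, h2, chordVec_comm, this]

lemma chordVec_nonneg {a b : ℤ} (hab : a ≠ b) (h1 : b ≠ a + 1) (h2 : a ≠ b + 1) (k : ℤ) :
    0 ≤ chordVec a b k := by
  unfold chordVec step
  split_ifs <;> omega

lemma reflArc_snake {N i : ℤ} (h0 : 0 ≤ i) (h : i + 2 ≤ N) {ε : Bool}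
    (hi : i % 2 ≠ if ε then 1 else 0) :
    reflArc N (centre ε) (snakeLo i, snakeHi i) = (snakeLo i, snakeHi i) := by
  unfold reflArc snakeLo snakeHi centre
  cases ε <;> simp only [if_true, if_false, Bool.false_eq_true] at * <;> split_ifs <;> ext <;>
    dsimp only at * <;> omega

/-- An arc crosses an edge of the zigzag if and only if the corresponding crossing number is
positive. -/
lemma noncrossingCyclic_snake {l i : ℤ} (h0 : 0 ≤ i) (h : i < l) {p : ℤ × ℤ}
    (hp : p ∈ cyclicArcs (l + 1)) : NoncrossingCyclic (l + 1) (snakeLo i, snakeHi i) p ↔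
      foldVec l (strip p.1) (strip p.2) i ≤ 0 := by
  rw [mem_cyclicArcs] at hp
  have hlo : snakeLo i < 0 := by unfold snakeLo; omega
  have e : NoncrossingCyclic (l + 1) (snakeLo i, snakeHi i) p ↔
      (0 ≤ p.1 → ¬(p.1 < snakeHi i ∧ snakeHi i < p.2) ∧
        ¬(p.1 < snakeLo i + (l + 1) ∧ snakeLo i + (l + 1) < p.2)) ∧
      (p.1 < 0 → (p.1 ≤ snakeLo i ∧ snakeHi i ≤ p.2) ∨ (snakeLo i ≤ p.1 ∧ p.2 ≤ snakeHi i)) := by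
    unfold NoncrossingCyclic
    dsimp only
    omega
  rw [e]
  unfold foldVec chordVec step snakeLo snakeHi
  rcases lt_or_ge p.1 0 with h1 | h1
  · have e1 : strip p.1 = -2 * p.1 - 1 := by unfold strip; omega
    have e2 : strip p.2 = 2 * p.2 := by unfold strip; omega
    rw [e1, e2]
    split_ifs <;> omega
  · have e1 : strip p.1 = 2 * p.1 := by unfold strip; omega
    have e2 : strip p.2 = 2 * p.2 := by unfold strip; omega
    rw [e1, e2]
    split_ifs <;> omega

/-- The crossing numbers of an arc that is not a fixed edge of the zigzag transform under
reflections as root vectors do. -/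
lemma foldVec_reflArc {l : ℤ} (ε : Bool) {p : ℤ × ℤ} (hp : p ∈ cyclicArcs (l + 1))
    (hne : ∀ i, 0 ≤ i → i < l → i % 2 ≠ (if ε then 1 else 0) → p ≠ (snakeLo i, snakeHi i))
    {k : ℤ} (hk : 0 ≤ k) (hkl : k < l) :
    foldVec l (strip (reflArc (l + 1) (centre ε) p).1)
      (strip (reflArc (l + 1) (centre ε) p).2) k =
    if k % 2 = (if ε then 1 else 0) then
      foldVec l (strip p.1) (strip p.2) (k - 1) + foldVec l (strip p.1) (strip p.2) (k + 1) -
        foldVec l (strip p.1) (strip p.2) k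
    else foldVec l (strip p.1) (strip p.2) k := by
  obtain ⟨a1, a2, a3, a4, a5, a6, a7, a8, a9⟩ := strip_bounds hp
  obtain ⟨a, b, ha, hb, hab⟩ := exists_isStripRefl_reflArc ε hp
  have he : (if ε then 1 else 0 : ℤ) = 0 ∨ (if ε then 1 else 0 : ℤ) = 1 := by cases ε <;> simp
  have e : foldVec l (strip (reflArc (l + 1) (centre ε) p).1)
      (strip (reflArc (l + 1) (centre ε) p).2) k = foldVec l a b k := by
    rcases hab with ⟨h1, h2⟩ | ⟨h1, h2⟩
    · rw [h1, h2, foldVec_comm]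
    · rw [h1, h2, show 2 * (l + 1) - 1 - b = 2 * l + 1 - b by ring,
        show 2 * (l + 1) - 1 - a = 2 * l + 1 - a by ring, foldVec_mirror, foldVec_comm]
  rw [e]
  rw [show 2 * (l + 1) = 2 * l + 2 by ring] at ha hb
  have aux : ∀ x y, ((strip p.1 = x ∧ strip p.2 = y) ∨ (strip p.1 = y ∧ strip p.2 = x)) →
      ¬(y = x + 1 ∧ x % 2 = if ε then 1 else 0) := by
    rintro x y hxy ⟨h1, h2⟩
    have hs := arc_eq_snake hp (by omega)
    have hp' := mem_cyclicArcs.1 hp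
    refine hne (p.2 - p.1 - 2) (by omega) (by omega) ?_ hs
    intro h3
    have := strip_snake (i := p.2 - p.1 - 2) (by omega)
    rw [show snakeLo (p.2 - p.1 - 2) = p.1 from (congrArg Prod.fst hs).symm,
      show snakeHi (p.2 - p.1 - 2) = p.2 from (congrArg Prod.snd hs).symm] at this
    have hx : x = p.2 - p.1 - 2 + 1 := by omega
    rw [← h2] at h3
    omega
  exact foldVec_refl he a1 a3 a5 (by omega) (by omega) ha hb (aux _ _ (Or.inl ⟨rfl, rfl⟩))
    (aux _ _ (Or.inr ⟨rfl, rfl⟩)) a8 a9 hk hkl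

lemma weightB_sub_eq_foldVec {l a b k : ℤ} (hab : a < b) (h : a + b ≠ 2 * l - 1) :
    weightB l a k - weightB l b k = foldVec l a (b + 2) k := by
  unfold foldVec weightB
  rw [if_neg (by omega), chordVec_of_lt (by omega), chordVec_of_lt (by omega)]
  unfold step
  split_ifs <;> omega

/-- Every nonnegative vector of the form of a root of type `B_l` is attached to an arc. -/
lemma exists_arc_of_weightB {l a b : ℤ} (ha : 0 ≤ a) (hal : a < 2 * l) (hb : 0 ≤ b)
    (hbl : b < 2 * l) (hab : a ≠ b) (hab' : a + b ≠ 2 * l - 1)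
    (h : ∀ k, 0 ≤ k → k < l → 0 ≤ weightB l a k - weightB l b k) :
    ∃ p ∈ cyclicArcs (l + 1), p.2 ≠ p.1 + (l + 1) ∧ strip p.2 ≠ strip p.1 + 1 ∧
      strip p.1 ≠ strip p.2 + 1 ∧
      ∀ k, weightB l a k - weightB l b k = foldVec l (strip p.1) (strip p.2) k := by
  have hlt : a < b := by
    by_contra hba
    by_cases hb' : b < l
    · have := h b hb hb'
      unfold weightB step at this
      split_ifs at this <;> omega
    · have := h (2 * l - 2 - b) (by omega) (by omega)
      unfold weightB step at this
      split_ifs at this <;> omega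
  obtain ⟨p, hp, hs⟩ := exists_arc_strip (N := l + 1) (a := a) (c := b + 2) ha (by omega) (by omega)
  refine ⟨p, hp, ?_, by omega, by omega, fun k => ?_⟩
  · rw [mem_cyclicArcs] at hp
    unfold strip at hs
    intro hp'
    split_ifs at hs <;> omega
  · rw [weightB_sub_eq_foldVec hlt hab', ← foldVec_mirror l (strip p.1)]
    rcases hs with ⟨h1, h2⟩ | ⟨h1, h2⟩ | ⟨h1, h2⟩ | ⟨h1, h2⟩
    · rw [h1, h2, foldVec_mirror]
    · rw [h1, h2, foldVec_mirror, foldVec_comm]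
    · rw [h1, h2]
      congr 1 <;> ring
    · rw [h1, h2, foldVec_comm]
      congr 1 <;> ring

/-- The model of the cluster complex of type `B_l`: the arcs in a disc with `l + 1` boundary points
and an interior point, where compatible arcs are those which do not cross. -/
noncomputable def modelB (l : ℕ) : Model (typeB l) (ℤ × ℤ) where
  verts := cyclicArcs (l + 1)
  refl ε := reflArc (l + 1) (centre ε)
  vec p k := foldVec l (strip p.1) (strip p.2) k
  neg i := (snakeLo i, snakeHi i)
  compat := NoncrossingCyclic (l + 1)
  diag i := by simp [typeB, CartanMatrix.B]
  refl_mem ε _ hx := reflArc_mem ε hx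
  refl_refl ε _ hx := reflArc_reflArc ε hx
  neg_mem i := snake_mem_cyclicArcs (by omega) (by have := i.2; omega)
  vec_neg i := by
    funext k
    have hi := i.2
    have hk := k.2
    simp only [foldVec, simpleRoot, Pi.neg_apply, Pi.single_apply, Fin.ext_iff,
      chordVec_snake (i := ((i : ℕ) : ℤ)) (by omega)]
    have := strip_snake (i := ((i : ℕ) : ℤ)) (by omega)
    split_ifs <;> omega
  vec_injOn := by
    intro p hp q hq h
    refine arc_ext_of_foldVec (Finset.mem_coe.1 hp) (Finset.mem_coe.1 hq) fun k hk hkl => ?_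
    have := congrFun h ⟨k.toNat, by omega⟩
    simpa [hk] using this
  vec_nonneg := by
    intro p hp
    by_cases h : strip p.2 = strip p.1 + 1 ∨ strip p.1 = strip p.2 + 1
    · left
      have hp' := mem_cyclicArcs.1 hp
      refine ⟨⟨(p.2 - p.1 - 2).toNat, by omega⟩, ?_⟩
      have e : ((p.2 - p.1 - 2).toNat : ℤ) = p.2 - p.1 - 2 := by omega
      simp only [e]
      exact arc_eq_snake hp h
    · right
      intro k
      have h1 := chordVec_nonneg (strip_bounds hp).2.2.2.2.1 (by omega) (by omega)
      have h2 := h1 k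
      have h3 := h1 (2 * l - 2 - k)
      simp only [foldVec, Pi.zero_apply]
      split_ifs <;> omega
  vec_surj := by
    intro v hv h0
    obtain ⟨a, ha, hal, h | ⟨b, hb, hbl, hab, hab', h⟩⟩ := isRoot_cartanB hv
    · have hal' : a < l := by
        by_contra hla
        have := h0 ⟨(2 * l - 1 - a).toNat, by omega⟩
        rw [h, weightB] at this
        simp only [Pi.zero_apply] at this
        unfold step at this
        split_ifs at this <;> omega
      obtain ⟨p, hp, hs⟩ := exists_arc_strip (N := l + 1) (a := a) (c := 2 * l + 1 - a) ha
        (by omega) (by omega)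
      refine ⟨p, hp, ?_⟩
      funext k
      have hk := k.2
      rw [h, weightB, foldVec, if_pos (by omega)]
      have hs' : (strip p.1 = a ∧ strip p.2 = 2 * l + 1 - a) ∨
        (strip p.1 = 2 * l + 1 - a ∧ strip p.2 = a) := by omega
      have e : chordVec a (2 * l + 1 - a) k = step a k - step (2 * l - 1 - a) k := by
        rw [chordVec_of_lt (by omega)]
        unfold step
        split_ifs <;> omega
      rcases hs' with ⟨h1, h2⟩ | ⟨h1, h2⟩
      · rw [h1, h2, e]
      · rw [h1, h2, chordVec_comm, e]
    · obtain ⟨p, hp, -, -, -, hs⟩ := exists_arc_of_weightB ha hal hb hbl hab hab' fun k hk hkl => by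
        have := h0 ⟨k.toNat, by omega⟩
        rw [h] at this
        simpa [hk] using this
      refine ⟨p, hp, ?_⟩
      funext k
      rw [h, hs]
  refl_neg ε i hi := by
    have := i.2
    simp only [typeB] at hi
    rw [Ne, sign_eq_iff] at hi
    exact reflArc_snake (by omega) (by omega) hi
  vec_refl ε p hp hne k := by
    have hk := k.2
    have hs : (typeB l).sign k = ε ↔ ((k : ℕ) : ℤ) % 2 = if ε then 1 else 0 := sign_eq_iff k ε
    obtain ⟨a1, a2, a3, a4, a5, a6, a7, a8, a9⟩ := strip_bounds hp
    have hC : ((fun k : Fin l => foldVec l (strip p.1) (strip p.2) k) ᵥ* (typeB l).C) k = _ :=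
      vecMul_cartanB l (foldVec l (strip p.1) (strip p.2))
        (foldVec_neg_one a1 a3 (by omega) (by omega) a8 a9 a5) (by
          rw [← foldVec_symm]
          congr 1
          ring) k
    simp only [hs, hC]
    rw [foldVec_reflArc ε hp _ (by omega) (by omega)]
    · split_ifs <;> ring
    · intro i hi hil hie h
      have e : ((i.toNat : ℕ) : ℤ) = i := by omega
      refine hne ⟨i.toNat, by omega⟩ ?_ ?_
      · simp only [typeB]
        rw [Ne, sign_eq_iff, e]
        exact hie
      · simp only [e, h]
  compat_symm _ _ h := h.symm
  compat_refl ε _ hx _ hy h := noncrossingCyclic_reflArc ε hx hy h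
  compat_neg i _ hp := noncrossingCyclic_snake (by omega) (by have := i.2; omega) hp
  orbit P h0 h := by
    refine reflArc_orbit P (fun i hi hil => ?_) h
    have := h0 ⟨i.toNat, by omega⟩
    have e : ((i.toNat : ℕ) : ℤ) = i := by omega
    simpa only [e] using this

/-! ### Type D -/

/-- The vector in the root lattice of type `D_l` with coefficients `f k` at the nodes `k < l - 2`
and whose coefficients at the nodes `l - 2` and `l - 1` have sum `f (l - 2)` and difference `d`. -/
def vecD (l : ℤ) (f : ℤ → ℤ) (d k : ℤ) : ℤ :=
  if k = l - 1 then (f (l - 2) - d) / 2 else if k = l - 2 then (f (l - 2) + d) / 2 else f k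

lemma cartanD_apply {l : ℕ} (hl : 4 ≤ l) (j k : Fin l) : CartanMatrix.D l j k =
    if (j : ℤ) = k then 2 else if ((j : ℤ) + 1 = k ∧ (k : ℤ) + 1 < l) ∨
      ((k : ℤ) + 1 = j ∧ (j : ℤ) + 1 < l) ∨ ((j : ℤ) + 3 = l ∧ (k : ℤ) + 1 = l) ∨
      ((k : ℤ) + 3 = l ∧ (j : ℤ) + 1 = l) then -1 else 0 := by
  have hj := j.2
  have hk := k.2
  simp only [CartanMatrix.D, Matrix.of_apply, Fin.ext_iff]
  split_ifs <;> omega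

lemma vecMul_cartanD {l : ℕ} (hl : 4 ≤ l) (f : ℤ → ℤ) (d : ℤ) (h1 : f (-1) = 0)
    (h2 : (f (l - 2) + d) % 2 = 0) (k : Fin l) :
    ((fun i : Fin l => vecD l f d i) ᵥ* CartanMatrix.D l) k =
      if (k : ℤ) = l - 1 then f (l - 2) - d - f (l - 3) else
      if (k : ℤ) = l - 2 then f (l - 2) + d - f (l - 3) else 2 * f k - f (k - 1) - f (k + 1) := by
  have hk := k.2
  have hl' : (4 : ℤ) ≤ l := by omega
  simp only [Matrix.vecMul, dotProduct, cartanD_apply hl]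
  by_cases c1 : (k : ℤ) = l - 1
  · have e : ∀ j : Fin l, vecD l f d j * (if (j : ℤ) = k then 2 else
        if ((j : ℤ) + 1 = k ∧ (k : ℤ) + 1 < l) ∨
        ((k : ℤ) + 1 = j ∧ (j : ℤ) + 1 < l) ∨ ((j : ℤ) + 3 = l ∧ (k : ℤ) + 1 = l) ∨
        ((k : ℤ) + 3 = l ∧ (j : ℤ) + 1 = l) then -1 else 0) =
        2 * (if ((j : ℕ) : ℤ) = l - 1 then vecD l f d j else 0) -
        (if ((j : ℕ) : ℤ) = l - 3 then vecD l f d j else 0) := by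
      intro j
      generalize vecD l f d j = x
      split_ifs <;> omega
    simp only [e, Finset.sum_sub_distrib, ← Finset.mul_sum, sum_fin_ite_eq]
    rw [if_pos c1, if_pos (by omega), if_pos (by omega)]
    unfold vecD
    rw [if_pos rfl, if_neg (by omega), if_neg (by omega)]
    omega
  by_cases c2 : (k : ℤ) = l - 2
  · have e : ∀ j : Fin l, vecD l f d j * (if (j : ℤ) = k then 2 else
        if ((j : ℤ) + 1 = k ∧ (k : ℤ) + 1 < l) ∨
        ((k : ℤ) + 1 = j ∧ (j : ℤ) + 1 < l) ∨ ((j : ℤ) + 3 = l ∧ (k : ℤ) + 1 = l) ∨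
        ((k : ℤ) + 3 = l ∧ (j : ℤ) + 1 = l) then -1 else 0) =
        2 * (if ((j : ℕ) : ℤ) = l - 2 then vecD l f d j else 0) -
        (if ((j : ℕ) : ℤ) = l - 3 then vecD l f d j else 0) := by
      intro j
      generalize vecD l f d j = x
      split_ifs <;> omega
    simp only [e, Finset.sum_sub_distrib, ← Finset.mul_sum, sum_fin_ite_eq]
    rw [if_neg c1, if_pos c2, if_pos (by omega), if_pos (by omega)]
    unfold vecD
    rw [if_neg (by omega), if_pos rfl, if_neg (by omega), if_neg (by omega)]
    omega
  by_cases c3 : (k : ℤ) = l - 3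
  · have e : ∀ j : Fin l, vecD l f d j * (if (j : ℤ) = k then 2 else
        if ((j : ℤ) + 1 = k ∧ (k : ℤ) + 1 < l) ∨
        ((k : ℤ) + 1 = j ∧ (j : ℤ) + 1 < l) ∨ ((j : ℤ) + 3 = l ∧ (k : ℤ) + 1 = l) ∨
        ((k : ℤ) + 3 = l ∧ (j : ℤ) + 1 = l) then -1 else 0) =
        2 * (if ((j : ℕ) : ℤ) = l - 3 then vecD l f d j else 0) -
        (if ((j : ℕ) : ℤ) = l - 4 then vecD l f d j else 0) -
        (if ((j : ℕ) : ℤ) = l - 2 then vecD l f d j else 0) -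
        (if ((j : ℕ) : ℤ) = l - 1 then vecD l f d j else 0) := by
      intro j
      generalize vecD l f d j = x
      split_ifs <;> omega
    simp only [e, Finset.sum_sub_distrib, ← Finset.mul_sum, sum_fin_ite_eq]
    rw [if_neg c1, if_neg c2, if_pos (by omega), if_pos (by omega), if_pos (by omega),
      if_pos (by omega), c3, show (l : ℤ) - 3 - 1 = l - 4 by ring,
      show (l : ℤ) - 3 + 1 = l - 2 by ring]
    unfold vecD
    rw [if_neg (by omega), if_neg (by omega), if_neg (by omega), if_neg (by omega),
      if_neg (by omega), if_pos rfl, if_pos rfl]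
    omega
  have e : ∀ j : Fin l, vecD l f d j * (if (j : ℤ) = k then 2 else
      if ((j : ℤ) + 1 = k ∧ (k : ℤ) + 1 < l) ∨
      ((k : ℤ) + 1 = j ∧ (j : ℤ) + 1 < l) ∨ ((j : ℤ) + 3 = l ∧ (k : ℤ) + 1 = l) ∨
      ((k : ℤ) + 3 = l ∧ (j : ℤ) + 1 = l) then -1 else 0) =
      2 * (if ((j : ℕ) : ℤ) = k then vecD l f d j else 0) -
      (if ((j : ℕ) : ℤ) = k - 1 then vecD l f d j else 0) -
      (if ((j : ℕ) : ℤ) = k + 1 then vecD l f d j else 0) := by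
    intro j
    generalize vecD l f d j = x
    split_ifs <;> omega
  simp only [e, Finset.sum_sub_distrib, ← Finset.mul_sum, sum_fin_ite_eq]
  have hf : ∀ m : ℤ, m < l - 2 → vecD l f d m = f m := fun m hm => by
    rw [vecD, if_neg (by omega), if_neg (by omega)]
  rw [if_neg c1, if_neg c2, if_pos (by omega), if_pos (show 0 ≤ (k : ℤ) + 1 ∧ _ by omega),
    hf _ (by omega), hf _ (by omega), hf _ (by omega)]
  split_ifs with c4
  · rfl
  · rw [show (k : ℤ) - 1 = -1 by omega, h1]

/-- The difference of the coordinates of the weight `e_a` at the nodes `l - 2` and `l - 1`. -/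
def forkWeight (l a : ℤ) : ℤ := (if a = l then 1 else 0) - (if a = l - 1 then 1 else 0)

/-- The action on the indices of the weights of the `i`-th simple reflection of type `D_l`. -/
def weightSwapD (l i x : ℤ) : ℤ :=
  if i = l - 1 then (if x = l - 2 then l else if x = l then l - 2 else if x = l - 1 then l + 1 else
    if x = l + 1 then l - 1 else x) else weightSwap l i x

/-- The root `e_a - e_b` of type `D_l`. -/
def rootD (l a b k : ℤ) : ℤ :=
  vecD l (fun j => weightB l a j - weightB l b j) (forkWeight l a - forkWeight l b) k

lemma weightB_add_forkWeight_odd (l a : ℤ) :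
    (weightB l a (l - 2) + forkWeight l a) % 2 = 1 := by
  unfold weightB forkWeight step
  split_ifs <;> omega

lemma weightSwapD_spec {l i : ℤ} (hl : 2 ≤ l) (hi : 0 ≤ i) (hil : i < l) :
    (∀ x, 0 ≤ x → x < 2 * l → 0 ≤ weightSwapD l i x ∧ weightSwapD l i x < 2 * l) ∧
    (∀ x, weightSwapD l i (weightSwapD l i x) = x) ∧
    (∀ x, weightSwapD l i (2 * l - 1 - x) = 2 * l - 1 - weightSwapD l i x) := by
  by_cases h : i = l - 1
  · subst h
    have e : ∀ x, weightSwapD l (l - 1) x = if x = l - 2 then l else if x = l then l - 2 else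
        if x = l - 1 then l + 1 else if x = l + 1 then l - 1 else x := fun x => by
      rw [weightSwapD, if_pos rfl]
    simp only [e]
    refine ⟨fun x h0 h1 => ?_, fun x => ?_, fun x => ?_⟩
    · split_ifs <;> omega
    · grind
    · grind
  · unfold weightSwapD
    simp only [h, if_false]
    exact ⟨fun x h0 h1 => ⟨weightSwap_nonneg hi hil h0, weightSwap_lt hil hi h1⟩,
      weightSwap_weightSwap hil, weightSwap_neg hil⟩

lemma forkWeight_weightSwap {l i : ℤ} (hi : i < l - 2) (x : ℤ) :
    forkWeight l (weightSwap l i x) = forkWeight l x := by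
  unfold forkWeight weightSwap
  split_ifs <;> omega

lemma weightSwap_fork (l x : ℤ) :
    weightB l (weightSwap l (l - 2) x) (l - 2) = weightB l x (l - 3) - forkWeight l x ∧
    forkWeight l (weightSwap l (l - 2) x) = weightB l x (l - 3) - weightB l x (l - 2) := by
  constructor
  · rw [weightB_weightSwap (by omega) _ (by omega), if_pos rfl]
    unfold weightB forkWeight step
    split_ifs <;> omega
  · unfold weightB forkWeight step weightSwap
    split_ifs <;> omega

lemma weightSwapD_fork (l x : ℤ) :
    weightB l (weightSwapD l (l - 1) x) (l - 2) = weightB l x (l - 3) + forkWeight l x ∧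
    forkWeight l (weightSwapD l (l - 1) x) = weightB l x (l - 2) - weightB l x (l - 3) ∧
    ∀ k, k < l - 2 → weightB l (weightSwapD l (l - 1) x) k = weightB l x k := by
  unfold weightSwapD
  simp only [if_true]
  refine ⟨?_, ?_, fun k hk => ?_⟩
  · unfold weightB forkWeight step
    split_ifs <;> omega
  · unfold weightB forkWeight step
    split_ifs <;> omega
  · unfold weightB step
    split_ifs <;> omega

lemma simpleReflection_rootD {l : ℕ} (hl : 4 ≤ l) {a b : ℤ} (ha : 0 ≤ a) (hal : a < 2 * l)
    (hb : 0 ≤ b) (hbl : b < 2 * l) (i : Fin l) :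
    simpleReflection (CartanMatrix.D l) i (fun k => rootD l a b k) =
      fun k : Fin l => rootD l (weightSwapD l i a) (weightSwapD l i b) k := by
  have hi : ((i : ℕ) : ℤ) < l := by exact_mod_cast i.2
  funext k
  have hk : ((k : ℕ) : ℤ) < l := by exact_mod_cast k.2
  have hoa := weightB_add_forkWeight_odd (l : ℤ) a
  have hob := weightB_add_forkWeight_odd (l : ℤ) b
  have e := vecMul_cartanD hl (fun j => weightB l a j - weightB l b j)
    (forkWeight l a - forkWeight l b) (by simp only [weightB_neg_one ha hal,
      weightB_neg_one hb hbl, sub_self]) (by omega) i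
  simp only [simpleReflection, Pi.sub_apply, Pi.smul_apply, simpleRoot, Pi.single_apply,
    smul_eq_mul, Fin.ext_iff]
  unfold rootD
  rw [e]
  simp only [← Int.natCast_inj (m := (k : ℕ))]
  generalize ((k : ℕ) : ℤ) = k at *
  generalize ((i : ℕ) : ℤ) = i at *
  generalize (l : ℤ) = l at *
  clear e
  by_cases c1 : i = l - 1
  · subst c1
    obtain ⟨a1, a2, a3⟩ := weightSwapD_fork l a
    obtain ⟨b1, b2, b3⟩ := weightSwapD_fork l b
    unfold vecD
    simp only [a1, a2, b1, b2, if_true]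
    split_ifs <;> first
      | omega
      | (rw [a3 _ (by omega), b3 _ (by omega)]; ring1)
  by_cases c2 : i = l - 2
  · subst c2
    have hs : ∀ x, weightSwapD l (l - 2) x = weightSwap l (l - 2) x := fun x => by
      rw [weightSwapD, if_neg c1]
    obtain ⟨a1, a2⟩ := weightSwap_fork l a
    obtain ⟨b1, b2⟩ := weightSwap_fork l b
    unfold vecD
    simp only [hs, a1, a2, b1, b2, if_true, c1, if_false]
    split_ifs with h1 h2 h2 <;> first
      | omega
      | (rw [weightB_weightSwap (by omega) _ hk, weightB_weightSwap (by omega) _ hk, if_neg h2]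
         ring1)
  have hs : ∀ x, weightSwapD l i x = weightSwap l i x := fun x => by
    rw [weightSwapD, if_neg c1]
  unfold vecD
  simp only [hs, c1, c2, if_false, forkWeight_weightSwap (show i < l - 2 by omega)]
  rw [weightB_weightSwap hi a (show l - 2 < l by omega), if_neg (Ne.symm c2),
    weightB_weightSwap hi b (show l - 2 < l by omega), if_neg (Ne.symm c2),
    weightB_weightSwap hi a hk, weightB_weightSwap hi b hk]
  split_ifs <;> first
    | (exfalso; omega)
    | ring1
    | (ring_nf)

lemma rootD_succ {l i k : ℤ} (hi : i < l - 1) (hk : k < l) :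
    rootD l i (i + 1) k = if k = i then 1 else 0 := by
  have e : ∀ j, j < l - 1 → weightB l i j - weightB l (i + 1) j = if j = i then 1 else 0 := by
    intro j hj
    unfold weightB step
    split_ifs <;> omega
  have e' : forkWeight l i - forkWeight l (i + 1) = if i = l - 2 then 1 else 0 := by
    unfold forkWeight
    split_ifs <;> omega
  unfold rootD vecD
  dsimp only
  rw [e', e _ (by omega)]
  by_cases h1 : k = l - 1
  · rw [if_pos h1]
    split_ifs <;> omega
  · rw [if_neg h1, e _ (by omega)]
    split_ifs <;> omega

lemma rootD_last {l k : ℤ} (hk : k < l) :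
    rootD l (l - 2) l k = if k = l - 1 then 1 else 0 := by
  have e : ∀ j, j < l - 1 → weightB l (l - 2) j - weightB l l j = if j = l - 2 then 1 else 0 := by
    intro j hj
    unfold weightB step
    split_ifs <;> omega
  have e' : forkWeight l (l - 2) - forkWeight l l = -1 := by
    unfold forkWeight
    split_ifs <;> omega
  unfold rootD vecD
  dsimp only
  rw [e', e _ (by omega), if_pos rfl]
  by_cases h1 : k = l - 1
  · rw [if_pos h1, if_pos h1]
    omega
  · rw [if_neg h1, e _ (by omega), if_neg h1]
    split_ifs <;> omega

/-- The roots of type `D_l` are `±e_a ± e_b`. -/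
lemma isRoot_cartanD {l : ℕ} (hl : 4 ≤ l) {v : Fin l → ℤ} (hv : IsRoot (CartanMatrix.D l) v) :
    ∃ a b : ℤ, 0 ≤ a ∧ a < 2 * l ∧ 0 ≤ b ∧ b < 2 * l ∧ a ≠ b ∧ a + b ≠ 2 * l - 1 ∧
      v = fun k : Fin l => rootD l a b k := by
  induction hv with
  | simple i =>
    have := i.2
    by_cases hi : (i : ℕ) + 1 = l
    · refine ⟨l - 2, l, by omega, by omega, by omega, by omega, by omega, by omega, ?_⟩
      funext k
      have := k.2
      rw [rootD_last (by omega)]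
      simp only [simpleRoot, Pi.single_apply, Fin.ext_iff]
      split_ifs <;> omega
    · refine ⟨i, i + 1, by omega, by omega, by omega, by omega, by omega, by omega, ?_⟩
      funext k
      have := k.2
      rw [rootD_succ (by omega) (by omega)]
      simp only [simpleRoot, Pi.single_apply, Fin.ext_iff]
      split_ifs <;> omega
  | reflect i v _ ih =>
    obtain ⟨a, b, ha, hal, hb, hbl, hab, hab', rfl⟩ := ih
    obtain ⟨h1, h2, h3⟩ := weightSwapD_spec (l := l) (i := (i : ℕ)) (by omega) (by omega)
      (by exact_mod_cast i.2)
    refine ⟨weightSwapD l i a, weightSwapD l i b, (h1 a ha hal).1, (h1 a ha hal).2,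
      (h1 b hb hbl).1, (h1 b hb hbl).2, ?_, ?_, simpleReflection_rootD hl ha hal hb hbl i⟩
    · intro h
      rw [← h2 a, h, h2] at hab
      exact hab rfl
    · intro h
      have h' : weightSwapD l i a = weightSwapD l i (2 * l - 1 - b) := by
        rw [h3]
        omega
      have := congrArg (weightSwapD l i) h'
      rw [h2, h2] at this
      omega

/-- The arcs and radii of a disc with `l` boundary points and an interior point. An arc `(a, b)`
with `b - a < l` carries the label `false`, and the arcs with `b - a = l` stand for the radii, which
come with two labels each. -/
noncomputable def taggedArcs (l : ℤ) : Finset ((ℤ × ℤ) × Bool) :=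
  (cyclicArcs l ×ˢ Finset.univ).filter fun x => x.1.2 ≠ x.1.1 + l → x.2 = false

lemma mem_taggedArcs {l : ℤ} {x : (ℤ × ℤ) × Bool} :
    x ∈ taggedArcs l ↔ x.1 ∈ cyclicArcs l ∧ (x.1.2 ≠ x.1.1 + l → x.2 = false) := by
  simp [taggedArcs]

/-- Two radii are compatible if they have the same label or the same end; otherwise compatible
means not crossing. -/
def CompatTagged (l : ℤ) (x y : (ℤ × ℤ) × Bool) : Prop :=
  (x.1.2 = x.1.1 + l → y.1.2 = y.1.1 + l → x.2 = y.2 ∨ x.1 = y.1) ∧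
  (¬(x.1.2 = x.1.1 + l ∧ y.1.2 = y.1.1 + l) → NoncrossingCyclic l x.1 y.1)

/-- The sign attached to the label of a radius. -/
def tagSign (l : ℤ) (x : (ℤ × ℤ) × Bool) : ℤ :=
  if x.1.2 = x.1.1 + l then (if x.2 then -1 else 1) else 0

lemma strip_add_strip {N : ℤ} {p : ℤ × ℤ} (hp : p ∈ cyclicArcs N) :
    strip p.1 + strip p.2 = 2 * N - 1 ↔ p.2 = p.1 + N := by
  rw [mem_cyclicArcs] at hp
  unfold strip
  split_ifs <;> omega

lemma foldVec_fork {l : ℤ} {p : ℤ × ℤ} (hp : p ∈ cyclicArcs l) :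
    (p.2 = p.1 + l → foldVec (l - 1) (strip p.1) (strip p.2) (l - 2) = 1 ∨
      foldVec (l - 1) (strip p.1) (strip p.2) (l - 2) = -1) ∧
    (p.2 ≠ p.1 + l → foldVec (l - 1) (strip p.1) (strip p.2) (l - 2) % 2 = 0) := by
  have h := strip_add_strip hp
  have hb := strip_bounds hp
  constructor
  · intro hr
    have h := h.2 hr
    rw [foldVec, if_pos (by omega)]
    unfold chordVec step
    split_ifs <;> omega
  · intro hr
    rw [foldVec, if_neg (by omega), show 2 * (l - 1) - 2 - (l - 2) = l - 2 by ring]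
    omega

lemma foldVec_add_tagSign {l : ℤ} {x : (ℤ × ℤ) × Bool} (hx : x.1 ∈ cyclicArcs l) :
    (foldVec (l - 1) (strip x.1.1) (strip x.1.2) (l - 2) + tagSign l x) % 2 = 0 := by
  have := foldVec_fork hx
  unfold tagSign
  split_ifs <;> omega

lemma vecD_congr {l d k : ℤ} {f f' : ℤ → ℤ} (h : ∀ k, 0 ≤ k → k < l - 1 → f k = f' k) (hl : 4 ≤ l)
    (hk0 : 0 ≤ k) (hk : k < l) : vecD l f d k = vecD l f' d k := by
  unfold vecD
  rw [h (l - 2) (by omega) (by omega)]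
  split_ifs
  · rfl
  · rfl
  · exact h k hk0 (by omega)

lemma rootD_neg (l a b k : ℤ) : rootD l a b k = rootD l (2 * l - 1 - b) (2 * l - 1 - a) k := by
  unfold rootD
  congr 1
  · funext j
    unfold weightB
    rw [show 2 * l - 1 - (2 * l - 1 - a) = a by ring, show 2 * l - 1 - (2 * l - 1 - b) = b by ring]
    ring
  · unfold forkWeight
    split_ifs <;> omega

lemma weightB_pred {l a k : ℤ} (h1 : a ≠ l - 1) (h2 : a ≠ l) (hk : k < l - 1) :
    weightB l a k = weightB (l - 1) (if a < l then a else a - 2) k := by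
  unfold weightB step
  split_ifs <;> omega

/-- The roots `±e_a ± e_{l - 1}` belong to the radii. -/
lemma exists_radius_of_rootD {l a b : ℤ} (hl : 4 ≤ l) (ha : 0 ≤ a) (hab : a ≠ b)
    (hab' : a + b ≠ 2 * l - 1) (hb : b = l - 1 ∨ b = l)
    (h : ∀ k, 0 ≤ k → k < l → 0 ≤ rootD l a b k) :
    ∃ x ∈ taggedArcs l, ∀ k, 0 ≤ k → k < l →
      vecD l (foldVec (l - 1) (strip x.1.1) (strip x.1.2)) (tagSign l x) k = rootD l a b k := by
  have hal' : a < l := by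
    by_contra hla
    have h1 := h (l - 1) (by omega) (by omega)
    have h2 := h (l - 2) (by omega) (by omega)
    unfold rootD vecD at h1 h2
    dsimp only at h1 h2
    rw [if_pos rfl] at h1
    rw [if_neg (by omega), if_pos rfl] at h2
    have e1 : weightB l a (l - 2) - weightB l b (l - 2) ≤ 0 := by
      unfold weightB step
      split_ifs <;> omega
    have e2 : forkWeight l a - forkWeight l b = 1 ∨ forkWeight l a - forkWeight l b = -1 := by
      unfold forkWeight
      split_ifs <;> omega
    omega
  obtain ⟨p, hp, hs⟩ := exists_arc_strip (N := l) (a := a) (c := 2 * l - 1 - a) ha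
    (by omega) (by omega)
  have hr : p.2 = p.1 + l := (strip_add_strip hp).1 (by omega)
  refine ⟨(p, decide (b = l)), mem_taggedArcs.2 ⟨hp, fun h => absurd hr h⟩, fun k hk0 hk => ?_⟩
  have ed : tagSign l (p, decide (b = l)) = forkWeight l a - forkWeight l b := by
    unfold tagSign forkWeight
    rw [if_pos hr]
    simp only [decide_eq_true_eq]
    split_ifs <;> omega
  rw [ed]
  refine vecD_congr (fun k hk0 hk => ?_) hl hk0 hk
  dsimp only
  have e : chordVec a (2 * l - 1 - a) k = weightB l a k - weightB l b k := by
    rw [chordVec_of_lt (by omega)]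
    unfold weightB step
    split_ifs <;> omega
  rw [foldVec, if_pos (by omega)]
  have hs' : (strip p.1 = a ∧ strip p.2 = 2 * l - 1 - a) ∨
    (strip p.1 = 2 * l - 1 - a ∧ strip p.2 = a) := by omega
  rcases hs' with ⟨h1, h2⟩ | ⟨h1, h2⟩
  · rw [h1, h2, e]
  · rw [h1, h2, chordVec_comm, e]

lemma exists_taggedArc_of_rootD {l a b : ℤ} (hl : 4 ≤ l) (ha : 0 ≤ a) (hal : a < 2 * l)
    (hb : 0 ≤ b) (hbl : b < 2 * l) (hab : a ≠ b) (hab' : a + b ≠ 2 * l - 1)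
    (h : ∀ k, 0 ≤ k → k < l → 0 ≤ rootD l a b k) :
    ∃ x ∈ taggedArcs l, ∀ k, 0 ≤ k → k < l →
      vecD l (foldVec (l - 1) (strip x.1.1) (strip x.1.2)) (tagSign l x) k = rootD l a b k := by
  by_cases h1 : b = l - 1 ∨ b = l
  · exact exists_radius_of_rootD hl ha hab hab' h1 h
  by_cases h2 : a = l - 1 ∨ a = l
  · simp only [rootD_neg l a b] at h ⊢
    exact exists_radius_of_rootD hl (by omega) (by omega) (by omega) (by omega) h
  have ed : forkWeight l a - forkWeight l b = 0 := by
    unfold forkWeight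
    split_ifs <;> omega
  have ew : ∀ k, k < l - 1 → weightB l a k - weightB l b k =
      weightB (l - 1) (if a < l then a else a - 2) k -
        weightB (l - 1) (if b < l then b else b - 2) k := fun k hk => by
    rw [weightB_pred (by omega) (by omega) hk, weightB_pred (by omega) (by omega) hk]
  obtain ⟨p, hp, hr, -, -, hs⟩ := exists_arc_of_weightB (l := l - 1)
    (a := if a < l then a else a - 2) (b := if b < l then b else b - 2)
    (by split_ifs <;> omega) (by split_ifs <;> omega) (by split_ifs <;> omega)
    (by split_ifs <;> omega) (by split_ifs <;> omega) (by split_ifs <;> omega) (by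
      intro k hk0 hk
      rw [← ew k hk]
      by_cases hk2 : k = l - 2
      · have := h k hk0 (by omega)
        rw [rootD, vecD, if_neg (by omega), if_pos hk2, ed] at this
        rw [hk2]
        omega
      · have := h k hk0 (by omega)
        rwa [rootD, vecD, if_neg (by omega), if_neg hk2] at this)
  rw [show l - 1 + 1 = l by ring] at hp hr
  refine ⟨(p, false), mem_taggedArcs.2 ⟨hp, fun _ => rfl⟩, fun k hk0 hk => ?_⟩
  rw [rootD, ed, tagSign, if_neg hr]
  refine vecD_congr (fun k _ hk => ?_) hl hk0 hk
  rw [ew k hk, hs]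

/-- The reflection on arcs and radii; the reflection of the colour of the two nodes `l - 2` and
`l - 1` also exchanges the labels of the radii. -/
def reflTagged (l : ℕ) (ε : Bool) (x : (ℤ × ℤ) × Bool) : (ℤ × ℤ) × Bool :=
  (reflArc l (centre ε) x.1,
    if x.1.2 = x.1.1 + l ∧ (l - 2).bodd = ε then !x.2 else x.2)

lemma reflArc_radius {N : ℤ} (ε : Bool) (p : ℤ × ℤ) :
    (reflArc N (centre ε) p).2 = (reflArc N (centre ε) p).1 + N ↔ p.2 = p.1 + N := by
  unfold reflArc
  split_ifs <;> dsimp only <;> omega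

lemma tagSign_reflTagged (l : ℕ) (ε : Bool) (x : (ℤ × ℤ) × Bool) :
    tagSign l (reflTagged l ε x) = if (l - 2).bodd = ε then -tagSign l x else tagSign l x := by
  unfold tagSign
  have : (reflTagged l ε x).1 = reflArc l (centre ε) x.1 := rfl
  simp only [this, reflArc_radius]
  unfold reflTagged
  by_cases h1 : x.1.2 = x.1.1 + l <;> by_cases h2 : (l - 2).bodd = ε <;> cases h3 : x.2 <;>
    simp [h1, h2]

lemma reflTagged_mem (l : ℕ) (ε : Bool) {x : (ℤ × ℤ) × Bool} (hx : x ∈ taggedArcs l) :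
    reflTagged l ε x ∈ taggedArcs l := by
  rw [mem_taggedArcs] at *
  refine ⟨reflArc_mem ε hx.1, fun h => ?_⟩
  have h' : ¬(x.1.2 = x.1.1 + l) := fun e => h ((reflArc_radius ε x.1).2 e)
  simp only [reflTagged, h', false_and, if_false]
  exact hx.2 h'

lemma reflTagged_reflTagged (l : ℕ) (ε : Bool) {x : (ℤ × ℤ) × Bool} (hx : x ∈ taggedArcs l) :
    reflTagged l ε (reflTagged l ε x) = x := by
  rw [mem_taggedArcs] at hx
  have h := reflArc_radius (N := l) ε x.1
  unfold reflTagged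
  ext1
  · exact reflArc_reflArc ε hx.1
  · simp only [h]
    split_ifs <;> simp

lemma compatTagged_reflTagged (l : ℕ) (ε : Bool) {x y : (ℤ × ℤ) × Bool} (hx : x ∈ taggedArcs l)
    (hy : y ∈ taggedArcs l) (h : CompatTagged l x y) :
    CompatTagged l (reflTagged l ε x) (reflTagged l ε y) := by
  have hx1 : (reflTagged l ε x).1 = reflArc l (centre ε) x.1 := rfl
  have hy1 : (reflTagged l ε y).1 = reflArc l (centre ε) y.1 := rfl
  constructor
  · rw [hx1, hy1, reflArc_radius, reflArc_radius]
    intro h1 h2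
    rcases h.1 h1 h2 with h3 | h3
    · left
      simp only [reflTagged, h1, h2, h3, true_and]
    · right
      rw [h3]
  · rw [hx1, hy1, reflArc_radius, reflArc_radius]
    intro h1
    exact noncrossingCyclic_reflArc ε (mem_taggedArcs.1 hx).1 (mem_taggedArcs.1 hy).1 (h.2 h1)

/-- The vertices attached to the negative simple roots. -/
def negTagged (l i : ℤ) : (ℤ × ℤ) × Bool :=
  if i = l - 1 then ((snakeLo (l - 2), snakeHi (l - 2)), false)
  else ((snakeLo i, snakeHi i), decide (i = l - 2))

lemma snake_radius {l i : ℤ} : snakeHi i = snakeLo i + l ↔ i = l - 2 := by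
  unfold snakeHi snakeLo
  omega

lemma vec_negTagged {l i k : ℤ} (hl : 4 ≤ l) (hi0 : 0 ≤ i) (hi : i < l) (hk0 : 0 ≤ k)
    (hk : k < l) : vecD l (foldVec (l - 1) (strip (negTagged l i).1.1) (strip (negTagged l i).1.2))
      (tagSign l (negTagged l i)) k = if k = i then -1 else 0 := by
  have hf : ∀ j, 0 ≤ j → j < l - 1 → ∀ k, 0 ≤ k → k < l - 1 →
      foldVec (l - 1) (strip (snakeLo j)) (strip (snakeHi j)) k =
      if k = j then (if j = l - 2 then -1 else if k = l - 2 then -2 else -1) else 0 := by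
    intro j hj hjl k hk hkl
    have := strip_snake hj
    unfold foldVec
    rw [chordVec_snake hj, chordVec_snake hj]
    split_ifs <;> omega
  unfold negTagged
  by_cases h1 : i = l - 1
  · rw [if_pos h1]
    unfold tagSign vecD
    dsimp only
    rw [if_pos (snake_radius.2 rfl), hf _ (by omega) (by omega) _ (by omega) (by omega)]
    simp only [if_true, Bool.false_eq_true, if_false]
    by_cases h2 : k = l - 1
    · rw [if_pos h2]
      split_ifs <;> omega
    · by_cases h3 : k = l - 2
      · rw [if_neg h2, if_pos h3]
        split_ifs <;> omega
      · rw [if_neg h2, if_neg h3, hf _ (by omega) (by omega) _ (by omega) (by omega)]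
        split_ifs <;> omega
  · rw [if_neg h1]
    unfold tagSign vecD
    dsimp only
    simp only [snake_radius, decide_eq_true_eq]
    rw [hf _ (by omega) (by omega) _ (by omega) (by omega)]
    by_cases h2 : k = l - 1
    · rw [if_pos h2]
      split_ifs <;> omega
    · by_cases h3 : k = l - 2
      · rw [if_neg h2, if_pos h3]
        split_ifs <;> omega
      · rw [if_neg h2, if_neg h3, hf _ (by omega) (by omega) _ (by omega) (by omega)]
        split_ifs <;> omega

lemma negTagged_mem {l i : ℤ} (hl : 4 ≤ l) (hi0 : 0 ≤ i) (hi : i < l) :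
    negTagged l i ∈ taggedArcs l := by
  rw [mem_taggedArcs]
  unfold negTagged
  split_ifs with h
  · exact ⟨snake_mem_cyclicArcs (by omega) (by omega), fun _ => rfl⟩
  · refine ⟨snake_mem_cyclicArcs (by omega) (by omega), fun h => ?_⟩
    dsimp only at *
    rw [Ne, snake_radius] at h
    simpa using h

/-- The tagged arcs on an edge of the zigzag are the vertices of the negative simple roots. -/
lemma exists_eq_negTagged {l j : ℤ} {x : (ℤ × ℤ) × Bool} (hx : x ∈ taggedArcs l)
    (hj0 : 0 ≤ j) (hjl : j < l - 1) (h : x.1 = (snakeLo j, snakeHi j)) :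
    ∃ i, 0 ≤ i ∧ i < l ∧ x = negTagged l i ∧ (i = j ∨ (j = l - 2 ∧ i = l - 1)) := by
  obtain ⟨p, t⟩ := x
  dsimp only at h
  subst h
  have ht := (mem_taggedArcs.1 hx).2
  dsimp only at ht
  rw [Ne, snake_radius] at ht
  by_cases h1 : j = l - 2
  · subst h1
    cases t
    · exact ⟨l - 1, by omega, by omega, by rw [negTagged, if_pos rfl], by omega⟩
    · exact ⟨l - 2, by omega, by omega, by rw [negTagged, if_neg (by omega)]; simp, by omega⟩
  · exact ⟨j, by omega, by omega, by rw [negTagged, if_neg (by omega)]; simp [ht h1, h1], by omega⟩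

lemma sign_typeD {l : ℕ} (hl : 4 ≤ l) (k : Fin l) (ε : Bool) : (typeD l).sign k = ε ↔
    (if (k : ℤ) = l - 1 then (l : ℤ) - 2 else k) % 2 = if ε then 1 else 0 := by
  have hk := k.2
  simp only [typeD]
  by_cases h : (k : ℕ) + 1 = l
  · rw [if_pos h, if_pos (by omega), sign_eq_iff, show ((l - 2 : ℕ) : ℤ) = l - 2 by omega]
  · rw [if_neg h, if_neg (by omega), sign_eq_iff]

lemma compatTagged_neg {l i : ℤ} (hl : 4 ≤ l) (hi0 : 0 ≤ i) (hi : i < l) {x : (ℤ × ℤ) × Bool}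
    (hx : x ∈ taggedArcs l) : CompatTagged l (negTagged l i) x ↔
      vecD l (foldVec (l - 1) (strip x.1.1) (strip x.1.2)) (tagSign l x) i ≤ 0 := by
  obtain ⟨hp, ht⟩ := mem_taggedArcs.1 hx
  have hf := foldVec_fork hp
  have hN : ∀ j, 0 ≤ j → j < l - 1 → (NoncrossingCyclic l (snakeLo j, snakeHi j) x.1 ↔
      foldVec (l - 1) (strip x.1.1) (strip x.1.2) j ≤ 0) :=
    fun j h0 h1 => by
      have := noncrossingCyclic_snake (l := l - 1) (p := x.1) h0 h1
        (by rwa [show l - 1 + 1 = l by ring])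
      rwa [show l - 1 + 1 = l by ring] at this
  -- the radius with the same end as the last edge of the zigzag
  have hrad : x.1.2 = x.1.1 + l → ((snakeLo (l - 2), snakeHi (l - 2)) = x.1 ↔
      foldVec (l - 1) (strip x.1.1) (strip x.1.2) (l - 2) = -1) := by
    intro hr
    have hs := (strip_add_strip hp).2 hr
    have hb := strip_bounds hp
    have hp' := mem_cyclicArcs.1 hp
    rw [foldVec, if_pos (by omega)]
    constructor
    · intro h
      rw [← h, chordVec_snake (by omega), if_pos rfl]
    · intro h
      have h1 : strip x.1.2 = strip x.1.1 + 1 ∨ strip x.1.1 = strip x.1.2 + 1 := by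
        unfold chordVec step at h
        split_ifs at h <;> omega
      rw [arc_eq_snake hp h1, show x.1.2 - x.1.1 - 2 = l - 2 by omega]
  unfold CompatTagged negTagged
  by_cases h1 : i = l - 1
  · rw [if_pos h1, vecD, if_pos h1]
    dsimp only
    rw [snake_radius]
    unfold tagSign
    by_cases hr : x.1.2 = x.1.1 + l
    · have := hrad hr
      have := hf.1 hr
      cases h3 : x.2 <;> simp_all <;> omega
    · have := hf.2 hr
      simp only [hr, if_false]
      simp only [false_implies, implies_true, and_false, not_false_eq_true, true_and, true_implies]
      rw [hN _ (by omega) (by omega)]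
      omega
  · rw [if_neg h1, vecD, if_neg h1]
    dsimp only
    rw [snake_radius]
    unfold tagSign
    by_cases h2 : i = l - 2
    · subst h2
      by_cases hr : x.1.2 = x.1.1 + l
      · have := hrad hr
        have := hf.1 hr
        cases h3 : x.2 <;> simp_all <;> omega
      · have := hf.2 hr
        simp only [hr, if_false, if_true]
        simp only [false_implies, implies_true, and_false, not_false_eq_true, true_and,
          true_implies]
        rw [hN _ (by omega) (by omega)]
        omega
    · rw [if_neg h2]
      simp only [h2, false_implies, false_and, not_false_eq_true, true_and, true_implies]
      exact hN i hi0 (by omega)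

lemma vecD_injOn {l : ℤ} (hl : 4 ≤ l) {x y : (ℤ × ℤ) × Bool} (hx : x ∈ taggedArcs l)
    (hy : y ∈ taggedArcs l) (h : ∀ k, 0 ≤ k → k < l →
      vecD l (foldVec (l - 1) (strip x.1.1) (strip x.1.2)) (tagSign l x) k =
      vecD l (foldVec (l - 1) (strip y.1.1) (strip y.1.2)) (tagSign l y) k) : x = y := by
  obtain ⟨hx1, hx2⟩ := mem_taggedArcs.1 hx
  obtain ⟨hy1, hy2⟩ := mem_taggedArcs.1 hy
  have px := foldVec_add_tagSign hx1
  have py := foldVec_add_tagSign hy1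
  have h1 := h (l - 1) (by omega) (by omega)
  have h2 := h (l - 2) (by omega) (by omega)
  rw [vecD, vecD, if_pos rfl, if_pos rfl] at h1
  simp only [vecD, if_neg (show ¬(l - 2 = l - 1) by omega), if_true] at h2
  have h3 : x.1 = y.1 := by
    refine arc_ext_of_foldVec (l := l - 1) (by rwa [sub_add_cancel]) (by rwa [sub_add_cancel])
      fun k hk hkl => ?_
    by_cases e : k = l - 2
    · subst e
      omega
    · have := h k hk (by omega)
      simpa only [vecD, if_neg (show ¬(k = l - 1) by omega), if_neg e] using this
  have h4 : tagSign l x = tagSign l y := by omega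
  ext1
  · exact h3
  · unfold tagSign at h4
    rw [h3] at h4 hx2
    by_cases hr : y.1.2 = y.1.1 + l
    · rw [if_pos hr, if_pos hr] at h4
      cases hx : x.2 <;> cases hy : y.2 <;> simp_all
    · rw [hx2 hr, hy2 hr]

lemma vecD_nonneg {l : ℤ} {x : (ℤ × ℤ) × Bool} (hx : x ∈ taggedArcs l)
    (h1 : strip x.1.2 ≠ strip x.1.1 + 1) (h2 : strip x.1.1 ≠ strip x.1.2 + 1) (k : ℤ) :
    0 ≤ vecD l (foldVec (l - 1) (strip x.1.1) (strip x.1.2)) (tagSign l x) k := by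
  have hp := (mem_taggedArcs.1 hx).1
  have hc := chordVec_nonneg (strip_bounds hp).2.2.2.2.1 h1 h2
  have hf : ∀ k, 0 ≤ foldVec (l - 1) (strip x.1.1) (strip x.1.2) k := by
    intro k
    have h3 := hc k
    have h4 := hc (2 * (l - 1) - 2 - k)
    unfold foldVec
    split_ifs <;> omega
  have h5 := hf k
  have h6 := hf (l - 2)
  have h7 := (foldVec_fork hp).1
  unfold vecD tagSign
  split_ifs <;> omega

lemma vecD_reflTagged {l : ℕ} (hl : 4 ≤ l) (ε : Bool) {x : (ℤ × ℤ) × Bool} (hx : x ∈ taggedArcs l)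
    (hne : ∀ i : Fin l, (typeD l).sign i ≠ ε → x ≠ negTagged l i) (k : Fin l) :
    vecD l (foldVec (l - 1) (strip (reflTagged l ε x).1.1) (strip (reflTagged l ε x).1.2))
      (tagSign l (reflTagged l ε x)) k =
    if (typeD l).sign k = ε then
      vecD l (foldVec (l - 1) (strip x.1.1) (strip x.1.2)) (tagSign l x) k -
        ((fun i : Fin l => vecD l (foldVec (l - 1) (strip x.1.1) (strip x.1.2)) (tagSign l x) i) ᵥ*
          (typeD l).C) k
    else vecD l (foldVec (l - 1) (strip x.1.1) (strip x.1.2)) (tagSign l x) k := by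
  have hk := k.2
  have hl' : (4 : ℤ) ≤ l := by omega
  obtain ⟨hp, ht⟩ := mem_taggedArcs.1 hx
  obtain ⟨a1, a2, a3, a4, a5, a6, a7, a8, a9⟩ := strip_bounds hp
  have hpar := foldVec_add_tagSign hp
  have hC : ((fun i : Fin l => vecD l (foldVec (l - 1) (strip x.1.1) (strip x.1.2))
      (tagSign l x) i) ᵥ* (typeD l).C) k = _ :=
    vecMul_cartanD hl (foldVec (l - 1) (strip x.1.1) (strip x.1.2)) (tagSign l x)
      (foldVec_neg_one a1 a3 (by omega) (by omega) a8 (by omega) a5) hpar k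
  have hsym : foldVec (l - 1) (strip x.1.1) (strip x.1.2) (l - 1) =
      foldVec (l - 1) (strip x.1.1) (strip x.1.2) (l - 3) := by
    rw [← foldVec_symm]
    congr 1
    ring
  have hR : ∀ k, 0 ≤ k → k < (l : ℤ) - 1 →
      foldVec (l - 1) (strip (reflArc l (centre ε) x.1).1) (strip (reflArc l (centre ε) x.1).2) k =
      if k % 2 = (if ε then 1 else 0) then
        foldVec (l - 1) (strip x.1.1) (strip x.1.2) (k - 1) +
          foldVec (l - 1) (strip x.1.1) (strip x.1.2) (k + 1) -
          foldVec (l - 1) (strip x.1.1) (strip x.1.2) k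
      else foldVec (l - 1) (strip x.1.1) (strip x.1.2) k := by
    intro k hk hkl
    have := foldVec_reflArc (l := l - 1) ε (p := x.1) (by rwa [sub_add_cancel]) (by
      intro i hi hil hie h
      obtain ⟨j, hj, hjl, h1, h2⟩ := exists_eq_negTagged hx hi hil h
      refine hne ⟨j.toNat, by omega⟩ ?_ ?_
      · rw [Ne, sign_typeD hl]
        dsimp only
        rw [show ((j.toNat : ℕ) : ℤ) = j by omega]
        split_ifs at hie ⊢ <;> omega
      · dsimp only
        rwa [show ((j.toNat : ℕ) : ℤ) = j by omega]) hk hkl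
    rwa [sub_add_cancel] at this
  have hb : (l - 2).bodd = ε ↔ ((l : ℤ) - 2) % 2 = if ε then 1 else 0 := by
    rw [sign_eq_iff, show ((l - 2 : ℕ) : ℤ) = l - 2 by omega]
  rw [hC, tagSign_reflTagged]
  simp only [sign_typeD hl, hb]
  have hx1 : (reflTagged l ε x).1 = reflArc l (centre ε) x.1 := rfl
  rw [hx1]
  have hR2 := hR (l - 2) (by omega) (by omega)
  rw [show (l : ℤ) - 2 - 1 = l - 3 by ring, show (l : ℤ) - 2 + 1 = l - 1 by ring, hsym] at hR2
  by_cases c1 : (k : ℤ) = l - 1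
  · simp only [vecD, if_pos c1, hR2]
    split_ifs <;> omega
  by_cases c2 : (k : ℤ) = l - 2
  · simp only [vecD, if_neg c1, if_pos c2, hR2]
    split_ifs <;> omega
  · simp only [vecD, if_neg c1, if_neg c2]
    rw [hR k (by omega) (by omega)]
    split_ifs <;> omega

/-- The model of the cluster complex of type `D_l`: the tagged arcs in a disc with `l` boundary
points and an interior point. -/
noncomputable def modelD (l : ℕ) (hl : 4 ≤ l) : Model (typeD l) ((ℤ × ℤ) × Bool) where
  verts := taggedArcs l
  refl ε := reflTagged l ε
  vec x k := vecD l (foldVec (l - 1) (strip x.1.1) (strip x.1.2)) (tagSign l x) k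
  neg i := negTagged l i
  compat := CompatTagged l
  diag i := by simp [typeD, CartanMatrix.D]
  refl_mem ε _ hx := reflTagged_mem l ε hx
  refl_refl ε _ hx := reflTagged_reflTagged l ε hx
  neg_mem i := negTagged_mem (by omega) (by omega) (by have := i.2; omega)
  vec_neg i := by
    funext k
    have hi := i.2
    have hk := k.2
    rw [vec_negTagged (by omega) (by omega) (by omega) (by omega) (by omega)]
    simp only [simpleRoot, Pi.neg_apply, Pi.single_apply, Fin.ext_iff]
    split_ifs <;> omega
  vec_injOn := by
    intro x hx y hy h
    refine vecD_injOn (by omega) (Finset.mem_coe.1 hx) (Finset.mem_coe.1 hy) fun k hk hkl => ?_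
    have := congrFun h ⟨k.toNat, by omega⟩
    simpa [hk] using this
  vec_nonneg := by
    intro x hx
    have hp := (mem_taggedArcs.1 hx).1
    by_cases h : strip x.1.2 = strip x.1.1 + 1 ∨ strip x.1.1 = strip x.1.2 + 1
    · left
      have hp' := mem_cyclicArcs.1 hp
      obtain ⟨i, hi, hil, h, -⟩ := exists_eq_negTagged hx (j := x.1.2 - x.1.1 - 2) (by omega)
        (by omega) (arc_eq_snake hp h)
      refine ⟨⟨i.toNat, by omega⟩, ?_⟩
      dsimp only
      rwa [show ((i.toNat : ℕ) : ℤ) = i by omega]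
    · right
      intro k
      exact vecD_nonneg hx (by omega) (by omega) k
  vec_surj := by
    intro v hv h0
    obtain ⟨a, b, ha, hal, hb, hbl, hab, hab', rfl⟩ := isRoot_cartanD hl hv
    obtain ⟨x, hx, h⟩ := exists_taggedArc_of_rootD (l := l) (by omega) ha hal hb hbl hab hab'
      fun k hk hkl => by
        have := h0 ⟨k.toNat, by omega⟩
        simpa [hk] using this
    refine ⟨x, hx, ?_⟩
    funext k
    have hk := k.2
    exact h k (by omega) (by omega)
  refl_neg ε i hi := by
    have hil := i.2
    have hb : (l - 2).bodd = ε ↔ ((l : ℤ) - 2) % 2 = if ε then 1 else 0 := by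
      rw [sign_eq_iff, show ((l - 2 : ℕ) : ℤ) = l - 2 by omega]
    rw [Ne, sign_typeD hl] at hi
    unfold reflTagged negTagged
    by_cases h1 : (i : ℤ) = l - 1
    · simp only [if_pos h1] at hi ⊢
      rw [reflArc_snake (by omega) (by omega) hi, if_neg (fun h => hi (hb.1 h.2))]
    · simp only [if_neg h1] at hi ⊢
      rw [reflArc_snake (by omega) (by omega) hi, if_neg]
      rintro ⟨h2, h3⟩
      rw [snake_radius] at h2
      rw [h2] at hi
      exact hi (hb.1 h3)
  vec_refl ε x hx hne k := vecD_reflTagged hl ε hx hne k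
  compat_symm x y h := ⟨fun h1 h2 => (h.1 h2 h1).imp Eq.symm Eq.symm,
    fun h1 => (h.2 fun h2 => h1 h2.symm).symm⟩
  compat_refl ε _ hx _ hy h := compatTagged_reflTagged l ε hx hy h
  compat_neg i _ hx := compatTagged_neg (by omega) (by omega) (by have := i.2; omega) hx
  orbit P h0 h := by
    have key := reflArc_orbit (N := l) (fun p => ∀ t, (p, t) ∈ taggedArcs (l : ℤ) → P (p, t))
      (fun i hi hil t ht => by
        obtain ⟨j, hj, hjl, e, -⟩ := exists_eq_negTagged ht hi (by omega) rfl
        have := h0 ⟨j.toNat, by omega⟩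
        rw [e]
        simpa [hj] using this)
      (fun ε p hp ih t ht => by
        have h1 := reflTagged_mem l ε ht
        have e : reflTagged l ε (reflArc l (centre ε) p, t) =
            (p, (reflTagged l ε (reflArc l (centre ε) p, t)).2) := by
          ext1
          · exact reflArc_reflArc ε hp
          · rfl
        rw [e] at h1
        have h2 := h ε _ h1 (ih _ h1)
        rwa [← e, reflTagged_reflTagged l ε ht] at h2)
    rintro ⟨p, t⟩ hx
    exact key p (mem_taggedArcs.1 hx).1 t hx

/-! ### Counting dissections -/

/-- The diagonals of the polygon with vertices the integers from `lo` to `hi`, together with the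
edge from `lo` to `hi`. -/
noncomputable def segments (lo hi : ℤ) : Finset (ℤ × ℤ) :=
  (Finset.Icc lo hi ×ˢ Finset.Icc lo hi).filter fun p => p.1 + 2 ≤ p.2

lemma mem_segments {lo hi : ℤ} {p : ℤ × ℤ} : p ∈ segments lo hi ↔
    lo ≤ p.1 ∧ p.1 + 2 ≤ p.2 ∧ p.2 ≤ hi := by
  simp only [segments, Finset.mem_filter, Finset.mem_product, Finset.mem_Icc]
  omega

lemma Noncrossing.symm {p q : ℤ × ℤ} (h : Noncrossing p q) : Noncrossing q p := ⟨h.2, h.1⟩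

section

variable {S : Type*} [CommRing S] (y : S)

/-- The polynomial that counts the dissections of the polygon with vertices `0, …, n`. -/
noncomputable def diagCount (n : ℤ) : S := cliquePoly y Noncrossing (diagonals 0 n)

/-- The polynomial that counts the dissections of the polygon with vertices `0, …, n` in which the
edge from `0` to `n` may or may not be chosen. -/
noncomputable def segCount (n : ℤ) : S := cliquePoly y Noncrossing (segments 0 n)

lemma cliquePoly_diagonals (a b : ℤ) :
    cliquePoly y Noncrossing (diagonals a b) = diagCount y (b - a) := by
  have e : diagonals a b = (diagonals 0 (b - a)).image fun p => (p.1 + a, p.2 + a) := by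
    ext p
    simp only [Finset.mem_image, mem_diagonals, Prod.exists]
    constructor
    · intro h
      exact ⟨p.1 - a, p.2 - a, by omega, by simp⟩
    · rintro ⟨u, v, h, rfl⟩
      dsimp only
      omega
  rw [e, diagCount]
  refine cliquePoly_image y (fun p _ q _ h => ?_) fun p _ q _ _ => ?_
  · simp only [Prod.mk.injEq] at h
    ext <;> omega
  · unfold Noncrossing
    dsimp only
    omega

lemma cliquePoly_segments (a b : ℤ) :
    cliquePoly y Noncrossing (segments a b) = segCount y (b - a) := by
  have e : segments a b = (segments 0 (b - a)).image fun p => (p.1 + a, p.2 + a) := by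
    ext p
    simp only [Finset.mem_image, mem_segments, Prod.exists]
    constructor
    · intro h
      exact ⟨p.1 - a, p.2 - a, by omega, by simp⟩
    · rintro ⟨u, v, h, rfl⟩
      dsimp only
      omega
  rw [e, segCount]
  refine cliquePoly_image y (fun p _ q _ h => ?_) fun p _ q _ _ => ?_
  · simp only [Prod.mk.injEq] at h
    ext <;> omega
  · unfold Noncrossing
    dsimp only
    omega

lemma segCount_of_lt {n : ℤ} (hn : n < 2) : segCount y n = 1 := by
  have : segments 0 n = ∅ := by
    ext p
    simp only [mem_segments, Finset.notMem_empty, iff_false]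
    omega
  rw [segCount, this, cliquePoly_empty]

lemma segCount_of_le {n : ℤ} (hn : 2 ≤ n) : segCount y n = (1 + y) * diagCount y n := by
  classical
  have e : segments 0 n = insert (0, n) (diagonals 0 n) := by
    ext ⟨p, q⟩
    simp only [Finset.mem_insert, mem_segments, mem_diagonals, Prod.mk.injEq]
    omega
  rw [segCount, e, cliquePoly_insert y (fun _ _ => Noncrossing.symm) (by simp [mem_diagonals]),
    Finset.filter_true_of_mem, diagCount]
  · ring
  · intro p hp
    rw [mem_diagonals] at hp
    unfold Noncrossing
    dsimp only
    omega

/-- Sort the dissections of a polygon by the longest diagonal at the vertex `0`. -/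
lemma diagCount_eq {n : ℤ} (hn : 2 ≤ n) : diagCount y n = segCount y (n - 1) +
    ∑ c ∈ Finset.Icc 2 (n - 1), y * (diagCount y c * segCount y (n - c)) := by
  classical
  have hm : ∀ p, p ∈ (Finset.Icc 2 (n - 1)).image (fun c : ℤ => ((0 : ℤ), c)) ↔
      p.1 = 0 ∧ 2 ≤ p.2 ∧ p.2 ≤ n - 1 := by
    rintro ⟨p, q⟩
    simp only [Finset.mem_image, Finset.mem_Icc, Prod.mk.injEq]
    constructor
    · rintro ⟨c, h, rfl, rfl⟩
      exact ⟨rfl, h⟩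
    · rintro ⟨rfl, h⟩
      exact ⟨q, h, rfl, rfl⟩
  rw [diagCount, cliquePoly_eliminate y (fun _ _ => Noncrossing.symm) Prod.snd
    (m := (Finset.Icc 2 (n - 1)).image (fun c : ℤ => ((0 : ℤ), c)))
    (link := fun p => diagonals 0 p.2 ∪ segments p.2 n)]
  · congr 1
    · rw [← cliquePoly_segments y 1 n]
      congr 1
      ext p
      simp only [Finset.mem_sdiff, hm, mem_diagonals, mem_segments]
      omega
    · rw [Finset.sum_image (by simp)]
      refine Finset.sum_congr rfl fun c hc => ?_
      rw [cliquePoly_union y (fun _ _ => Noncrossing.symm), cliquePoly_segments, diagCount]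
      · rw [Finset.disjoint_left]
        intro p
        simp only [mem_diagonals, mem_segments]
        omega
      · intro p hp q hq
        rw [mem_diagonals] at hp
        rw [mem_segments] at hq
        unfold Noncrossing
        dsimp only at *
        omega
  · intro p
    rw [hm, mem_diagonals]
    omega
  · intro p hp q hq _ h
    rw [hm] at hp hq
    ext <;> omega
  · rintro ⟨a, c⟩ hp ⟨u, v⟩
    rw [hm] at hp
    simp only [Finset.mem_union, mem_diagonals, mem_segments, hm, Ne, Prod.mk.injEq]
    unfold Noncrossing
    dsimp only at *
    omega

/-- The arc modulo `N` that a diagonal of the polygon with vertices `a, …, b`, where `a < 0 ≤ b`,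
represents. -/
def wrapArc (N : ℤ) (p : ℤ × ℤ) : ℤ × ℤ := if p.2 < 0 then (p.1 + N, p.2 + N) else p

lemma mem_image_wrapArc [DecidableEq (ℤ × ℤ)] {N a b : ℤ} (ha : a < 0) (hb : 0 ≤ b)
    (hba : b ≤ a + N) {p : ℤ × ℤ} : p ∈ (diagonals a b).image (wrapArc N) ↔
      p.1 + 2 ≤ p.2 ∧ ((a ≤ p.1 ∧ p.2 ≤ b ∧ 0 ≤ p.2 ∧ ¬(p.1 = a ∧ p.2 = b)) ∨
        (a + N ≤ p.1 ∧ p.2 < N)) := by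
  simp only [Finset.mem_image, mem_diagonals, Prod.exists]
  constructor
  · rintro ⟨u, v, h, rfl⟩
    unfold wrapArc
    split_ifs <;> omega
  · rintro ⟨h1, h2 | h2⟩
    · exact ⟨p.1, p.2, by omega, by rw [wrapArc, if_neg (by dsimp only; omega)]⟩
    · exact ⟨p.1 - N, p.2 - N, by omega, by rw [wrapArc, if_pos (by dsimp only; omega)]; simp⟩

lemma wrapArc_injOn {N a b : ℤ} (hba : b ≤ a + N) :
    Set.InjOn (wrapArc N) (diagonals a b) := by
  intro p hp q hq h
  rw [Finset.mem_coe, mem_diagonals] at hp hq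
  have h1 := congrArg Prod.fst h
  have h2 := congrArg Prod.snd h
  unfold wrapArc at h1 h2
  ext <;> split_ifs at h1 h2 <;> omega

lemma noncrossingCyclic_wrapArc {N a b : ℤ} (ha : a < 0) (hb : 0 ≤ b)
    (hba : b ≤ a + N) {p q : ℤ × ℤ} (hp : p ∈ diagonals a b) (hq : q ∈ diagonals a b) :
    NoncrossingCyclic N (wrapArc N p) (wrapArc N q) ↔ Noncrossing p q := by
  rw [mem_diagonals] at hp hq
  unfold NoncrossingCyclic wrapArc Noncrossing
  split_ifs <;> omega

/-- The arcs of length at most `m` that pass over the edge from `-1` to `0`. -/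
noncomputable def coveringArcs (m : ℤ) : Finset (ℤ × ℤ) :=
  (Finset.Icc (-m) (-1) ×ˢ Finset.Icc 0 m).filter fun p => p.1 + 2 ≤ p.2 ∧ p.2 ≤ p.1 + m

lemma mem_coveringArcs {m : ℤ} {p : ℤ × ℤ} : p ∈ coveringArcs m ↔
    p.1 < 0 ∧ 0 ≤ p.2 ∧ p.1 + 2 ≤ p.2 ∧ p.2 ≤ p.1 + m := by
  simp only [coveringArcs, Finset.mem_filter, Finset.mem_product, Finset.mem_Icc]
  omega

/-- There are `c` arcs of length `c` that pass over a given edge. These factors turn the generating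
function of polygons into its derivative. -/
lemma sum_coveringArcs (m : ℤ) (F : ℤ → S) :
    ∑ p ∈ coveringArcs m, F (p.2 - p.1) = ∑ c ∈ Finset.Icc 2 m, (c : S) * F c := by
  have : ∀ c ∈ Finset.Icc 2 m, (c : S) * F c = ∑ _a ∈ Finset.Icc (-c) (-1), F c := by
    intro c hc
    rw [Finset.mem_Icc] at hc
    rw [Finset.sum_const, Int.card_Icc, nsmul_eq_mul, ← Int.cast_natCast (R := S),
      show ((-1 + 1 - -c).toNat : ℤ) = c by omega]
  rw [Finset.sum_congr rfl this, Finset.sum_sigma']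
  refine Finset.sum_nbij' (fun p => ⟨p.2 - p.1, p.1⟩) (fun x => (x.2, x.1 + x.2)) ?_ ?_ ?_ ?_ ?_
  · intro p hp
    rw [mem_coveringArcs] at hp
    simp only [Finset.mem_sigma, Finset.mem_Icc]
    omega
  · rintro ⟨c, a⟩ hx
    simp only [Finset.mem_sigma, Finset.mem_Icc] at hx
    rw [mem_coveringArcs]
    dsimp only
    omega
  · intro p _
    simp
  · rintro ⟨c, a⟩ _
    simp
  · intro p _
    rfl

/-- Sort the sets of noncrossing arcs by the longest arc over the edge from `-1` to `0`. -/
lemma cliquePoly_cyclicArcs {N : ℤ} :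
    cliquePoly y (NoncrossingCyclic N) (cyclicArcs N) = segCount y (N - 1) +
      ∑ c ∈ Finset.Icc 2 N, (c : S) * (y * (diagCount y c * segCount y (N - c))) := by
  classical
  have hsymm : ∀ p q, NoncrossingCyclic N p q → NoncrossingCyclic N q p := fun _ _ h => h.symm
  have hplain : ∀ a b, 0 ≤ a → cliquePoly y (NoncrossingCyclic N) (segments a b) =
      segCount y (b - a) := by
    intro a b ha
    rw [← cliquePoly_segments, ← cliquePoly_image y (f := id) (r := NoncrossingCyclic N)
      (r' := Noncrossing) Function.injective_id.injOn, Finset.image_id]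
    intro p hp q hq _
    rw [mem_segments] at hp hq
    unfold NoncrossingCyclic
    simp only [id]
    constructor
    · exact fun h => h.1 (by omega) (by omega)
    · exact fun h => ⟨fun _ _ => h, by omega, by omega, by omega⟩
  rw [cliquePoly_eliminate y hsymm (fun p => p.2 - p.1) (m := coveringArcs N)
    (link := fun p => (diagonals p.1 p.2).image (wrapArc N) ∪ segments p.2 (p.1 + N))]
  · congr 1
    · rw [show N - 1 = N - 1 - 0 by ring, ← hplain _ _ le_rfl]
      congr 1
      ext p
      simp only [Finset.mem_sdiff, mem_cyclicArcs, mem_coveringArcs, mem_segments]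
      omega
    · rw [← sum_coveringArcs N fun c => y * (diagCount y c * segCount y (N - c))]
      refine Finset.sum_congr rfl fun p hp => ?_
      rw [mem_coveringArcs] at hp
      rw [cliquePoly_union y hsymm, hplain _ _ (by omega),
        cliquePoly_image y (wrapArc_injOn (by omega)) (r := Noncrossing), cliquePoly_diagonals,
        show p.1 + N - p.2 = N - (p.2 - p.1) by ring]
      · exact fun q hq q' hq' _ => (noncrossingCyclic_wrapArc (by omega) (by omega) (by omega)
          hq hq').symm
      · rw [Finset.disjoint_left]
        intro q
        rw [mem_image_wrapArc (by omega) (by omega) (by omega), mem_segments]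
        omega
      · intro q hq q' hq'
        rw [mem_image_wrapArc (by omega) (by omega) (by omega)] at hq
        rw [mem_segments] at hq'
        unfold NoncrossingCyclic Noncrossing
        omega
  · intro p
    rw [mem_coveringArcs, mem_cyclicArcs]
    omega
  · intro p hp q hq h
    rw [mem_coveringArcs] at hp hq
    unfold NoncrossingCyclic at h
    intro h'
    ext <;> omega
  · intro p hp q
    rw [mem_coveringArcs] at hp
    rw [Finset.mem_union, mem_image_wrapArc (by omega) (by omega) (by omega), mem_segments,
      mem_cyclicArcs, mem_coveringArcs, Ne, Prod.ext_iff]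
    unfold NoncrossingCyclic
    have h1 : ¬(0 ≤ p.1) := by omega
    have h2 : p.1 < 0 := by omega
    simp only [h1, h2, false_implies, true_implies, true_and]
    omega

end

section

variable {S : Type*} [CommRing S] (y : S)

/-- The segments between the points `a, …, b`, together with the radii with label `τ` at the points
`k, …, b`. -/
noncomputable def fan (N a b k : ℤ) (τ : Bool) : Finset ((ℤ × ℤ) × Bool) :=
  ((segments a b).image fun p => (p, false)) ∪ (Finset.Icc k b).image fun x => ((x - N, x), τ)

lemma mem_fan {N a b k : ℤ} {τ : Bool} {x : (ℤ × ℤ) × Bool} : x ∈ fan N a b k τ ↔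
    (a ≤ x.1.1 ∧ x.1.1 + 2 ≤ x.1.2 ∧ x.1.2 ≤ b ∧ x.2 = false) ∨
      (k ≤ x.1.2 ∧ x.1.2 ≤ b ∧ x.1.2 = x.1.1 + N ∧ x.2 = τ) := by
  obtain ⟨⟨p, q⟩, t⟩ := x
  simp only [fan, Finset.mem_union, Finset.mem_image, mem_segments, Finset.mem_Icc, Prod.mk.injEq,
    Prod.exists]
  constructor
  · rintro (⟨u, v, h, ⟨rfl, rfl⟩, rfl⟩ | ⟨u, h, ⟨rfl, rfl⟩, rfl⟩)
    · exact Or.inl ⟨h.1, h.2.1, h.2.2, rfl⟩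
    · exact Or.inr ⟨h.1, h.2, by ring, rfl⟩
  · rintro (⟨h1, h2, h3, rfl⟩ | ⟨h1, h2, h3, rfl⟩)
    · exact Or.inl ⟨p, q, by omega, ⟨rfl, rfl⟩, rfl⟩
    · exact Or.inr ⟨q, by omega, ⟨by omega, rfl⟩, rfl⟩

lemma CompatTagged.symm {N : ℤ} {x x' : (ℤ × ℤ) × Bool} (h : CompatTagged N x x') :
    CompatTagged N x' x :=
  ⟨fun h1 h2 => (h.1 h2 h1).imp Eq.symm Eq.symm, fun h1 => (h.2 fun h2 => h1 h2.symm).symm⟩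

lemma compatTagged_plain {N : ℤ} {x x' : (ℤ × ℤ) × Bool} (h : x.1.2 < x.1.1 + N)
    (h0 : 0 ≤ x.1.1) (h0' : 0 ≤ x'.1.1) :
    CompatTagged N x x' ↔ Noncrossing x.1 x'.1 := by
  have h1 : ¬(x.1.2 = x.1.1 + N) := by omega
  have h2 : ¬(x.1.1 < 0) := by omega
  have h3 : ¬(x'.1.1 < 0) := by omega
  simp [CompatTagged, NoncrossingCyclic, h1, h2, h3, h0, h0']

lemma compatTagged_radius_plain {N : ℤ} {x x' : (ℤ × ℤ) × Bool} (h : x.1.2 = x.1.1 + N)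
    (hN : x.1.2 < N) (h' : x'.1.2 < x'.1.1 + N) (h0' : 0 ≤ x'.1.1) :
    CompatTagged N x x' ↔ ¬(x'.1.1 < x.1.2 ∧ x.1.2 < x'.1.2) := by
  have h1 : ¬(x'.1.2 = x'.1.1 + N) := by omega
  have h2 : ¬(0 ≤ x.1.1) := by omega
  have h3 : ¬(x'.1.1 < 0) := by omega
  simp only [CompatTagged, NoncrossingCyclic, h1, h2, h3, h0', false_implies, and_false,
    true_and, true_implies, implies_true, and_true, not_false_eq_true, ← h]
  have h4 : x.1.1 < 0 := by omega
  simp [h4]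

lemma compatTagged_radius {N : ℤ} {x x' : (ℤ × ℤ) × Bool} (h : x.1.2 = x.1.1 + N)
    (h' : x'.1.2 = x'.1.1 + N) :
    CompatTagged N x x' ↔ x.2 = x'.2 ∨ x.1.2 = x'.1.2 := by
  have : x.1 = x'.1 ↔ x.1.2 = x'.1.2 := by
    rw [Prod.ext_iff]
    omega
  simp [CompatTagged, h, h', this]

lemma cliquePoly_segments_tagged {N a b : ℤ} (ha : 0 ≤ a) (hb : b < N) :
    cliquePoly y (CompatTagged N) ((segments a b).image fun p => (p, false)) =
      segCount y (b - a) := by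
  rw [← cliquePoly_segments]
  refine cliquePoly_image y (fun p _ q _ h => congrArg Prod.fst h) fun p hp q hq _ => ?_
  rw [mem_segments] at hp hq
  rw [compatTagged_plain] <;> dsimp only <;> omega

lemma mem_image_segments [DecidableEq ((ℤ × ℤ) × Bool)] {a b : ℤ} {x : (ℤ × ℤ) × Bool} :
    x ∈ (segments a b).image (fun p => (p, false)) ↔
      a ≤ x.1.1 ∧ x.1.1 + 2 ≤ x.1.2 ∧ x.1.2 ≤ b ∧ x.2 = false := by
  obtain ⟨p, t⟩ := x
  simp only [Finset.mem_image, mem_segments, Prod.mk.injEq]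
  constructor
  · rintro ⟨x, h, rfl, rfl⟩
    exact ⟨h.1, h.2.1, h.2.2, rfl⟩
  · rintro ⟨h1, h2, h3, rfl⟩
    exact ⟨p, ⟨h1, h2, h3⟩, rfl, rfl⟩

lemma mem_image_radius [DecidableEq ((ℤ × ℤ) × Bool)] {N k b : ℤ} {τ : Bool}
    {x : (ℤ × ℤ) × Bool} : x ∈ (Finset.Icc k b).image (fun x : ℤ => ((x - N, x), τ)) ↔
      k ≤ x.1.2 ∧ x.1.2 ≤ b ∧ x.1.2 = x.1.1 + N ∧ x.2 = τ := by
  obtain ⟨⟨p, q⟩, t⟩ := x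
  simp only [Finset.mem_image, Finset.mem_Icc, Prod.mk.injEq]
  constructor
  · rintro ⟨x, h, ⟨rfl, rfl⟩, rfl⟩
    exact ⟨h.1, h.2, by ring, rfl⟩
  · rintro ⟨h1, h2, h3, rfl⟩
    exact ⟨q, by omega, ⟨by omega, rfl⟩, rfl⟩

/-- The polynomial that counts the noncrossing sets in a fan at the points `0, …, n` with radii
at the points `k, …, n`. -/
noncomputable def fanCount (n k : ℤ) : S :=
  cliquePoly y (CompatTagged (n + 1)) (fan (n + 1) 0 n k false)

lemma cliquePoly_fan {N a b k : ℤ} {τ : Bool} (ha : 0 ≤ a) (hb : b < N) :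
    cliquePoly y (CompatTagged N) (fan N a b k τ) = fanCount y (b - a) (k - a) := by
  classical
  let f : (ℤ × ℤ) × Bool → (ℤ × ℤ) × Bool := fun x =>
    if x.1.2 = x.1.1 + (b - a + 1) then ((x.1.2 + a - N, x.1.2 + a), τ)
    else ((x.1.1 + a, x.1.2 + a), x.2)
  have hf1 : ∀ x : (ℤ × ℤ) × Bool, x.1.2 = x.1.1 + (b - a + 1) →
      f x = ((x.1.2 + a - N, x.1.2 + a), τ) := fun x h => if_pos h
  have hf2 : ∀ x : (ℤ × ℤ) × Bool, x.1.2 ≠ x.1.1 + (b - a + 1) →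
      f x = ((x.1.1 + a, x.1.2 + a), x.2) := fun x h => if_neg h
  have e : fan N a b k τ = (fan (b - a + 1) 0 (b - a) (k - a) false).image f := by
    ext x
    simp only [Finset.mem_image, mem_fan]
    constructor
    · rintro (h | h)
      · refine ⟨((x.1.1 - a, x.1.2 - a), x.2), Or.inl ?_, ?_⟩
        · dsimp only
          exact ⟨by omega, by omega, by omega, h.2.2.2⟩
        · rw [hf2 _ (by dsimp only; omega)]
          simp
      · refine ⟨((x.1.2 - a - (b - a + 1), x.1.2 - a), false), Or.inr ?_, ?_⟩
        · dsimp only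
          exact ⟨by omega, by omega, by omega, rfl⟩
        · rw [hf1 _ (by dsimp only; omega)]
          ext <;> dsimp only
          · omega
          · omega
          · exact h.2.2.2.symm
    · rintro ⟨z, h | h, rfl⟩
      · rw [hf2 _ (by omega)]
        left
        dsimp only
        exact ⟨by omega, by omega, by omega, h.2.2.2⟩
      · rw [hf1 _ (by omega)]
        right
        dsimp only
        exact ⟨by omega, by omega, by omega, rfl⟩
  rw [e, fanCount]
  refine cliquePoly_image y ?_ ?_
  · intro x hx z hz h
    rw [Finset.mem_coe, mem_fan] at hx hz
    rcases hx with hx | hx <;> rcases hz with hz | hz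
    · rw [hf2 _ (by omega), hf2 _ (by omega)] at h
      simp only [Prod.mk.injEq] at h
      ext
      · omega
      · omega
      · exact h.2
    · rw [hf2 _ (by omega), hf1 _ (by omega)] at h
      simp only [Prod.mk.injEq] at h
      omega
    · rw [hf1 _ (by omega), hf2 _ (by omega)] at h
      simp only [Prod.mk.injEq] at h
      omega
    · rw [hf1 _ (by omega), hf1 _ (by omega)] at h
      simp only [Prod.mk.injEq] at h
      ext
      · omega
      · omega
      · exact hx.2.2.2.trans hz.2.2.2.symm
  · intro x hx z hz _
    rw [mem_fan] at hx hz
    have hs : ∀ N (x z : (ℤ × ℤ) × Bool), CompatTagged N x z ↔ CompatTagged N z x :=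
      fun N x z => ⟨fun h => h.symm, fun h => h.symm⟩
    rcases hx with hx | hx <;> rcases hz with hz | hz
    · rw [hf2 _ (by omega), hf2 _ (by omega), compatTagged_plain, compatTagged_plain]
      · unfold Noncrossing
        dsimp only
        omega
      all_goals try dsimp only
      all_goals omega
    · rw [hf2 _ (by omega), hf1 _ (by omega), hs, compatTagged_radius_plain, hs,
        compatTagged_radius_plain]
      · dsimp only
        omega
      all_goals try dsimp only
      all_goals omega
    · rw [hf2 z (by omega), hf1 _ (by omega), compatTagged_radius_plain,
        compatTagged_radius_plain]
      · dsimp only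
        omega
      all_goals try dsimp only
      all_goals omega
    · rw [hf1 _ (by omega), hf1 _ (by omega), compatTagged_radius, compatTagged_radius]
      · simp [hx.2.2.2, hz.2.2.2]
      all_goals first | omega | (dsimp only; omega)

/-- Sort the noncrossing sets by their first radius. -/
lemma cliquePoly_fan_eq {N a b k : ℤ} {τ : Bool} (ha : 0 ≤ a) (hk : a ≤ k) (hb : b < N) :
    cliquePoly y (CompatTagged N) (fan N a b k τ) = segCount y (b - a) +
      ∑ x ∈ Finset.Icc k b, y * (segCount y (x - a) *
        cliquePoly y (CompatTagged N) (fan N x b (x + 1) τ)) := by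
  classical
  have hsymm : ∀ p q, CompatTagged N p q → CompatTagged N q p := fun _ _ h => h.symm
  rw [cliquePoly_eliminate y hsymm (fun x => -x.1.2)
    (m := (Finset.Icc k b).image fun x => ((x - N, x), τ))
    (link := fun x => (segments a x.1.2).image (fun p => (p, false)) ∪
      fan N x.1.2 b (x.1.2 + 1) τ)]
  · congr 1
    · rw [← cliquePoly_segments_tagged y ha hb]
      congr 1
      ext x
      rw [Finset.mem_sdiff, mem_image_radius, mem_fan, mem_image_segments]
      constructor
      · rintro ⟨h | h, h'⟩
        · exact h
        · exact absurd h h'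
      · exact fun h => ⟨Or.inl h, by omega⟩
    · rw [Finset.sum_image (by
        intro u _ v _ h
        simp only [Prod.mk.injEq] at h
        omega)]
      refine Finset.sum_congr rfl fun x hx => ?_
      rw [Finset.mem_Icc] at hx
      rw [cliquePoly_union y hsymm, cliquePoly_segments_tagged y ha (by dsimp only; omega)]
      · rw [Finset.disjoint_left]
        intro u
        rw [mem_image_segments, mem_fan]
        dsimp only
        omega
      · intro u hu v hv
        rw [mem_image_segments] at hu
        rw [mem_fan] at hv
        dsimp only at hu hv
        rcases hv with hv | hv
        · rw [compatTagged_plain (by omega) (by omega) (by omega)]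
          unfold Noncrossing
          omega
        · apply hsymm
          rw [compatTagged_radius_plain (by omega) (by omega) (by omega) (by omega)]
          omega
  · intro x
    rw [mem_image_radius, mem_fan]
    exact Or.inr
  · intro x hx z hz _ h
    rw [mem_image_radius] at hx hz
    ext
    · omega
    · omega
    · rw [hx.2.2.2, hz.2.2.2]
  · intro x hx z
    rw [mem_image_radius] at hx
    rw [Finset.mem_union, mem_image_segments, mem_fan, mem_fan, mem_image_radius]
    constructor
    · rintro (h | h | h)
      · refine ⟨Or.inl ⟨h.1, h.2.1, by omega, h.2.2.2⟩, ?_, ?_, by omega⟩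
        · rw [compatTagged_radius_plain (by omega) (by omega) (by omega) (by omega)]
          omega
        · rintro rfl
          omega
      · refine ⟨Or.inl ⟨by omega, h.2.1, by omega, h.2.2.2⟩, ?_, ?_, by omega⟩
        · rw [compatTagged_radius_plain (by omega) (by omega) (by omega) (by omega)]
          omega
        · rintro rfl
          omega
      · refine ⟨Or.inr ⟨by omega, h.2.1, h.2.2⟩, ?_, ?_, by omega⟩
        · rw [compatTagged_radius (by omega) (by omega), hx.2.2.2, h.2.2.2]
          exact Or.inl rfl
        · rintro rfl
          omega
    · rintro ⟨h | h, h1, h2, h3⟩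
      · rw [compatTagged_radius_plain (by omega) (by omega) (by omega) (by omega)] at h1
        by_cases h4 : z.1.2 ≤ x.1.2
        · exact Or.inl ⟨h.1, h.2.1, h4, h.2.2.2⟩
        · exact Or.inr (Or.inl ⟨by omega, h.2.1, h.2.2.1, h.2.2.2⟩)
      · refine Or.inr (Or.inr ⟨?_, h.2.1, h.2.2⟩)
        by_contra h4
        have h5 : x.1.2 = z.1.2 := by
          by_contra h6
          exact h3 ⟨h, by omega⟩
        refine h2 ?_
        ext
        · omega
        · omega
        · rw [hx.2.2.2, h.2.2.2]

/-- In a set of compatible radii with both labels, all radii end at one point. -/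
lemma cliquePoly_fan_union_fan {N a b : ℤ} (ha : 0 ≤ a) (hb : b < N) :
    cliquePoly y (CompatTagged N) (fan N a b a false ∪ fan N a b a true) = fanCount y (b - a) 0 +
      ∑ x ∈ Finset.Icc a b, y * (segCount y (x - a) *
        (fanCount y (b - x) 1 + y * segCount y (b - x))) := by
  classical
  have hsymm : ∀ p q, CompatTagged N p q → CompatTagged N q p := fun _ _ h => h.symm
  rw [cliquePoly_eliminate y hsymm (fun x => -x.1.2)
    (m := (Finset.Icc a b).image fun x => ((x - N, x), true))
    (link := fun x => (segments a x.1.2).image (fun p => (p, false)) ∪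
      insert (x.1, false) (fan N x.1.2 b (x.1.2 + 1) true))]
  · congr 1
    · rw [← sub_self a, ← cliquePoly_fan y (τ := false) ha hb]
      congr 1
      ext x
      rw [Finset.mem_sdiff, Finset.mem_union, mem_image_radius, mem_fan, mem_fan]
      constructor
      · rintro ⟨h | h | h, h'⟩
        · exact h
        · exact Or.inl h
        · exact absurd h h'
      · rintro (h | h)
        · exact ⟨Or.inl (Or.inl h), by omega⟩
        · exact ⟨Or.inl (Or.inr h), fun h' => by simp [h.2.2.2] at h'⟩
    · rw [Finset.sum_image (by
        intro u _ v _ h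
        simp only [Prod.mk.injEq] at h
        omega)]
      refine Finset.sum_congr rfl fun x hx => ?_
      rw [Finset.mem_Icc] at hx
      rw [cliquePoly_union y hsymm, cliquePoly_segments_tagged y ha (by dsimp only; omega),
        cliquePoly_insert y hsymm, cliquePoly_fan y (by dsimp only; omega) hb]
      · dsimp only
        rw [show x + 1 - x = 1 by ring, ← cliquePoly_segments_tagged y (a := x) (by omega) hb]
        congr 5
        ext z
        rw [Finset.mem_filter, mem_fan, mem_image_segments]
        constructor
        · rintro ⟨h | h, h'⟩
          · exact h
          · rw [compatTagged_radius (by dsimp only; ring) (by omega)] at h'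
            rcases h' with h' | h'
            · simp [h.2.2.2] at h'
            · dsimp only at h'
              omega
        · intro h
          refine ⟨Or.inl h, ?_⟩
          rw [compatTagged_radius_plain (by dsimp only; ring) (by dsimp only; omega) (by omega)
            (by omega)]
          dsimp only
          omega
      · rw [mem_fan]
        dsimp only
        omega
      · rw [Finset.disjoint_left]
        intro u
        rw [mem_image_segments, Finset.mem_insert, mem_fan]
        rintro h (rfl | h')
        · dsimp only at h
          omega
        · dsimp only at *
          omega
      · intro u hu v hv
        rw [mem_image_segments] at hu
        rw [Finset.mem_insert, mem_fan] at hv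
        dsimp only at hu hv
        rcases hv with rfl | hv | hv
        · apply hsymm
          rw [compatTagged_radius_plain (by dsimp only; ring) (by dsimp only; omega) (by omega)
            (by omega)]
          dsimp only
          omega
        · rw [compatTagged_plain (by omega) (by omega) (by omega)]
          unfold Noncrossing
          omega
        · apply hsymm
          rw [compatTagged_radius_plain (by omega) (by omega) (by omega) (by omega)]
          omega
  · intro x
    rw [mem_image_radius, Finset.mem_union, mem_fan, mem_fan]
    exact fun h => Or.inr (Or.inr h)
  · intro x hx z hz _ h
    rw [mem_image_radius] at hx hz
    ext
    · omega
    · omega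
    · rw [hx.2.2.2, hz.2.2.2]
  · intro x hx z
    rw [mem_image_radius] at hx
    rw [Finset.mem_union, Finset.mem_insert, Finset.mem_union, mem_image_segments, mem_fan,
      mem_fan, mem_fan, mem_image_radius]
    constructor
    · rintro (h | rfl | h | h)
      · refine ⟨Or.inl (Or.inl ⟨h.1, h.2.1, by omega, h.2.2.2⟩), ?_, ?_, by omega⟩
        · rw [compatTagged_radius_plain (by omega) (by omega) (by omega) (by omega)]
          omega
        · rintro rfl
          omega
      · refine ⟨Or.inl (Or.inr ⟨by dsimp only; omega, by dsimp only; omega,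
          by dsimp only; omega, rfl⟩), ?_, ?_, by dsimp only; omega⟩
        · rw [compatTagged_radius (by omega) (by dsimp only; omega)]
          exact Or.inr rfl
        · intro h
          have := congrArg Prod.snd h
          simp [hx.2.2.2] at this
      · refine ⟨Or.inl (Or.inl ⟨by omega, h.2.1, by omega, h.2.2.2⟩), ?_, ?_, by omega⟩
        · rw [compatTagged_radius_plain (by omega) (by omega) (by omega) (by omega)]
          omega
        · rintro rfl
          omega
      · refine ⟨Or.inr (Or.inr ⟨by omega, h.2.1, h.2.2⟩), ?_, ?_, by omega⟩
        · rw [compatTagged_radius (by omega) (by omega), hx.2.2.2, h.2.2.2]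
          exact Or.inl rfl
        · rintro rfl
          omega
    · rintro ⟨(h | h) | (h | h), h1, h2, h3⟩
      · rw [compatTagged_radius_plain (by omega) (by omega) (by omega) (by omega)] at h1
        by_cases h4 : z.1.2 ≤ x.1.2
        · exact Or.inl ⟨h.1, h.2.1, h4, h.2.2.2⟩
        · exact Or.inr (Or.inr (Or.inl ⟨by omega, h.2.1, h.2.2.1, h.2.2.2⟩))
      · rw [compatTagged_radius (by omega) (by omega), hx.2.2.2, h.2.2.2] at h1
        rcases h1 with h1 | h1
        · simp at h1
        · refine Or.inr (Or.inl ?_)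
          ext
          · dsimp only
            omega
          · dsimp only
            omega
          · exact h.2.2.2
      · rw [compatTagged_radius_plain (by omega) (by omega) (by omega) (by omega)] at h1
        by_cases h4 : z.1.2 ≤ x.1.2
        · exact Or.inl ⟨h.1, h.2.1, h4, h.2.2.2⟩
        · exact Or.inr (Or.inr (Or.inl ⟨by omega, h.2.1, h.2.2.1, h.2.2.2⟩))
      · refine Or.inr (Or.inr (Or.inr ⟨?_, h.2.1, h.2.2⟩))
        by_contra h4
        have h5 : x.1.2 = z.1.2 := by
          by_contra h6
          exact h3 ⟨h, by omega⟩
        refine h2 ?_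
        ext
        · omega
        · omega
        · rw [hx.2.2.2, h.2.2.2]

end

section

variable {S : Type*} [CommRing S] (y : S)

/-- The polynomial that counts the compatible sets of segments and radii with both labels at the
points `0, …, n`. -/
noncomputable def doubleFanCount (n : ℤ) : S := fanCount y n 0 +
  ∑ x ∈ Finset.Icc 0 n, y * (segCount y x * (fanCount y (n - x) 1 + y * segCount y (n - x)))

lemma cliquePoly_fan_union_fan' {N a b : ℤ} (ha : 0 ≤ a) (hb : b < N) :
    cliquePoly y (CompatTagged N) (fan N a b a false ∪ fan N a b a true) =
      doubleFanCount y (b - a) := by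
  rw [cliquePoly_fan_union_fan y ha hb, doubleFanCount]
  congr 1
  refine Finset.sum_nbij' (fun x => x - a) (fun x => x + a) ?_ ?_ ?_ ?_ ?_
  · intro x hx
    rw [Finset.mem_Icc] at *
    omega
  · intro x hx
    rw [Finset.mem_Icc] at *
    omega
  · intro x _
    ring
  · intro x _
    ring
  · intro x _
    rw [show b - a - (x - a) = b - x by ring]

lemma fanCount_eq {n k : ℤ} (hk : 0 ≤ k) : fanCount y n k = segCount y n +
    ∑ x ∈ Finset.Icc k n, y * (segCount y x * fanCount y (n - x) 1) := by
  rw [fanCount, cliquePoly_fan_eq y le_rfl hk (by omega), sub_zero]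
  congr 1
  refine Finset.sum_congr rfl fun x hx => ?_
  rw [Finset.mem_Icc] at hx
  rw [cliquePoly_fan y (by omega) (by omega), sub_zero, show x + 1 - x = 1 by ring]

/-- Sort the compatible sets of tagged arcs by the longest arc over the edge from `-1` to `0`. -/
lemma cliquePoly_taggedArcs {N : ℤ} (hN : 2 ≤ N) :
    cliquePoly y (CompatTagged N) (taggedArcs N) = doubleFanCount y (N - 1) +
      ∑ c ∈ Finset.Icc 2 (N - 1), (c : S) * (y * (diagCount y c * doubleFanCount y (N - c))) := by
  classical
  have hsymm : ∀ p q, CompatTagged N p q → CompatTagged N q p := fun _ _ h => h.symm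
  have hm : ∀ x, x ∈ (coveringArcs (N - 1)).image (fun p => (p, false)) ↔
      x.1.1 < 0 ∧ 0 ≤ x.1.2 ∧ x.1.1 + 2 ≤ x.1.2 ∧ x.1.2 ≤ x.1.1 + (N - 1) ∧ x.2 = false := by
    rintro ⟨p, t⟩
    simp only [Finset.mem_image, mem_coveringArcs, Prod.mk.injEq]
    constructor
    · rintro ⟨q, h, rfl, rfl⟩
      exact ⟨h.1, h.2.1, h.2.2.1, h.2.2.2, rfl⟩
    · rintro ⟨h1, h2, h3, h4, rfl⟩
      exact ⟨p, ⟨h1, h2, h3, h4⟩, rfl, rfl⟩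
  have hw : ∀ a b, a < 0 → 0 ≤ b → b ≤ a + N → ∀ x : (ℤ × ℤ) × Bool,
      x ∈ ((diagonals a b).image (wrapArc N)).image (fun p => (p, false)) ↔
      (x.1.1 + 2 ≤ x.1.2 ∧ ((a ≤ x.1.1 ∧ x.1.2 ≤ b ∧ 0 ≤ x.1.2 ∧ ¬(x.1.1 = a ∧ x.1.2 = b)) ∨
        (a + N ≤ x.1.1 ∧ x.1.2 < N))) ∧ x.2 = false := by
    rintro a b ha hb hba ⟨p, t⟩
    rw [← mem_image_wrapArc ha hb hba, Finset.mem_image]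
    constructor
    · rintro ⟨q, h, h'⟩
      rw [Prod.mk.injEq] at h'
      exact ⟨h'.1 ▸ h, h'.2.symm⟩
    · rintro ⟨h, h'⟩
      exact ⟨p, h, Prod.ext rfl h'.symm⟩
  rw [cliquePoly_eliminate y hsymm (fun x => x.1.2 - x.1.1)
    (m := (coveringArcs (N - 1)).image fun p => (p, false))
    (link := fun x => ((diagonals x.1.1 x.1.2).image (wrapArc N)).image (fun p => (p, false)) ∪
      (fan N x.1.2 (x.1.1 + N) x.1.2 false ∪ fan N x.1.2 (x.1.1 + N) x.1.2 true))]
  · congr 1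
    · rw [show doubleFanCount y (N - 1) = doubleFanCount y (N - 1 - 0) by rw [sub_zero],
        ← cliquePoly_fan_union_fan' y le_rfl (show N - 1 < N by omega)]
      congr 1
      ext x
      rw [Finset.mem_sdiff, hm, Finset.mem_union, mem_fan, mem_fan, mem_taggedArcs,
        mem_cyclicArcs]
      rcases x with ⟨p, _ | _⟩ <;> simp <;> omega
    · rw [← sum_coveringArcs (N - 1) fun c => y * (diagCount y c * doubleFanCount y (N - c)),
        Finset.sum_image fun u _ v _ h => congrArg Prod.fst h]
      refine Finset.sum_congr rfl fun p hp => ?_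
      rw [mem_coveringArcs] at hp
      obtain ⟨a, b⟩ := p
      dsimp only at hp ⊢
      rw [cliquePoly_union y hsymm, cliquePoly_fan_union_fan' y (by omega)
        (by omega), cliquePoly_image y (r := NoncrossingCyclic N),
        cliquePoly_image y (wrapArc_injOn (by omega)) (r := Noncrossing),
        cliquePoly_diagonals, show a + N - b = N - (b - a) by ring]
      · exact fun q hq q' hq' _ => (noncrossingCyclic_wrapArc (by omega) (by omega) (by omega)
          hq hq').symm
      · exact fun u _ v _ h => congrArg Prod.fst h
      · intro u hu v hv _
        rw [mem_image_wrapArc (by omega) (by omega) (by omega)] at hu hv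
        have h1 : ¬(u.2 = u.1 + N) := by omega
        simp [CompatTagged, h1]
      · rw [Finset.disjoint_left]
        intro x
        rw [hw _ _ (by omega) (by omega) (by omega), Finset.mem_union, mem_fan,
          mem_fan]
        omega
      · intro u hu v hv
        rw [hw _ _ (by omega) (by omega) (by omega)] at hu
        rw [Finset.mem_union, mem_fan, mem_fan] at hv
        refine ⟨by omega, fun _ => ?_⟩
        unfold NoncrossingCyclic Noncrossing
        omega
  · intro x
    rw [hm, mem_taggedArcs, mem_cyclicArcs]
    exact fun h => ⟨by omega, fun _ => h.2.2.2.2⟩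
  · intro x hx z hz h
    rw [hm] at hx hz
    have h1 := h.2 (by omega)
    unfold NoncrossingCyclic at h1
    intro h'
    ext
    · omega
    · omega
    · rw [hx.2.2.2.2, hz.2.2.2.2]
  · intro x hx z
    rw [hm] at hx
    have hne : z ≠ x ↔ ¬((z.1.1 = x.1.1 ∧ z.1.2 = x.1.2) ∧ z.2 = x.2) := by
      rw [Ne, Prod.ext_iff, Prod.ext_iff]
    rw [Finset.mem_union, hw _ _ (by omega) (by omega) (by omega), Finset.mem_union, mem_fan,
      mem_fan, mem_taggedArcs, mem_cyclicArcs, hm, hne]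
    have h1 : ¬(0 ≤ x.1.1) := by omega
    have h2 : x.1.1 < 0 := by omega
    have h3 : ¬(x.1.2 = x.1.1 + N) := by omega
    unfold CompatTagged NoncrossingCyclic
    simp only [h1, h2, h3, false_implies, true_implies, true_and, false_and, not_false_eq_true,
      hx.2.2.2.2]
    rcases z with ⟨p, _ | _⟩ <;> simp <;> omega

end

/-! ### Generating functions -/

section algebra

variable {R : Type*} [CommRing R] {x y H H' E K : R}

lemma one_sub_mul_eq_one (hE : E = 1 + x + (1 + y) * H) (hH : H = (x + y * H) * (E - 1)) :
    (1 - x - y * H) * E = 1 := by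
  linear_combination hE + hH

/-- A quadratic equation for `1 - x - yH`, where `H` is the generating function of dissections. -/
lemma quadratic_of_segments (hE : E = 1 + x + (1 + y) * H) (hH : H = (x + y * H) * (E - 1)) :
    (1 + y) * (1 - x - y * H) ^ 2 - (1 + 2 * y - x) * (1 - x - y * H) + y = 0 := by
  subst hE
  linear_combination (-y) * hH

/-- The generating function of type `B` is the inverse of a square root of `1 - 2cx + x²`, where
`c = 1 + 2y`. -/
lemma mul_discriminant_root (hE : E = 1 + x + (1 + y) * H) (hH : H = (x + y * H) * (E - 1))
    (hH' : H' = (1 + y * H') * (E - 1) + (x + y * H) * (1 + (1 + y) * H'))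
    (hK : K = E * (1 + y * H')) :
    K * (2 * (1 + y) * (1 - x - y * H) - (1 + 2 * y - x)) = 1 := by
  have h1 := one_sub_mul_eq_one hE hH
  have h2 : (1 + y * H') * (2 * (1 + y) * (1 - x - y * H) - (1 + 2 * y - x)) = 1 - x - y * H := by
    subst hE
    linear_combination y * hH'
  rw [hK]
  linear_combination E * h2 + h1

lemma discriminant_root_sq (hE : E = 1 + x + (1 + y) * H) (hH : H = (x + y * H) * (E - 1)) :
    (2 * (1 + y) * (1 - x - y * H) - (1 + 2 * y - x)) ^ 2 =
      1 - 2 * (1 + 2 * y) * x + x ^ 2 := by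
  linear_combination 4 * (1 + y) * quadratic_of_segments hE hH

lemma two_mul_derivative_eq (hE : E = 1 + x + (1 + y) * H) (hH : H = (x + y * H) * (E - 1))
    (hH' : H' = (1 + y * H') * (E - 1) + (x + y * H) * (1 + (1 + y) * H'))
    (hK : K = E * (1 + y * H')) :
    2 * y * (1 + y) * H' = (1 + 2 * y - x) * K - (1 + 2 * y) := by
  have h1 := one_sub_mul_eq_one hE hH
  have h2 := mul_discriminant_root hE hH hH' hK
  have h3 : K * (1 - x - y * H) = 1 + y * H' := by
    rw [hK]
    linear_combination (1 + y * H') * h1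
  linear_combination (-2 * (1 + y)) * h3 + h2

/-- The generating function `D` of type `D`, with those of fans `Q`, `U` and double fans `V`
eliminated. -/
lemma two_mul_mul_eq {Q U V D : R} (hE : E = 1 + x + (1 + y) * H)
    (hH : H = (x + y * H) * (E - 1))
    (hH' : H' = (1 + y * H') * (E - 1) + (x + y * H) * (1 + (1 + y) * H'))
    (hK : K = E * (1 + y * H')) (hQ : Q = E + y * (E - 1) * Q) (hU : U = E + y * E * Q)
    (hV : V = U + y * E * (Q + y * E)) (hD : D = V * (1 + y * H') - (1 + y) ^ 2 * (y * H')) :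
    2 * (x * D) = 2 * K - x * K * (1 + 2 * y - x) - 2 - y * x + (1 + y) * (1 + 2 * y) * x := by
  have h1 := one_sub_mul_eq_one hE hH
  have hq := quadratic_of_segments hE hH
  have h2 := mul_discriminant_root hE hH hH' hK
  have h4 := two_mul_derivative_eq hE hH hH' hK
  have h3 : K * (1 - x - y * H) = 1 + y * H' := by
    rw [hK]
    linear_combination (1 + y * H') * h1
  set u := 1 - x - y * H with hu
  -- With `u = 1 / E`, the series `Q` is the inverse of a linear expression in `u`. The quadratic
  -- equation for `u` removes the denominators: `y * E` is linear in `u`, and `x * Q = E - 1`.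
  have h5 : Q * ((1 + y) * u - y) = 1 := by
    linear_combination u * hQ + (1 + y * Q) * h1
  have h6 : y * E = 1 + 2 * y - x - (1 + y) * u := by
    linear_combination E * hq - ((1 + y) * u - (1 + 2 * y - x)) * h1
  have h7 : x * Q = E - 1 := by
    linear_combination Q * (E * hq - ((1 + y) * u - y + x) * h1) + (E - 1) * h5
  have h8 : V * (1 + y * H') = K * (1 + 2 * y * Q + y ^ 2 * E) := by
    rw [← h3, hV, hU]
    linear_combination K * (1 + 2 * y * Q + y ^ 2 * E) * h1
  rw [hD, h8]
  linear_combination 4 * y * K * h7 + (4 * K + 2 * x * y * K) * h6 - x * (1 + y) * h4 -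
    (2 + y * x) * h2

end algebra

section series

variable {S : Type*} [CommRing S] (y : S)

lemma sum_Icc_int {a b : ℤ} (ha : 0 ≤ a) {n : ℕ} (hb : b ≤ n) (F : ℤ → S) :
    ∑ c ∈ Finset.Icc a b, F c =
      ∑ k ∈ Finset.range (n + 1), if a ≤ (k : ℤ) ∧ (k : ℤ) ≤ b then F k else 0 := by
  rw [← Finset.sum_filter]
  refine Finset.sum_nbij' Int.toNat Nat.cast ?_ ?_ ?_ ?_ ?_
  · intro c hc
    simp only [Finset.mem_Icc, Finset.mem_filter, Finset.mem_range] at *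
    omega
  · intro c hc
    simp only [Finset.mem_Icc, Finset.mem_filter, Finset.mem_range] at *
    omega
  · intro c hc
    rw [Finset.mem_Icc] at hc
    omega
  · intro c _
    simp
  · intro c hc
    rw [Finset.mem_Icc] at hc
    rw [show (c.toNat : ℤ) = c by omega]

/-- The generating function of dissections of polygons, graded by `y`. -/
noncomputable def diagSeries : PowerSeries S :=
  PowerSeries.mk fun n => if n < 2 then 0 else diagCount y n

/-- The generating function of dissections of polygons in which the edge from `0` to `n` may or may
not be chosen. -/
noncomputable def segSeries : PowerSeries S := PowerSeries.mk fun n => segCount y n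

lemma segSeries_eq : segSeries y =
    1 + PowerSeries.X + (1 + PowerSeries.C y) * diagSeries y := by
  ext n
  rw [show (1 + PowerSeries.C y : PowerSeries S) = PowerSeries.C (1 + y) by simp, map_add, map_add,
    PowerSeries.coeff_C_mul, segSeries, diagSeries, PowerSeries.coeff_mk, PowerSeries.coeff_mk,
    PowerSeries.coeff_one, PowerSeries.coeff_X]
  rcases lt_or_ge n 2 with h | h
  · rw [segCount_of_lt y (by omega)]
    interval_cases n <;> simp
  · rw [segCount_of_le y (by omega), if_neg (by omega), if_neg (by omega), if_neg (by omega)]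
    ring

lemma coeff_segSeries_sub_one (n : ℕ) :
    PowerSeries.coeff n (segSeries y - 1) = if n = 0 then 0 else segCount y n := by
  rw [map_sub, segSeries, PowerSeries.coeff_mk, PowerSeries.coeff_one]
  split_ifs with h
  · rw [segCount_of_lt y (by omega)]
    ring
  · ring

lemma diagSeries_eq : diagSeries y =
    (PowerSeries.X + PowerSeries.C y * diagSeries y) * (segSeries y - 1) := by
  have hX : ∀ n : ℕ, PowerSeries.coeff n (PowerSeries.X * (segSeries y - 1)) =
      if n < 2 then 0 else segCount y (n - 1) := by
    rintro (_ | n)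
    · simp
    · rw [PowerSeries.coeff_succ_X_mul, coeff_segSeries_sub_one]
      push_cast
      rw [add_sub_cancel_right]
      split_ifs <;> first | omega | rfl
  ext n
  rw [add_mul, mul_assoc, map_add, PowerSeries.coeff_C_mul, hX, PowerSeries.coeff_mul,
    Finset.Nat.sum_antidiagonal_eq_sum_range_succ_mk, Finset.mul_sum]
  simp only [coeff_segSeries_sub_one, diagSeries, PowerSeries.coeff_mk]
  split_ifs with h
  · rw [Finset.sum_eq_zero, add_zero]
    intro k hk
    rw [Finset.mem_range] at hk
    rw [if_pos (by omega), zero_mul, mul_zero]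
  · rw [diagCount_eq y (by omega), sum_Icc_int (by omega) (n := n) (by omega)]
    congr 1
    refine Finset.sum_congr rfl fun k hk => ?_
    rw [Finset.mem_range] at hk
    rw [Nat.cast_sub (by omega)]
    split_ifs <;> first | omega | ring

/-- The generating function of type `B`: the coefficient at `x ^ n` belongs to the disc with `n + 1`
boundary points. -/
noncomputable def cyclicSeries : PowerSeries S :=
  PowerSeries.mk fun n => cliquePoly y (NoncrossingCyclic (n + 1)) (cyclicArcs (n + 1))

lemma coeff_derivative_diagSeries (n : ℕ) :
    PowerSeries.coeff n (PowerSeries.derivative S (diagSeries y)) =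
      if n = 0 then 0 else diagCount y (n + 1) * (n + 1) := by
  rw [PowerSeries.coeff_derivative, diagSeries, PowerSeries.coeff_mk]
  split_ifs <;> first | omega | simp

lemma cyclicSeries_eq : cyclicSeries y =
    segSeries y * (1 + PowerSeries.C y * PowerSeries.derivative S (diagSeries y)) := by
  ext n
  rw [show segSeries y * (1 + PowerSeries.C y * PowerSeries.derivative S (diagSeries y)) =
      segSeries y +
        PowerSeries.C y * (PowerSeries.derivative S (diagSeries y) * segSeries y) by ring,
    map_add, PowerSeries.coeff_C_mul, PowerSeries.coeff_mul,
    Finset.Nat.sum_antidiagonal_eq_sum_range_succ_mk, Finset.mul_sum]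
  simp only [coeff_derivative_diagSeries, segSeries, cyclicSeries, PowerSeries.coeff_mk]
  rw [cliquePoly_cyclicArcs, sum_Icc_int (by omega) (n := n + 1) (by push_cast; omega),
    Finset.sum_range_succ', add_sub_cancel_right]
  congr 1
  rw [if_neg (by simp), add_zero]
  refine Finset.sum_congr rfl fun k hk => ?_
  rw [Finset.mem_range] at hk
  rw [Nat.cast_sub (by omega)]
  push_cast
  rw [show (n : ℤ) + 1 - (k + 1) = n - k by ring]
  split_ifs <;> first | omega | ring

/-- The generating functions of fans. -/
noncomputable def fanSeries (k : ℤ) : PowerSeries S := PowerSeries.mk fun n => fanCount y n k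

lemma fanSeries_one_eq : fanSeries y 1 =
    segSeries y + PowerSeries.C y * (segSeries y - 1) * fanSeries y 1 := by
  ext n
  rw [mul_assoc, map_add, PowerSeries.coeff_C_mul, PowerSeries.coeff_mul,
    Finset.Nat.sum_antidiagonal_eq_sum_range_succ_mk, Finset.mul_sum]
  simp only [coeff_segSeries_sub_one]
  simp only [segSeries, fanSeries, PowerSeries.coeff_mk]
  rw [fanCount_eq y (by omega), sum_Icc_int (by omega) (n := n) le_rfl]
  congr 1
  refine Finset.sum_congr rfl fun k hk => ?_
  rw [Finset.mem_range] at hk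
  rw [Nat.cast_sub (by omega)]
  split_ifs <;> first | omega | ring

lemma fanSeries_zero_eq : fanSeries y 0 =
    segSeries y + PowerSeries.C y * segSeries y * fanSeries y 1 := by
  ext n
  rw [mul_assoc, map_add, PowerSeries.coeff_C_mul, PowerSeries.coeff_mul,
    Finset.Nat.sum_antidiagonal_eq_sum_range_succ_mk, Finset.mul_sum]
  simp only [segSeries, fanSeries, PowerSeries.coeff_mk]
  rw [fanCount_eq y (by omega), sum_Icc_int (by omega) (n := n) le_rfl]
  congr 1
  refine Finset.sum_congr rfl fun k hk => ?_
  rw [Finset.mem_range] at hk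
  rw [Nat.cast_sub (by omega), if_pos (by omega)]

/-- The generating function of double fans. -/
noncomputable def doubleFanSeries : PowerSeries S := PowerSeries.mk fun n => doubleFanCount y n

lemma doubleFanSeries_eq : doubleFanSeries y = fanSeries y 0 +
    PowerSeries.C y * segSeries y * (fanSeries y 1 + PowerSeries.C y * segSeries y) := by
  ext n
  rw [mul_assoc, map_add, PowerSeries.coeff_C_mul, PowerSeries.coeff_mul,
    Finset.Nat.sum_antidiagonal_eq_sum_range_succ_mk, Finset.mul_sum]
  simp only [segSeries, fanSeries, doubleFanSeries, PowerSeries.coeff_mk, map_add,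
    PowerSeries.coeff_C_mul]
  rw [doubleFanCount, sum_Icc_int (by omega) (n := n) le_rfl]
  congr 1
  refine Finset.sum_congr rfl fun k hk => ?_
  rw [Finset.mem_range] at hk
  rw [Nat.cast_sub (by omega), if_pos (by omega)]

lemma doubleFanCount_zero : doubleFanCount y 0 = (1 + y) ^ 2 := by
  have h0 : segCount y 0 = 1 := segCount_of_lt y (by omega)
  have h1 : fanCount y 0 1 = 1 := by
    rw [fanCount_eq y (by omega)]
    simp [h0]
  have h2 : fanCount y 0 0 = 1 + y := by
    rw [fanCount_eq y (by omega)]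
    simp [h0, h1]
  rw [doubleFanCount]
  simp only [Finset.Icc_self, Finset.sum_singleton, sub_self, h0, h1, h2]
  ring

/-- The generating function of type `D`, with the same indexing as that of type `B`. The terms of
degree `0` have no combinatorial meaning. -/
noncomputable def taggedSeries : PowerSeries S := PowerSeries.mk fun n => doubleFanCount y n +
  ∑ c ∈ Finset.Icc 2 (n : ℤ), (c : S) * (y * (diagCount y c * doubleFanCount y (n + 1 - c)))

lemma taggedSeries_eq : taggedSeries y =
    doubleFanSeries y * (1 + PowerSeries.C y * PowerSeries.derivative S (diagSeries y)) -
      (1 + PowerSeries.C y) ^ 2 * (PowerSeries.C y * PowerSeries.derivative S (diagSeries y)) := by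
  ext n
  rw [show doubleFanSeries y * (1 + PowerSeries.C y * PowerSeries.derivative S (diagSeries y)) -
      (1 + PowerSeries.C y) ^ 2 * (PowerSeries.C y * PowerSeries.derivative S (diagSeries y)) =
      doubleFanSeries y +
      (PowerSeries.C y * (PowerSeries.derivative S (diagSeries y) * doubleFanSeries y) -
      PowerSeries.C ((1 + y) ^ 2 * y) * PowerSeries.derivative S (diagSeries y)) by
        simp only [map_mul, map_pow, map_add, map_one]; ring,
    map_add, map_sub, PowerSeries.coeff_C_mul, PowerSeries.coeff_C_mul, PowerSeries.coeff_mul,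
    Finset.Nat.sum_antidiagonal_eq_sum_range_succ_mk, Finset.sum_range_succ, mul_add,
    Finset.mul_sum]
  simp only [coeff_derivative_diagSeries, doubleFanSeries, taggedSeries, PowerSeries.coeff_mk]
  rw [Nat.sub_self, Nat.cast_zero, doubleFanCount_zero,
    sum_Icc_int (by omega) (n := n) le_rfl, Finset.sum_range_succ', if_neg (by simp), add_zero]
  congr 1
  rw [add_sub_assoc, show ∀ b : S, y * (b * (1 + y) ^ 2) - (1 + y) ^ 2 * y * b = 0 by
    intro b; ring, add_zero]
  refine Finset.sum_congr rfl fun k hk => ?_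
  rw [Finset.mem_range] at hk
  rw [Nat.cast_sub (by omega)]
  push_cast
  rw [show (n : ℤ) + 1 - (k + 1) = n - k by ring]
  split_ifs <;> first | omega | ring

end series

/-! ### Legendre polynomials -/

lemma iterate_derivative_succ_X_mul (p : ℝ[X]) (m : ℕ) :
    derivative^[m + 1] (X * p) = X * derivative^[m + 1] p + (m + 1 : ℝ[X]) * derivative^[m] p := by
  rw [mul_comm, iterate_derivative_mul_X]
  simp [nsmul_eq_mul]
  ring

lemma iterate_derivative_add_two_mul (p : ℝ[X]) (m : ℕ) :
    derivative^[m + 2] (X * (1 - X) * p) = X * (1 - X) * derivative^[m + 2] p +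
      ((m : ℝ[X]) + 2) * (1 - 2 * X) * derivative^[m + 1] p -
      ((m : ℝ[X]) + 2) * ((m : ℝ[X]) + 1) * derivative^[m] p := by
  rw [show X * (1 - X) * p = X * p - X * (X * p) by ring, iterate_derivative_sub,
    iterate_derivative_succ_X_mul, iterate_derivative_succ_X_mul, iterate_derivative_succ_X_mul,
    iterate_derivative_succ_X_mul]
  push_cast
  ring

lemma derivative_mul_one_sub_pow (n : ℕ) : derivative ((X * (1 - X) : ℝ[X]) ^ (n + 1)) =
    C ((n : ℝ) + 1) * ((1 - 2 * X) * (X * (1 - X)) ^ n) := by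
  rw [derivative_pow_succ]
  simp [derivative_mul]
  ring

lemma derivative_derivative_mul_one_sub_pow (n : ℕ) :
    derivative (derivative ((X * (1 - X) : ℝ[X]) ^ (n + 2))) =
    C (((n : ℝ) + 2) * (n + 1)) * (X * (1 - X)) ^ n -
      C (((n : ℝ) + 2) * (4 * n + 6)) * (X * (1 - X)) ^ (n + 1) := by
  rw [derivative_mul_one_sub_pow, derivative_C_mul, derivative_mul, derivative_mul_one_sub_pow]
  simp only [derivative_sub, derivative_one, derivative_mul, derivative_X, derivative_ofNat,
    Nat.cast_add, Nat.cast_one, map_add, map_mul, map_one, map_ofNat, map_natCast]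
  ring

/-- The shifted Legendre polynomial `P_n(1 - 2t)`, by its Rodrigues formula. -/
noncomputable def legendre (n : ℕ) : ℝ[X] :=
  C (1 / (n ! : ℝ)) * derivative^[n] ((X * (1 - X)) ^ n)

/-- The antiderivative of `legendre (n + 1)` that vanishes at `0` and at `1`. -/
noncomputable def legendreIntegral (n : ℕ) : ℝ[X] :=
  C (1 / ((n + 1)! : ℝ)) * derivative^[n] ((X * (1 - X)) ^ (n + 1))

lemma legendre_succ (n : ℕ) : legendre (n + 1) =
    C (1 / (n ! : ℝ)) * derivative^[n] ((1 - 2 * X) * (X * (1 - X)) ^ n) := by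
  rw [legendre, Function.iterate_succ_apply, derivative_mul_one_sub_pow, iterate_derivative_C_mul,
    ← mul_assoc, ← C_mul, Nat.factorial_succ]
  congr 2
  have := Nat.factorial_ne_zero n
  push_cast
  field_simp

lemma legendre_add_two (n : ℕ) :
    legendre (n + 2) = legendre n - C (4 * (n : ℝ) + 6) * legendreIntegral n := by
  rw [legendre, Function.iterate_add_apply, Function.iterate_succ_apply', Function.iterate_one,
    derivative_derivative_mul_one_sub_pow, iterate_derivative_sub, iterate_derivative_C_mul,
    iterate_derivative_C_mul, legendre, legendreIntegral, mul_sub, ← mul_assoc, ← mul_assoc,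
    ← mul_assoc, ← C_mul, ← C_mul, ← C_mul, Nat.factorial_succ, Nat.factorial_succ]
  have := Nat.factorial_ne_zero n
  congr 3
  · push_cast
    field_simp
    ring
  · push_cast
    field_simp
    ring

lemma legendre_add_two' (n : ℕ) : legendre (n + 2) =
    (1 - 2 * X) * legendre (n + 1) - 2 * ((n : ℝ[X]) + 1) * legendreIntegral n := by
  rw [legendre_succ, show (1 - 2 * X : ℝ[X]) * (X * (1 - X)) ^ (n + 1) =
    (X * (1 - X)) ^ (n + 1) - C 2 * (X * (X * (1 - X)) ^ (n + 1)) by rw [map_ofNat]; ring,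
    iterate_derivative_sub, iterate_derivative_C_mul, iterate_derivative_succ_X_mul, legendre,
    legendreIntegral]
  simp only [map_ofNat]
  ring

/-- Bonnet's recurrence. -/
lemma legendre_recurrence (n : ℕ) : ((n : ℝ[X]) + 2) * legendre (n + 2) =
    (2 * (n : ℝ[X]) + 3) * (1 - 2 * X) * legendre (n + 1) - ((n : ℝ[X]) + 1) * legendre n := by
  have h1 := legendre_add_two n
  have h2 := legendre_add_two' n
  simp only [map_add, map_mul, map_ofNat, map_natCast] at h1
  linear_combination (2 * (n : ℝ[X]) + 3) * h2 - ((n : ℝ[X]) + 1) * h1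

lemma mul_one_sub_mul_derivative_legendre (n : ℕ) :
    X * (1 - X) * derivative (legendre (n + 1)) =
      -(((n : ℝ[X]) + 1) * ((n : ℝ[X]) + 2) * legendreIntegral n) := by
  have h := iterate_derivative_add_two_mul ((X * (1 - X)) ^ (n + 1)) n
  rw [← pow_succ'] at h
  have h1 : C (1 / ((n + 1)! : ℝ)) * derivative^[n + 2] ((X * (1 - X) : ℝ[X]) ^ (n + 1 + 1)) =
      C ((n : ℝ) + 2) * legendre (n + 2) := by
    rw [legendre, ← mul_assoc, ← C_mul, Nat.factorial_succ (n + 1)]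
    have := Nat.factorial_ne_zero (n + 1)
    congr 2
    push_cast
    field_simp
    ring
  have h2 := legendre_add_two' n
  have h3 : derivative (legendre (n + 1)) =
      C (1 / ((n + 1)! : ℝ)) * derivative^[n + 2] ((X * (1 - X)) ^ (n + 1)) := by
    rw [legendre, derivative_C_mul, ← Function.iterate_succ_apply' derivative]
  have h4 : legendre (n + 1) =
      C (1 / ((n + 1)! : ℝ)) * derivative^[n + 1] ((X * (1 - X)) ^ (n + 1)) :=
    rfl
  have h5 : legendreIntegral n =
      C (1 / ((n + 1)! : ℝ)) * derivative^[n] ((X * (1 - X)) ^ (n + 1)) := rfl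
  simp only [map_add, map_ofNat, map_natCast] at h1
  rw [h3]
  generalize C (1 / ((n + 1)! : ℝ)) = k at *
  linear_combination h1 - k * h + ((n : ℝ[X]) + 2) * h2 +
    ((n : ℝ[X]) + 2) * (1 - 2 * X) * h4 - ((n : ℝ[X]) + 2) * ((n : ℝ[X]) + 1) * h5

lemma legendre_zero : legendre 0 = 1 := by simp [legendre]

lemma legendre_one : legendre 1 = 1 - 2 * X := by
  rw [legendre_succ]
  simp

lemma natDegree_legendre_le (n : ℕ) : (legendre n).natDegree ≤ n := by
  refine (natDegree_C_mul_le _ _).trans ((natDegree_iterate_derivative _ _).trans ?_)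
  have h : ((X * (1 - X) : ℝ[X]) ^ n).natDegree ≤ n * 2 := by
    refine natDegree_pow_le_of_le n (natDegree_mul_le_of_le natDegree_X_le (n := 1) ?_)
    exact (natDegree_sub_le _ _).trans (by simp)
  omega

/-! ### Jacobi polynomials -/

/-- The Jacobi polynomial `P_n^{(a, b)}` with integral parameters, as a polynomial in
`s = (x - 1) / 2`. -/
noncomputable def jacobiShift (a b n : ℕ) : ℝ[X] :=
  ∑ k ∈ Finset.range (n + 1), C (n.choose k * (n + a + b + k).choose k *
    (k ! * (a + n)! / ((a + k)! * n !)) : ℝ) * X ^ k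

lemma coeff_jacobiShift (a b n k : ℕ) : (jacobiShift a b n).coeff k =
    n.choose k * (n + a + b + k).choose k * (k ! * (a + n)! / ((a + k)! * n !)) := by
  simp only [jacobiShift, finsetSum_coeff, coeff_C_mul, coeff_X_pow, mul_ite, mul_one, mul_zero]
  rw [Finset.sum_ite_eq]
  split_ifs with h
  · rfl
  · rw [Nat.choose_eq_zero_of_lt (by simpa using h)]
    simp

lemma ascPochhammer_eval_natCast_add_one (m k : ℕ) :
    (ascPochhammer ℝ k).eval ((m : ℝ) + 1) = (m + k)! / m ! := by
  have h := Nat.factorial_mul_ascFactorial m k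
  have hm := Nat.factorial_ne_zero m
  rw [eq_div_iff (by exact_mod_cast hm), ← h, ← ascPochhammer_nat_eq_ascFactorial]
  push_cast
  ring

lemma shiftedJacobi_eq (a b n : ℕ) :
    shiftedJacobi a b n = (jacobiShift a b n).comp (X - 1) := by
  unfold shiftedJacobi jacobi jacobiShift
  simp only [mul_comp, C_comp, Polynomial.sum_comp, pow_comp, sub_comp, X_comp, one_comp]
  rw [Finset.mul_sum]
  refine Finset.sum_congr rfl fun k hk => ?_
  rw [Finset.mem_range] at hk
  have e : C (1 / 2 : ℝ) * (2 * X - 1 - 1) = X - 1 := by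
    have : C (1 / 2 : ℝ) * 2 = 1 := by
      rw [← map_ofNat C, ← C_mul]
      norm_num
    linear_combination (X - 1) * this
  rw [e, ← mul_assoc, ← C_mul]
  congr 2
  have h1 : (n : ℝ) + a + b + 1 = ((n + a + b : ℕ) : ℝ) + 1 := by push_cast; ring
  have h2 : (a : ℝ) + k + 1 = ((a + k : ℕ) : ℝ) + 1 := by push_cast; ring
  rw [h1, h2, ascPochhammer_eval_natCast_add_one, ascPochhammer_eval_natCast_add_one,
    show a + k + (n - k) = a + n by omega, Nat.cast_choose ℝ (Nat.le_add_left k (n + a + b)),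
    Nat.add_sub_cancel]
  have := Nat.factorial_ne_zero n
  have := Nat.factorial_ne_zero k
  have := Nat.factorial_ne_zero (a + k)
  have := Nat.factorial_ne_zero (n + a + b)
  field_simp

lemma legendre_eq (n : ℕ) : legendre n = C ((-1) ^ n) * (jacobiShift 0 0 n).comp (X - 1) := by
  have h1 : (shiftedLegendre n).map (Int.castRingHom ℝ) = legendre n := by
    have h := congrArg (Polynomial.map (Int.castRingHom ℝ)) (factorial_mul_shiftedLegendre_eq n)
    rw [Polynomial.map_mul, Polynomial.map_natCast, ← iterate_derivative_map] at h
    simp only [Polynomial.map_mul, Polynomial.map_pow, Polynomial.map_sub, Polynomial.map_X,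
      Polynomial.map_one] at h
    have hn : C (1 / (n ! : ℝ)) * (n ! : ℝ[X]) = 1 := by
      rw [← map_natCast C, ← C_mul]
      have := Nat.factorial_ne_zero n
      rw [one_div_mul_cancel (by exact_mod_cast this), C_1]
    rw [legendre, mul_pow, ← h, ← mul_assoc, hn, one_mul]
  have h2 := congrArg (Polynomial.map (Int.castRingHom ℝ))
    (neg_one_pow_mul_shiftedLegendre_comp_one_sub_X_eq n)
  rw [Polynomial.map_mul, Polynomial.map_comp] at h2
  simp only [Polynomial.map_pow, Polynomial.map_neg, Polynomial.map_sub, Polynomial.map_X,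
      Polynomial.map_one, h1] at h2
  rw [← h2, map_pow, map_neg, C_1]
  congr 1
  have h3 : jacobiShift 0 0 n =
      ((shiftedLegendre n).map (Int.castRingHom ℝ)).comp (C (-1) * X) := by
    ext k
    rw [coeff_jacobiShift, comp_C_mul_X_coeff, coeff_map, coeff_shiftedLegendre]
    have := Nat.factorial_ne_zero n
    have := Nat.factorial_ne_zero k
    have e : (n + k).choose n = (n + k).choose k := by
      rw [← Nat.choose_symm_add]
    have e2 : ((-1 : ℝ) ^ k) * (-1) ^ k = 1 := by rw [← mul_pow]; simp
    simp only [add_zero, zero_add, e, eq_intCast]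
    push_cast
    field_simp
    linear_combination (-(((n + k).choose k : ℝ) * (n.choose k : ℝ))) * e2
  rw [h3, h1, comp_assoc]
  simp

section choose

variable (n k : ℕ)

lemma cast_choose_succ_right : (n.choose (k + 1) : ℝ) = n.choose k * (n - k) / (k + 1) := by
  have h := Nat.choose_succ_right_eq n k
  rw [eq_div_iff (by positivity)]
  rcases le_or_gt k n with hk | hk
  · have := congrArg (Nat.cast (R := ℝ)) h
    push_cast [Nat.cast_sub hk] at this
    exact this
  · rw [Nat.choose_eq_zero_of_lt hk, Nat.choose_eq_zero_of_lt (by omega)]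
    simp

lemma cast_succ_choose_succ :
    ((n + 1).choose (k + 1) : ℝ) = n.choose k * (n + 1) / (k + 1) := by
  have h := congrArg (Nat.cast (R := ℝ)) (Nat.add_one_mul_choose_eq n k)
  rw [eq_div_iff (by positivity)]
  push_cast at h
  linarith

end choose

lemma coeff_jacobiShift_zero (b n k : ℕ) :
    (jacobiShift 0 b n).coeff k = n.choose k * (n + b + k).choose k := by
  have := Nat.factorial_ne_zero n
  have := Nat.factorial_ne_zero k
  rw [coeff_jacobiShift]
  simp only [zero_add, add_zero]
  field_simp

lemma coeff_jacobiShift_one (b n k : ℕ) : (jacobiShift 1 b n).coeff k =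
    n.choose k * (n + 1 + b + k).choose k * ((n + 1) / (k + 1)) := by
  have := Nat.factorial_ne_zero n
  have := Nat.factorial_ne_zero k
  rw [coeff_jacobiShift, add_comm 1 n, add_comm 1 k, Nat.factorial_succ, Nat.factorial_succ]
  push_cast
  field_simp

lemma derivative_jacobiShift (n : ℕ) :
    derivative (jacobiShift 0 0 (n + 1)) = C ((n : ℝ) + 2) * jacobiShift 1 1 n := by
  ext k
  rw [coeff_derivative, coeff_C_mul, coeff_jacobiShift_zero, coeff_jacobiShift_one,
    cast_succ_choose_succ, show n + 1 + 0 + (k + 1) = n + 1 + 1 + k by ring,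
    cast_choose_succ_right]
  push_cast
  field_simp
  ring

lemma two_mul_X_mul_jacobiShift (n : ℕ) :
    2 * X * jacobiShift 1 0 n = jacobiShift 0 0 (n + 1) - jacobiShift 0 0 n := by
  ext k
  rw [mul_assoc, ← map_ofNat C, coeff_C_mul, coeff_sub, coeff_jacobiShift_zero,
    coeff_jacobiShift_zero]
  rcases k with _ | k
  · simp
  · rw [coeff_X_mul, coeff_jacobiShift_one, cast_succ_choose_succ,
      show n + 1 + 0 + (k + 1) = n + 1 + k + 1 by ring, cast_succ_choose_succ,
      cast_choose_succ_right n k, show n + 0 + (k + 1) = n + 1 + k by ring,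
      cast_choose_succ_right, show n + 1 + 0 + k = n + 1 + k by ring]
    push_cast
    field_simp
    ring

lemma two_mul_sq_mul_jacobiShift (n : ℕ) : 2 * (1 + X) ^ 2 * jacobiShift 0 2 n =
    jacobiShift 0 0 (n + 2) - 2 * X * jacobiShift 0 0 (n + 1) + jacobiShift 0 0 n := by
  have e : 2 * (1 + X) ^ 2 * jacobiShift 0 2 n = C 2 * (jacobiShift 0 2 n +
      C 2 * (X * jacobiShift 0 2 n) + X * (X * jacobiShift 0 2 n)) := by
    rw [map_ofNat]
    ring
  rw [e, mul_assoc, ← map_ofNat C]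
  ext k
  simp only [coeff_add, coeff_sub, coeff_C_mul]
  rcases k with _ | _ | k
  · simp [coeff_jacobiShift_zero]
    norm_num
  · simp [coeff_jacobiShift_zero, coeff_X_mul]
    ring
  · simp only [coeff_X_mul, coeff_jacobiShift_zero]
    rw [show n + 2 + 0 + (k + 1 + 1) = n + 2 + k + 1 + 1 by ring,
      show n + 1 + 0 + (k + 1) = n + 2 + k by ring,
      show n + 0 + (k + 1 + 1) = n + 2 + k by ring,
      show n + 2 + (k + 1) = n + 2 + k + 1 by ring]
    simp only [cast_succ_choose_succ, cast_choose_succ_right]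
    push_cast
    field_simp
    ring

/-! ### The `f`-polynomials in terms of Legendre polynomials -/

section

variable {S : Type*} [CommRing S] (y : S)

lemma derivative_diagSeries_eq : PowerSeries.derivative S (diagSeries y) =
    (1 + PowerSeries.C y * PowerSeries.derivative S (diagSeries y)) * (segSeries y - 1) +
      (PowerSeries.X + PowerSeries.C y * diagSeries y) *
        (1 + (1 + PowerSeries.C y) * PowerSeries.derivative S (diagSeries y)) := by
  have h := congrArg (PowerSeries.derivative S) (diagSeries_eq y)
  rw [segSeries_eq, show (1 + PowerSeries.C y : PowerSeries S) = PowerSeries.C (1 + y) by simp] at h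
  simp only [Derivation.leibniz, map_add, map_sub, smul_eq_mul, PowerSeries.derivative_C,
    PowerSeries.derivative_X, map_one, Derivation.map_one_eq_zero] at h
  rw [segSeries_eq]
  linear_combination h

/-- The differential equation of the inverse of a square root of `1 - 2cx + x²`, where
`c = 1 + 2y`. -/
lemma discriminant_mul_derivative_cyclicSeries :
    (1 - 2 * (1 + 2 * PowerSeries.C y) * PowerSeries.X + PowerSeries.X ^ 2) *
      PowerSeries.derivative S (cyclicSeries y) =
    (1 + 2 * PowerSeries.C y - PowerSeries.X) * cyclicSeries y := by
  have hE := segSeries_eq y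
  have hH := diagSeries_eq y
  have hH' := derivative_diagSeries_eq y
  have h1 := mul_discriminant_root hE hH hH' (cyclicSeries_eq y)
  have h2 := discriminant_root_sq hE hH
  have h3 := congrArg (PowerSeries.derivative S) h1
  have h4 := two_mul_derivative_eq hE hH hH' (cyclicSeries_eq y)
  have e : 2 * (1 + PowerSeries.C y) * (1 - PowerSeries.X - PowerSeries.C y * diagSeries y) -
      (1 + 2 * PowerSeries.C y - PowerSeries.X) = 1 - PowerSeries.C (1 + 2 * y) * PowerSeries.X -
      PowerSeries.C (2 * y * (1 + y)) * diagSeries y := by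
    simp only [map_mul, map_add, map_one, map_ofNat]
    ring
  rw [e] at h1 h2 h3
  rw [← h2]
  have h5 : PowerSeries.derivative S (1 - PowerSeries.C (1 + 2 * y) * PowerSeries.X -
      PowerSeries.C (2 * y * (1 + y)) * diagSeries y) =
      -((1 + 2 * PowerSeries.C y - PowerSeries.X) * cyclicSeries y) := by
    simp only [Derivation.leibniz, map_sub, smul_eq_mul, PowerSeries.derivative_C,
      PowerSeries.derivative_X, Derivation.map_one_eq_zero]
    simp only [map_mul, map_add, map_one, map_ofNat]
    linear_combination -h4
  rw [Derivation.leibniz, h5, Derivation.map_one_eq_zero, smul_eq_mul, smul_eq_mul] at h3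
  generalize 1 - PowerSeries.C (1 + 2 * y) * PowerSeries.X -
    PowerSeries.C (2 * y * (1 + y)) * diagSeries y = δ at *
  linear_combination δ * h3 +
    (1 + 2 * PowerSeries.C y - PowerSeries.X) * cyclicSeries y * h1

lemma coeff_cyclicSeries_recurrence (n : ℕ) :
    ((n : S) + 2) * PowerSeries.coeff (n + 2) (cyclicSeries y) =
    (2 * (n : S) + 3) * (1 + 2 * y) * PowerSeries.coeff (n + 1) (cyclicSeries y) -
      ((n : S) + 1) * PowerSeries.coeff n (cyclicSeries y) := by
  have h := congrArg (PowerSeries.coeff (n + 1)) (discriminant_mul_derivative_cyclicSeries y)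
  rw [show (1 - 2 * (1 + 2 * PowerSeries.C y) * PowerSeries.X + PowerSeries.X ^ 2) *
      PowerSeries.derivative S (cyclicSeries y) = PowerSeries.derivative S (cyclicSeries y) -
      PowerSeries.C (2 * (1 + 2 * y)) *
        (PowerSeries.X * PowerSeries.derivative S (cyclicSeries y)) +
      PowerSeries.X * (PowerSeries.X * PowerSeries.derivative S (cyclicSeries y)) by
        simp only [map_mul, map_add, map_one, map_ofNat]; ring,
    show (1 + 2 * PowerSeries.C y - PowerSeries.X) * cyclicSeries y =
      PowerSeries.C (1 + 2 * y) * cyclicSeries y - PowerSeries.X * cyclicSeries y by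
        simp only [map_mul, map_add, map_one, map_ofNat]; ring,
    map_add, map_sub, map_sub, PowerSeries.coeff_C_mul, PowerSeries.coeff_C_mul,
    PowerSeries.coeff_succ_X_mul, PowerSeries.coeff_succ_X_mul, PowerSeries.coeff_succ_X_mul] at h
  rcases n with _ | n
  · simp [PowerSeries.coeff_derivative] at h ⊢
    linear_combination h
  · rw [PowerSeries.coeff_succ_X_mul] at h
    simp only [PowerSeries.coeff_derivative] at h
    push_cast at h ⊢
    linear_combination h

lemma coeff_zero_cyclicSeries : PowerSeries.coeff 0 (cyclicSeries y) = 1 := by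
  have h := congrArg (PowerSeries.coeff 0) (cyclicSeries_eq y)
  rw [h]
  have h0 : segCount y 0 = 1 := segCount_of_lt y (by omega)
  have h1 := coeff_derivative_diagSeries y 0
  simp at h1
  simp [h1, segSeries, h0]

lemma coeff_one_cyclicSeries : PowerSeries.coeff 1 (cyclicSeries y) = 1 + 2 * y := by
  have h := congrArg (PowerSeries.coeff 0) (discriminant_mul_derivative_cyclicSeries y)
  have h0 := coeff_zero_cyclicSeries y
  have h1 := PowerSeries.coeff_derivative (cyclicSeries y) 0
  have h2 := map_ofNat (PowerSeries.constantCoeff (R := S)) 2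
  simp at h h0 h1
  simpa [h0, h1, h2] using h

/-- The dissections of a polygon in terms of the polynomials of type `B`. -/
lemma mul_diagCount_eq (n : ℕ) : 2 * y * (1 + y) * ((n : S) + 2) * diagCount y (n + 2) =
    (1 + 2 * y) * PowerSeries.coeff (n + 1) (cyclicSeries y) -
      PowerSeries.coeff n (cyclicSeries y) := by
  have h := congrArg (PowerSeries.coeff (n + 1)) (two_mul_derivative_eq (segSeries_eq y)
    (diagSeries_eq y) (derivative_diagSeries_eq y) (cyclicSeries_eq y))
  rw [show 2 * PowerSeries.C y * (1 + PowerSeries.C y) * PowerSeries.derivative S (diagSeries y) =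
      PowerSeries.C (2 * y * (1 + y)) * PowerSeries.derivative S (diagSeries y) by
        simp only [map_mul, map_add, map_one, map_ofNat],
    show (1 + 2 * PowerSeries.C y - PowerSeries.X) * cyclicSeries y - (1 + 2 * PowerSeries.C y) =
      PowerSeries.C (1 + 2 * y) * cyclicSeries y - PowerSeries.X * cyclicSeries y -
        PowerSeries.C (1 + 2 * y) by
        simp only [map_mul, map_add, map_one, map_ofNat]; ring,
    map_sub, map_sub, PowerSeries.coeff_C_mul, PowerSeries.coeff_C_mul,
    PowerSeries.coeff_succ_X_mul, PowerSeries.coeff_C, if_neg (by omega),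
    coeff_derivative_diagSeries, if_neg (by omega)] at h
  push_cast at h
  rw [show (n : ℤ) + 1 + 1 = n + 2 by ring] at h
  linear_combination h

/-- The polynomial of type `D` in terms of those of type `B`. -/
lemma two_mul_tagged_eq (n : ℕ) :
    2 * cliquePoly y (CompatTagged (n + 2)) (taggedArcs (n + 2)) =
    2 * PowerSeries.coeff (n + 2) (cyclicSeries y) -
      (1 + 2 * y) * PowerSeries.coeff (n + 1) (cyclicSeries y) +
      PowerSeries.coeff n (cyclicSeries y) := by
  have h := congrArg (PowerSeries.coeff (n + 2)) (two_mul_mul_eq (segSeries_eq y)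
    (diagSeries_eq y) (derivative_diagSeries_eq y) (cyclicSeries_eq y) (fanSeries_one_eq y)
    (fanSeries_zero_eq y) (doubleFanSeries_eq y) (taggedSeries_eq y))
  rw [show 2 * (PowerSeries.X * taggedSeries y) =
      PowerSeries.C 2 * (PowerSeries.X * taggedSeries y) by rw [map_ofNat],
    show 2 * cyclicSeries y - PowerSeries.X * cyclicSeries y *
        (1 + 2 * PowerSeries.C y - PowerSeries.X) - 2 - PowerSeries.C y * PowerSeries.X +
        (1 + PowerSeries.C y) * (1 + 2 * PowerSeries.C y) * PowerSeries.X =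
      PowerSeries.C 2 * cyclicSeries y -
        PowerSeries.C (1 + 2 * y) * (PowerSeries.X * cyclicSeries y) +
        PowerSeries.X * (PowerSeries.X * cyclicSeries y) - PowerSeries.C 2 +
        PowerSeries.C (1 + 2 * y + 2 * y ^ 2) * PowerSeries.X by
        simp only [map_mul, map_add, map_one, map_ofNat, map_pow]; ring] at h
  rw [map_add, map_sub, map_add, map_sub] at h
  simp only [PowerSeries.coeff_C_mul, PowerSeries.coeff_succ_X_mul, PowerSeries.coeff_C,
    PowerSeries.coeff_X] at h
  rw [if_neg (by omega), if_neg (by omega), taggedSeries, PowerSeries.coeff_mk] at h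
  push_cast at h
  rw [cliquePoly_taggedArcs y (by omega), show (n : ℤ) + 2 - 1 = n + 1 by ring]
  rw [show (n : ℤ) + 1 + 1 = n + 2 by ring] at h
  linear_combination h

end

/-! ### The three types -/

lemma natCast_add_ne_zero (n m : ℕ) (hm : m ≠ 0) : (n : ℝ[X]) + (m : ℝ[X]) ≠ 0 := by
  rw [← Nat.cast_add, Nat.cast_ne_zero]
  omega

/-- The polynomials of type `B` are the Legendre polynomials, as both satisfy the three term
recurrence. -/
lemma coeff_cyclicSeries (n : ℕ) :
    PowerSeries.coeff n (cyclicSeries (-X : ℝ[X])) = legendre n := by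
  induction n using Nat.twoStepInduction with
  | zero => rw [coeff_zero_cyclicSeries, legendre_zero]
  | one =>
    rw [coeff_one_cyclicSeries, legendre_one]
    ring
  | more n h1 h2 =>
    have h := coeff_cyclicSeries_recurrence (-X : ℝ[X]) n
    rw [h1, h2] at h
    refine mul_left_cancel₀ (natCast_add_ne_zero n 2 two_ne_zero) ?_
    have h' := legendre_recurrence n
    push_cast
    linear_combination h - h'

lemma mul_diagCount_eq_legendreIntegral (n : ℕ) :
    X * (1 - X) * diagCount (-X : ℝ[X]) (n + 2) = legendreIntegral n := by
  have h := mul_diagCount_eq (-X : ℝ[X]) n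
  rw [coeff_cyclicSeries, coeff_cyclicSeries] at h
  have h1 := legendre_add_two n
  have h2 := legendre_add_two' n
  refine mul_left_cancel₀ (natCast_add_ne_zero n 2 two_ne_zero) ?_
  refine mul_left_cancel₀ (two_ne_zero (α := ℝ[X])) ?_
  simp only [map_add, map_mul, map_ofNat, map_natCast] at h1
  push_cast
  linear_combination h2 - h1 - h

lemma X_mul_one_sub_X_ne_zero : (X * (1 - X) : ℝ[X]) ≠ 0 := by
  intro h
  have := congrArg (eval 2) h
  norm_num at this

/-- Up to a factor, the polynomial of type `A` is the derivative of a Legendre polynomial, and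
derivatives of Jacobi polynomials are Jacobi polynomials with both parameters raised by one. -/
lemma diagCount_eq_jacobi (n : ℕ) : diagCount (-X : ℝ[X]) (n + 2) =
    C ((-1) ^ n / ((n : ℝ) + 1)) * shiftedJacobi 1 1 n := by
  have h := mul_one_sub_mul_derivative_legendre n
  rw [← mul_diagCount_eq_legendreIntegral] at h
  have h1 : derivative (legendre (n + 1)) =
      -(((n : ℝ[X]) + 1) * ((n : ℝ[X]) + 2) * diagCount (-X : ℝ[X]) (n + 2)) :=
    mul_left_cancel₀ X_mul_one_sub_X_ne_zero (by linear_combination h)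
  have h2 : shiftedJacobi 1 1 n = (jacobiShift 1 1 n).comp (X - 1) := by
    simpa using shiftedJacobi_eq 1 1 n
  rw [legendre_eq, derivative_C_mul, derivative_comp, derivative_jacobiShift, mul_comp, C_comp,
    ← h2] at h1
  simp only [derivative_sub, derivative_X, derivative_one, sub_zero, one_mul] at h1
  refine mul_left_cancel₀ (natCast_add_ne_zero n 2 two_ne_zero) ?_
  refine mul_left_cancel₀ (natCast_add_ne_zero n 1 one_ne_zero) ?_
  have h3 : ((n : ℝ[X]) + 1) * C ((-1) ^ n / ((n : ℝ) + 1)) = C ((-1) ^ n) := by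
    rw [← map_natCast C, ← C_1, ← C_add, ← C_mul, mul_div_cancel₀]
    positivity
  have h4 : (C ((-1) ^ (n + 1)) : ℝ[X]) = -C ((-1) ^ n) := by
    rw [pow_succ, ← C_neg]
    congr 1
    ring
  simp only [map_add, map_ofNat, map_natCast, h4] at h1
  push_cast
  linear_combination h1 - ((n : ℝ[X]) + 2) * shiftedJacobi 1 1 n * h3

lemma natDegree_diagCount_le (n : ℕ) : (diagCount (-X : ℝ[X]) (n + 2)).natDegree ≤ n := by
  have h := mul_diagCount_eq_legendreIntegral n
  -- Dividing by `X * (1 - X)` lowers the degree by two.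
  have h1 : (legendreIntegral n).natDegree ≤ n + 2 := by
    refine (natDegree_C_mul_le _ _).trans ((natDegree_iterate_derivative _ _).trans ?_)
    have : ((X * (1 - X) : ℝ[X]) ^ (n + 1)).natDegree ≤ (n + 1) * 2 := by
      refine natDegree_pow_le_of_le _ (natDegree_mul_le_of_le natDegree_X_le (n := 1) ?_)
      exact (natDegree_sub_le _ _).trans (by simp)
    omega
  by_cases h0 : diagCount (-X : ℝ[X]) (n + 2) = 0
  · simp [h0]
  · rw [← h, natDegree_mul X_mul_one_sub_X_ne_zero h0] at h1
    have h2 : (X * (1 - X) : ℝ[X]).natDegree = 2 := by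
      rw [natDegree_mul X_ne_zero (by
        intro h
        have := congrArg (eval 2) h
        norm_num at this), natDegree_X,
        ← neg_sub, natDegree_neg, ← C_1, natDegree_X_sub_C]
    omega

lemma fA_eq (l : ℕ) : fA l = diagCount (-X : ℝ[X]) (l + 2) := by
  have e : cliquePoly (-X : ℝ[X]) (modelA l).compat (modelA l).verts =
      diagCount (-X : ℝ[X]) (l + 2) := by
    change cliquePoly (-X : ℝ[X]) Noncrossing (diagonals (loA l) (hiA l)) = _
    rw [cliquePoly_diagonals, hiA]
    congr 1
    ring
  rw [fA, (modelA l).fPolynomial_eq (e ▸ natDegree_diagCount_le l), e]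

lemma fB_eq (l : ℕ) : fB l = legendre l := by
  have e : cliquePoly (-X : ℝ[X]) (modelB l).compat (modelB l).verts = legendre l := by
    rw [← coeff_cyclicSeries, cyclicSeries, PowerSeries.coeff_mk]
    rfl
  rw [fB, (modelB l).fPolynomial_eq (e ▸ natDegree_legendre_le l), e]

lemma two_mul_fD (n : ℕ) (hn : 2 ≤ n) : 2 * fD (n + 2) =
    2 * legendre (n + 2) - (1 - 2 * X) * legendre (n + 1) + legendre n := by
  have e : 2 * cliquePoly (-X : ℝ[X]) (modelD (n + 2) (by omega)).compat
      (modelD (n + 2) (by omega)).verts =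
      2 * legendre (n + 2) - (1 - 2 * X) * legendre (n + 1) + legendre n := by
    have h := two_mul_tagged_eq (-X : ℝ[X]) n
    simp only [coeff_cyclicSeries] at h
    change 2 * cliquePoly (-X : ℝ[X]) (CompatTagged ((n + 2 : ℕ) : ℤ))
      (taggedArcs ((n + 2 : ℕ) : ℤ)) = _
    push_cast
    linear_combination h
  rw [fD, Model.fPolynomial_eq (modelD (n + 2) (by omega)), e]
  have h1 : (C 2 * cliquePoly (-X : ℝ[X]) (modelD (n + 2) (by omega)).compat
      (modelD (n + 2) (by omega)).verts).natDegree ≤ n + 2 := by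
    rw [map_ofNat, e]
    refine natDegree_add_le_of_degree_le
      ((natDegree_sub_le_of_le (m := n + 2) (n := n + 2) ?_ ?_).trans (max_self _).le)
      ((natDegree_legendre_le n).trans (by omega))
    · rw [← map_ofNat C]
      exact (natDegree_C_mul_le _ _).trans (natDegree_legendre_le _)
    · refine (natDegree_mul_le_of_le (m := 1) ?_ (natDegree_legendre_le (n + 1))).trans (by omega)
      refine (natDegree_sub_le _ _).trans ?_
      rw [← map_ofNat C, natDegree_C_mul_X _ two_ne_zero]
      simp
  rwa [natDegree_C_mul two_ne_zero] at h1

/-- The first derivative in the Rodrigues type formula of type `D`. -/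
lemma iterate_derivative_mul_one_sub (n : ℕ) :
    C (1 / ((n + 1)! : ℝ)) * derivative^[n + 1] (X ^ (n + 1) * (1 - X) ^ (n + 2)) =
      (1 - X) * legendre (n + 1) - ((n : ℝ[X]) + 1) * legendreIntegral n := by
  rw [show (X : ℝ[X]) ^ (n + 1) * (1 - X) ^ (n + 2) =
    (X * (1 - X)) ^ (n + 1) - X * (X * (1 - X)) ^ (n + 1) by rw [mul_pow]; ring,
    iterate_derivative_sub, iterate_derivative_succ_X_mul, legendre, legendreIntegral]
  ring

/-- The second derivative in the Rodrigues type formula of type `D`. -/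
lemma iterate_derivative_sq_mul (n : ℕ) :
    2 * (C (1 / (n ! : ℝ)) * derivative^[n] (X ^ (n + 2) * (1 - X) ^ n)) =
      legendre n - legendre (n + 1) - 2 * ((n : ℝ[X]) + 1) * legendreIntegral n := by
  have e : (X : ℝ[X]) ^ (n + 2) * (1 - X) ^ n = C (1 / 2) * (X * (1 - X)) ^ n -
      C (1 / 2) * ((1 - 2 * X) * (X * (1 - X)) ^ n) - (X * (1 - X)) ^ (n + 1) := by
    have : C (1 / 2 : ℝ) * 2 = 1 := by
      rw [← map_ofNat C, ← C_mul]
      norm_num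
    rw [pow_succ (X * (1 - X)), mul_pow]
    linear_combination (-(X ^ (n + 1) * (1 - X) ^ n)) * this
  have h1 : C (1 / (n ! : ℝ)) = ((n : ℝ[X]) + 1) * C (1 / ((n + 1)! : ℝ)) := by
    rw [← map_natCast C, ← C_1, ← C_add, ← C_mul, Nat.factorial_succ]
    have := Nat.factorial_ne_zero n
    congr 1
    push_cast
    field_simp
  have h2 : 2 * C (1 / 2 : ℝ) = 1 := by
    rw [← map_ofNat C, ← C_mul]
    norm_num
  rw [e, iterate_derivative_sub, iterate_derivative_sub, iterate_derivative_C_mul,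
    iterate_derivative_C_mul, legendre_succ, legendre, legendreIntegral]
  linear_combination (C (1 / (n ! : ℝ)) * derivative^[n] ((X * (1 - X)) ^ n) -
    C (1 / (n ! : ℝ)) * derivative^[n] ((1 - 2 * X) * (X * (1 - X)) ^ n)) * h2 -
    2 * derivative^[n] ((X * (1 - X)) ^ (n + 1)) * h1

lemma fD_eq_add (n : ℕ) (hn : 2 ≤ n) : fD (n + 2) =
    C (1 / ((n + 1)! : ℝ)) * derivative^[n + 1] (X ^ (n + 1) * (1 - X) ^ (n + 2)) +
      C (1 / (n ! : ℝ)) * derivative^[n] (X ^ (n + 2) * (1 - X) ^ n) := by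
  refine mul_left_cancel₀ (two_ne_zero (α := ℝ[X])) ?_
  linear_combination two_mul_fD n hn - 2 * iterate_derivative_mul_one_sub n -
    iterate_derivative_sq_mul n + 2 * legendre_add_two' n

lemma fD_eq_iterate_derivative (n : ℕ) (hn : 2 ≤ n) : fD (n + 2) =
    C (1 / ((n + 1)! : ℝ)) * derivative^[n] (X ^ n * (1 - X) ^ n *
      (C ((n : ℝ) + 1) - C (3 * (n : ℝ) + 4) * X + C (3 * (n : ℝ) + 4) * X ^ 2)) := by
  have e : X ^ n * (1 - X) ^ n *
      (C ((n : ℝ) + 1) - C (3 * (n : ℝ) + 4) * X + C (3 * (n : ℝ) + 4) * X ^ 2) =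
      C ((n : ℝ) + 1) * (X * (1 - X)) ^ n - C (3 * (n : ℝ) + 4) * (X * (1 - X)) ^ (n + 1) := by
    rw [pow_succ (X * (1 - X)), mul_pow]
    ring
  have h : C (1 / ((n + 1)! : ℝ)) * C ((n : ℝ) + 1) = C (1 / (n ! : ℝ)) := by
    rw [← C_mul, Nat.factorial_succ]
    have := Nat.factorial_ne_zero n
    congr 1
    push_cast
    field_simp
  have h1 := legendre_add_two n
  simp only [map_add, map_mul, map_ofNat, map_natCast] at h1
  have h2 : legendre n = C (1 / (n ! : ℝ)) * derivative^[n] ((X * (1 - X)) ^ n) := rfl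
  have h3 : legendreIntegral n =
    C (1 / ((n + 1)! : ℝ)) * derivative^[n] ((X * (1 - X)) ^ (n + 1)) := rfl
  have h4 : C (3 * (n : ℝ) + 4) = 3 * (n : ℝ[X]) + 4 := by
    simp only [map_add, map_mul, map_ofNat, map_natCast]
  rw [e, iterate_derivative_sub, iterate_derivative_C_mul, iterate_derivative_C_mul, mul_sub,
    ← mul_assoc, h, ← h2, mul_left_comm, ← h3, h4]
  refine mul_left_cancel₀ (two_ne_zero (α := ℝ[X])) ?_
  linear_combination two_mul_fD n hn + h1 + legendre_add_two' n

lemma fD_eq_jacobi (n : ℕ) (hn : 2 ≤ n) : fD (n + 2) =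
    C ((-1) ^ (n + 1)) * (1 - X) * shiftedJacobi 1 0 (n + 1) +
      C ((-1) ^ (n + 2)) * X ^ 2 * shiftedJacobi 0 2 n := by
  have h1 : shiftedJacobi 1 0 (n + 1) = (jacobiShift 1 0 (n + 1)).comp (X - 1) := by
    simpa using shiftedJacobi_eq 1 0 (n + 1)
  have h2 : shiftedJacobi 0 2 n = (jacobiShift 0 2 n).comp (X - 1) := by
    simpa using shiftedJacobi_eq 0 2 n
  have h3 := congrArg (fun p => p.comp (X - 1)) (two_mul_X_mul_jacobiShift (n + 1))
  have h4 := congrArg (fun p => p.comp (X - 1)) (two_mul_sq_mul_jacobiShift n)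
  simp only [mul_comp, sub_comp, add_comp, pow_comp, X_comp, one_comp, ofNat_comp] at h3 h4
  rw [← h1] at h3
  rw [← h2] at h4
  have hs : ∀ m, (C ((-1) ^ (m + 1)) : ℝ[X]) = -C ((-1) ^ m) := fun m => by
    rw [pow_succ, ← C_neg]
    congr 1
    ring
  have h5 := two_mul_fD n hn
  rw [legendre_eq, legendre_eq, legendre_eq, hs (n + 1), hs n] at h5
  rw [hs (n + 1), hs n]
  refine mul_left_cancel₀ (two_ne_zero (α := ℝ[X])) ?_
  linear_combination h5 - C ((-1) ^ n) * h3 - C ((-1) ^ n) * h4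

end ClusterComplex

theorem theorem2p2 :
    (∀ l : ℕ, 1 ≤ l →
      X * (1 - X) * fA l =
          C (1 / ((l + 1)! : ℝ)) * derivative^[l] (X ^ (l + 1) * (1 - X) ^ (l + 1)) ∧
      fA l = C ((-1) ^ l / ((l : ℝ) + 1)) * shiftedJacobi 1 1 l) ∧
    (∀ l : ℕ, 2 ≤ l →
      fB l = C (1 / (l ! : ℝ)) * derivative^[l] (X ^ l * (1 - X) ^ l) ∧
      fB l = C ((-1) ^ l) * shiftedJacobi 0 0 l) ∧
    (∀ l : ℕ, 4 ≤ l →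
      fD l = C (1 / ((l - 1)! : ℝ)) * derivative^[l - 1] (X ^ (l - 1) * (1 - X) ^ l) +
          C (1 / ((l - 2)! : ℝ)) * derivative^[l - 2] (X ^ l * (1 - X) ^ (l - 2)) ∧
      fD l = C (1 / ((l - 1)! : ℝ)) * derivative^[l - 2] (X ^ (l - 2) * (1 - X) ^ (l - 2) *
          (C ((l : ℝ) - 1) - C (3 * (l : ℝ) - 2) * X + C (3 * (l : ℝ) - 2) * X ^ 2)) ∧
      fD l = C ((-1) ^ (l - 1)) * (1 - X) * shiftedJacobi 1 0 (l - 1) +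
          C ((-1) ^ l) * X ^ 2 * shiftedJacobi 0 2 (l - 2)) := by
  refine ⟨fun l _ => ⟨?_, ?_⟩, fun l _ => ⟨?_, ?_⟩, fun l hl => ?_⟩
  · rw [ClusterComplex.fA_eq, ClusterComplex.mul_diagCount_eq_legendreIntegral, ← mul_pow]
    rfl
  · rw [ClusterComplex.fA_eq, ClusterComplex.diagCount_eq_jacobi]
  · rw [ClusterComplex.fB_eq, ← mul_pow]
    rfl
  · rw [ClusterComplex.fB_eq, ClusterComplex.legendre_eq, ← ClusterComplex.shiftedJacobi_eq]
    simp
  · obtain ⟨n, rfl⟩ : ∃ n, l = n + 2 := ⟨l - 2, by omega⟩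
    refine ⟨ClusterComplex.fD_eq_add n (by omega), ?_, ClusterComplex.fD_eq_jacobi n (by omega)⟩
    rw [ClusterComplex.fD_eq_iterate_derivative n (by omega)]
    have h1 : ((n + 2 : ℕ) : ℝ) - 1 = n + 1 := by push_cast; ring
    have h2 : 3 * ((n + 2 : ℕ) : ℝ) - 2 = 3 * n + 4 := by push_cast; ring
    rw [h1, h2]
    rfl
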